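/- For $\operatorname{Im}\tau>0$ put $q=e^{2\pi i\tau}$ and let $$\theta(z|\tau)=-i\sum_{n\in\mathbb Z}(-1)^n e^{(n+1/2)^2\pi i\tau+(2n+1)iz},$$ with primes denoting $z$-derivatives. For the weight $\gamma=-2\cos 2\alpha$ define the functions $$t=\frac{\cos\alpha}{64\sin^3\alpha}\left(-\frac{\theta(\alpha)\theta'''(\alpha)}{\theta'(\alpha)^2}+\frac{\theta''(\alpha)}{\theta'(\alpha)}\right),\qquad R=\frac{\cos^2\alpha}{96\sin^4\alpha}\,\frac{\theta(\alpha)^2}{\theta'(\alpha)^2}\left(-\frac{\theta'''(\alpha)}{\theta'(\alpha)}+\frac{\theta'''(0)}{\theta'(0)}\right),$$ $$A=\frac{\theta'(\alpha)}{\theta(\alpha)},\qquad D=q\frac{d}{dq}=\frac1{2\pi i}\frac{d}{d\tau},\qquad S=\frac{8\sin^4\alpha}{\cos^2\alpha}\,\frac{A^2}{DR}.$$ Let $\eta(q)=q^{1/24}\prod_{n\ge1}(1-q^n)$ and $h=\left(\eta(q^3)/\eta(q)\right)^{12}$. Take $\gamma=1$, i.e. $\alpha=\pi/3$. Then: 1.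 For all $\tau$ with $\operatorname{Im}\tau>0$, $$\theta(\alpha)/\sqrt3=\eta(q^3)\ne0,\qquad \sqrt3A=1+6\sum_{n\ge1}\frac{q^n}{1+q^n+q^{2n}}=\sum_{m,n\in\mathbb Z}q^{m^2+mn+n^2},$$ and $h\neq 0$. Moreover, whenever $\theta'(\alpha|\tau)\ne0$ (all denominators below are then non-zero), $$R=\frac{h}{1+27h}=\frac1{27}\left(\frac{\sum_{m,n\in\mathbb Z+1/3}q^{m^2+mn+n^2}}{\sum_{m,n\in\mathbb Z}q^{m^2+mn+n^2}}\right)^3,\qquad \frac S6=\frac{(1+27h)^2}{h}=\frac1{R(1-27R)},$$ where $q^x=e^{2\pi i\tau x}$. 2. Near $q=0$ the functions $t$, $R$ and $A$ are given by convergent power series in $q$, with $t=q+O(q^2)$ and $R=q+O(q^2)$, and as formal power series in $q$ $$t=R\;{}_2F_1(1/3,2/3;2;27R),\qquad \sqrt3A={}_2F_1(1/3,2/3;1;27R).$$ There is a unique formal power series $q(t)$ with constant term $0$ that inverts $t(q)$. The series $R(t)=R(q(t))$ satisfies $t=R(t)\,{}_2F_1(1/3,2/3;2;27R(t))$ and is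 the unique formal power series with constant term $0$ such that $$t=\sum_{n\ge0}\frac1{n+1}\binom{2n}{n}\binom{3n}{n}R(t)^{n+1},$$ which is the formula of Bousquet-Mélou and Elvey Price for $R(t)$. There is likewise a unique formal power series $q(R)$ with constant term $0$ that inverts $R(q)$. The series $t$ and $A$, expressed through it as formal power series in $R$, are $t=R\,{}_2F_1(1/3,2/3;2;27R)$ and $\sqrt3A={}_2F_1(1/3,2/3;1;27R)$, and they satisfy $$R(1-27R)\frac{d^2t}{dR^2}-6t=0,\qquad R(1-27R)\frac{d^2A}{dR^2}+(1-54R)\frac{dA}{dR}-6A=0.$$ 3. On the interval $0<x<1/27$ the functions ${}_2F_1(1/3,2/3;1;27x)$ and ${}_2F_1(1/3,2/3;1;1-27x)$ are real analytic, linearly independent over $\mathbb R$, and both solve $x(1-27x)f''+(1-54x)f'-6f=0$. 4. If $0<q<1$, i.e. $\tau=iy$ with $y>0$, then $R$ is real with $0<27R<1$, and $$t=R\;{}_2F_1(1/3,2/3;2;27R),\qquad \sqrt3A={}_2F_1(1/3,2/3;1;27R)\neq 0,\qquad \tau A=\frac i3\;{}_2F_1(1/3,2/3;1;1-27R),$$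 and Ramanujan's identity holds: $$q=\exp\left(-\frac{2\pi}{\sqrt3}\;\frac{{}_2F_1(1/3,2/3;1;1-27R)}{{}_2F_1(1/3,2/3;1;27R)}\right).$$ -/

import Mathlib

noncomputable section

namespace SixVertex

/-- The nome `q = e^{2πiτ}`. -/
def nome (τ : ℂ) : ℂ := Complex.exp (2 * Real.pi * Complex.I * τ)

/-- The Jacobi theta function
`θ(z|τ) = -i ∑_{n ∈ ℤ} (-1)^n e^{(n+1/2)² πiτ + (2n+1)iz}`. -/
def theta (z τ : ℂ) : ℂ :=
  -Complex.I * ∑' n : ℤ, (-1 : ℂ) ^ n *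
    Complex.exp (((n : ℂ) + 1 / 2) ^ 2 * Real.pi * Complex.I * τ
      + (2 * (n : ℂ) + 1) * Complex.I * z)

/-- The `k`-th derivative of `θ` with respect to its first variable `z`. -/
def thetaD (k : ℕ) (z τ : ℂ) : ℂ := iteratedDeriv k (fun w => theta w τ) z

/-- The function `t` of `τ` (for the weight `γ = -2 cos 2α`). -/
def tFun (α τ : ℂ) : ℂ :=
  Complex.cos α / (64 * Complex.sin α ^ 3) *
    (-(theta α τ * thetaD 3 α τ / thetaD 1 α τ ^ 2) + thetaD 2 α τ / thetaD 1 α τ)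

/-- The function `R` of `τ` (for the weight `γ = -2 cos 2α`). -/
def RFun (α τ : ℂ) : ℂ :=
  Complex.cos α ^ 2 / (96 * Complex.sin α ^ 4) * (theta α τ ^ 2 / thetaD 1 α τ ^ 2) *
    (-(thetaD 3 α τ / thetaD 1 α τ) + thetaD 3 0 τ / thetaD 1 0 τ)

/-- The logarithmic derivative `A = θ'(α|τ) / θ(α|τ)`. -/
def AFun (α τ : ℂ) : ℂ := thetaD 1 α τ / theta α τ

/-- The operator `D = q d/dq = (1 / 2πi) d/dτ`. -/
def D (f : ℂ → ℂ) (τ : ℂ) : ℂ := deriv f τ / (2 * Real.pi * Complex.I)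

/-- `S = (8 sin⁴α / cos²α) · A² / (D R)`. -/
def SFun (α τ : ℂ) : ℂ :=
  8 * Complex.sin α ^ 4 / Complex.cos α ^ 2 * (AFun α τ ^ 2 / D (RFun α) τ)

/-- `h = (η(q³) / η(q))¹²`, with `η` the Dedekind eta function, written in the variable `τ`. -/
def hFun (τ : ℂ) : ℂ := (ModularForm.eta (3 * τ) / ModularForm.eta τ) ^ 12

/-- The term `q^{m² + mn + n²}` with `m`, `n` shifted by `s`, i.e. with `(m, n) ∈ (ℤ + s)²`. -/
def latticeTerm (s τ : ℂ) (p : ℤ × ℤ) : ℂ :=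
  Complex.exp (2 * Real.pi * Complex.I * τ *
    (((p.1 : ℂ) + s) ^ 2 + ((p.1 : ℂ) + s) * ((p.2 : ℂ) + s) + ((p.2 : ℂ) + s) ^ 2))

/-- `∑_{m, n ∈ ℤ + s} q^{m² + mn + n²}`. -/
def latticeSum (s τ : ℂ) : ℂ := ∑' p : ℤ × ℤ, latticeTerm s τ p

/-- `P` is the expansion of `f` as a power series in `q = e^{2πiτ}`: for all `τ` with large enough
imaginary part, the series `P` converges at `q` to `f τ`. -/
def IsQExpansion (P : PowerSeries ℂ) (f : ℂ → ℂ) : Prop :=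
  ∃ Y : ℝ, ∀ τ : ℂ, Y < τ.im →
    HasSum (fun n : ℕ => PowerSeries.coeff n P * nome τ ^ n) (f τ)

/-- The Gauss hypergeometric series `₂F₁(a, b; c; X)` as a formal power series. -/
def hypSeries (a b c : ℂ) : PowerSeries ℂ :=
  PowerSeries.mk fun n => ordinaryHypergeometricCoefficient a b c n

/-- The formal power series `∑_{n ≥ 0} (1 / (n+1)) (2n choose n) (3n choose n) X^{n+1}`. -/
def binomialSeries : PowerSeries ℂ :=
  PowerSeries.X * PowerSeries.mk fun n : ℕ =>
    (1 / ((n : ℂ) + 1)) * ((2 * n).choose n : ℂ) * ((3 * n).choose n : ℂ)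

/-- `s` is the formal power series with constant term `0` satisfying `P(s(X)) = X`. -/
def IsRightInverse (P s : PowerSeries ℂ) : Prop :=
  PowerSeries.constantCoeff s = 0 ∧ PowerSeries.subst s P = PowerSeries.X

/-- The left-hand side of `x (1 - 27 x) f'' + (1 - 54 x) f' - 6 f = 0` for real functions. -/
def hypOperator (f : ℝ → ℝ) (x : ℝ) : ℝ :=
  x * (1 - 27 * x) * deriv (deriv f) x + (1 - 54 * x) * deriv f x - 6 * f x

/-- The real function `x ↦ ₂F₁(1/3, 2/3; c; x)`, used for `|x| < 1`. -/
def F (c x : ℝ) : ℝ := ordinaryHypergeometric (1 / 3 : ℝ) (2 / 3 : ℝ) c x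

end SixVertex

end

noncomputable section

namespace SixVertex

open Complex Filter Topology
open scoped Real

/-! ### Theta series with characteristics and their moments -/

/-- The general term of `gSum`. -/
def gTerm (k : ℕ) (δ : ℝ) (z τ : ℂ) (n : ℤ) : ℂ :=
  ((n : ℂ) + δ) ^ k * cexp (2 * π * I * (τ * ((n : ℂ) + δ) ^ 2 + ((n : ℂ) + δ) * z))

/-- The theta series `∑ (n + δ)^k e(τ (n + δ)² + (n + δ) z)`, where `e(x) = exp (2πix)`. -/
def gSum (k : ℕ) (δ : ℝ) (z τ : ℂ) : ℂ := ∑' n : ℤ, gTerm k δ z τ n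

/-- A summable bound for `gTerm`, uniform for `T ≤ im τ` and `|im z| ≤ S`. -/
def gBound (k : ℕ) (δ S T : ℝ) (n : ℤ) : ℝ :=
  (2 ^ (k - 1) * Real.exp (2 * π * S * |δ|)) *
    ((|n| : ℝ) ^ k * Real.exp (-π * ((2 * T) * n ^ 2 - 2 * (2 * T * |δ| + S) * |n|))
      + |δ| ^ k * ((|n| : ℝ) ^ 0 *
          Real.exp (-π * ((2 * T) * n ^ 2 - 2 * (2 * T * |δ| + S) * |n|))))

lemma summable_gBound (k : ℕ) (δ S : ℝ) {T : ℝ} (hT : 0 < T) : Summable (gBound k δ S T) := by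
  refine Summable.mul_left _ (Summable.add ?_ (Summable.mul_left _ ?_))
  · simpa using summable_pow_mul_jacobiTheta₂_term_bound (2 * T * |δ| + S) (T := 2 * T)
      (by positivity) k
  · simpa using summable_pow_mul_jacobiTheta₂_term_bound (2 * T * |δ| + S) (T := 2 * T)
      (by positivity) 0

lemma norm_gTerm_le (k : ℕ) (δ : ℝ) {S T : ℝ} (hT : 0 < T) {z τ : ℂ}
    (hz : |z.im| ≤ S) (hτ : T ≤ τ.im) (n : ℤ) : ‖gTerm k δ z τ n‖ ≤ gBound k δ S T n := by
  have hS : 0 ≤ S := (abs_nonneg _).trans hz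
  have h1 : ‖((n : ℂ) + δ) ^ k‖ ≤ 2 ^ (k - 1) * ((|n| : ℝ) ^ k + |δ| ^ k) := by
    rw [norm_pow]
    refine (pow_le_pow_left₀ (norm_nonneg _) ?_ k).trans
      (add_pow_le (abs_nonneg _) (abs_nonneg _) k)
    refine (norm_add_le _ _).trans ?_
    simp
  have h2 : ‖cexp (2 * π * I * (τ * ((n : ℂ) + δ) ^ 2 + ((n : ℂ) + δ) * z))‖ ≤
      Real.exp (2 * π * S * |δ|) *
        Real.exp (-π * ((2 * T) * n ^ 2 - 2 * (2 * T * |δ| + S) * |n|)) := by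
    rw [Complex.norm_exp, ← Real.exp_add, Real.exp_le_exp]
    have e1 : (2 * π * I * (τ * ((n : ℂ) + δ) ^ 2 + ((n : ℂ) + δ) * z)).re =
        -2 * π * (τ.im * ((n : ℝ) + δ) ^ 2 + ((n : ℝ) + δ) * z.im) := by
      have : (2 * π * I * (τ * ((n : ℂ) + δ) ^ 2 + ((n : ℂ) + δ) * z)) =
        ((2 * π * ((n : ℝ) + δ) ^ 2 : ℝ) : ℂ) * (τ * I) +
          ((2 * π * ((n : ℝ) + δ) : ℝ) : ℂ) * (z * I) := by
        push_cast; ring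
      rw [this, add_re, re_ofReal_mul, re_ofReal_mul, mul_I_re, mul_I_re]
      ring
    rw [e1]
    have e2 : T * ((n : ℝ) ^ 2 - 2 * |δ| * |(n : ℝ)|) ≤ τ.im * ((n : ℝ) + δ) ^ 2 := by
      have : (n : ℝ) ^ 2 - 2 * |δ| * |(n : ℝ)| ≤ ((n : ℝ) + δ) ^ 2 := by
        have := neg_abs_le ((n : ℝ) * δ)
        rw [abs_mul] at this
        nlinarith [sq_nonneg δ]
      calc _ ≤ T * ((n : ℝ) + δ) ^ 2 := by gcongr
        _ ≤ _ := by gcongr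
    have e3 : -((|(n : ℝ)| + |δ|) * S) ≤ ((n : ℝ) + δ) * z.im := by
      refine le_trans (neg_le_neg ?_) (neg_abs_le _)
      rw [abs_mul]
      exact mul_le_mul (abs_add_le _ _) hz (abs_nonneg _) (by positivity)
    have := mul_le_mul_of_nonneg_left (add_le_add e2 e3) (by positivity : 0 ≤ 2 * π)
    push_cast
    linarith
  rw [gTerm, norm_mul]
  refine (mul_le_mul h1 h2 (norm_nonneg _) (by positivity)).trans (le_of_eq ?_)
  rw [gBound]
  ring

lemma summable_norm_gTerm (k : ℕ) (δ : ℝ) (z : ℂ) {τ : ℂ} (hτ : 0 < τ.im) :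
    Summable fun n => ‖gTerm k δ z τ n‖ :=
  Summable.of_nonneg_of_le (fun _ => norm_nonneg _) (norm_gTerm_le k δ hτ le_rfl le_rfl)
    (summable_gBound k δ |z.im| hτ)

lemma hasSum_gTerm (k : ℕ) (δ : ℝ) (z : ℂ) {τ : ℂ} (hτ : 0 < τ.im) :
    HasSum (gTerm k δ z τ) (gSum k δ z τ) :=
  (summable_norm_gTerm k δ z hτ).of_norm.hasSum

lemma hasDerivAt_gTerm_fst (k : ℕ) (δ : ℝ) (z τ : ℂ) (n : ℤ) :
    HasDerivAt (fun w => gTerm k δ w τ n) (2 * π * I * gTerm (k + 1) δ z τ n) z := by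
  have := (((((hasDerivAt_id z).const_mul ((n : ℂ) + δ)).const_add
    (τ * ((n : ℂ) + δ) ^ 2)).const_mul (2 * π * I)).cexp).const_mul (((n : ℂ) + δ) ^ k)
  refine this.congr_deriv ?_
  simp only [gTerm, id]
  ring

lemma hasDerivAt_gTerm_snd (k : ℕ) (δ : ℝ) (z τ : ℂ) (n : ℤ) :
    HasDerivAt (fun t => gTerm k δ z t n) (2 * π * I * gTerm (k + 2) δ z τ n) τ := by
  have := (((((hasDerivAt_id τ).mul_const (((n : ℂ) + δ) ^ 2)).add_const
    (((n : ℂ) + δ) * z)).const_mul (2 * π * I)).cexp).const_mul (((n : ℂ) + δ) ^ k)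
  refine this.congr_deriv ?_
  simp only [gTerm, id]
  ring

lemma isOpen_strip (S : ℝ) : IsOpen {w : ℂ | |w.im| < S} :=
  isOpen_lt (by fun_prop) continuous_const

lemma isOpen_halfPlane (T : ℝ) : IsOpen {w : ℂ | T < w.im} :=
  isOpen_lt continuous_const (by fun_prop)

lemma hasDerivAt_gSum_fst (k : ℕ) (δ : ℝ) (z : ℂ) {τ : ℂ} (hτ : 0 < τ.im) :
    HasDerivAt (fun w => gSum k δ w τ) (2 * π * I * gSum (k + 1) δ z τ) z := by
  have hu := summable_gBound k δ (|z.im| + 1) hτ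
  have hU := isOpen_strip (|z.im| + 1)
  have hz : z ∈ {w : ℂ | |w.im| < |z.im| + 1} := by simp
  have hd : ∀ n : ℤ, DifferentiableOn ℂ (fun w => gTerm k δ w τ n) {w : ℂ | |w.im| < |z.im| + 1} :=
    fun n w _ => (hasDerivAt_gTerm_fst k δ w τ n).differentiableAt.differentiableWithinAt
  have hb : ∀ (n : ℤ) (w : ℂ), w ∈ {w : ℂ | |w.im| < |z.im| + 1} →
      ‖gTerm k δ w τ n‖ ≤ gBound k δ (|z.im| + 1) τ.im n :=
    fun n w hw => norm_gTerm_le k δ hτ hw.le le_rfl n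
  have h1 := hasSum_deriv_of_summable_norm hu hd hU hb hz
  have h2 := ((differentiableOn_tsum_of_summable_norm hu hd hU hb).differentiableAt
    (hU.mem_nhds hz)).hasDerivAt
  simp only [(hasDerivAt_gTerm_fst k δ z τ _).deriv] at h1
  rw [h1.unique ((hasSum_gTerm (k + 1) δ z hτ).mul_left _)] at h2
  exact h2

lemma hasDerivAt_gSum_snd (k : ℕ) (δ : ℝ) (z : ℂ) {τ : ℂ} (hτ : 0 < τ.im) :
    HasDerivAt (fun t => gSum k δ z t) (2 * π * I * gSum (k + 2) δ z τ) τ := by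
  have hT : 0 < τ.im / 2 := by positivity
  have hu := summable_gBound k δ |z.im| hT
  have hU := isOpen_halfPlane (τ.im / 2)
  have hz : τ ∈ {w : ℂ | τ.im / 2 < w.im} := by simp only [Set.mem_ofPred_eq]; linarith
  have hd : ∀ n : ℤ, DifferentiableOn ℂ (fun t => gTerm k δ z t n) {w : ℂ | τ.im / 2 < w.im} :=
    fun n w _ => (hasDerivAt_gTerm_snd k δ z w n).differentiableAt.differentiableWithinAt
  have hb : ∀ (n : ℤ) (t : ℂ), t ∈ {w : ℂ | τ.im / 2 < w.im} →
      ‖gTerm k δ z t n‖ ≤ gBound k δ |z.im| (τ.im / 2) n :=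
    fun n t ht => norm_gTerm_le k δ hT le_rfl ht.le n
  have h1 := hasSum_deriv_of_summable_norm hu hd hU hb hz
  have h2 := ((differentiableOn_tsum_of_summable_norm hu hd hU hb).differentiableAt
    (hU.mem_nhds hz)).hasDerivAt
  simp only [(hasDerivAt_gTerm_snd k δ z τ _).deriv] at h1
  rw [h1.unique ((hasSum_gTerm (k + 2) δ z hτ).mul_left _)] at h2
  exact h2

/-! ### The function `θ` and its derivatives -/

lemma exp_pi_int_mul_I (n : ℤ) : cexp (π * I * n) = (-1) ^ n := by
  rw [← exp_pi_mul_I, ← Complex.exp_int_mul]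
  ring_nf

lemma theta_eq_gSum (z : ℂ) {τ : ℂ} (hτ : 0 < τ.im) :
    theta z τ = -gSum 0 (1 / 2) (z / π + 1 / 2) (τ / 2) := by
  have hτ' : 0 < (τ / 2).im := by simpa using hτ
  have hπ : (π : ℂ) ≠ 0 := by exact_mod_cast Real.pi_ne_zero
  rw [theta, ← tsum_mul_left, gSum, ← tsum_neg]
  refine tsum_congr fun n => ?_
  rw [gTerm, ← exp_pi_int_mul_I, pow_zero, one_mul, ← Complex.exp_add]
  have : (2 * π * I * (τ / 2 * ((n : ℂ) + (1 / 2 : ℝ)) ^ 2 +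
      ((n : ℂ) + (1 / 2 : ℝ)) * (z / π + 1 / 2))) =
      (π * I * n + (((n : ℂ) + 1 / 2) ^ 2 * π * I * τ + (2 * n + 1) * I * z)) + π / 2 * I := by
    push_cast
    field_simp
    ring
  rw [this, Complex.exp_add _ (π / 2 * I), Complex.exp_pi_div_two_mul_I]
  ring

lemma hasDerivAt_gSum_theta (k : ℕ) (z : ℂ) {τ : ℂ} (hτ : 0 < τ.im) :
    HasDerivAt (fun w => -(2 * I) ^ k * gSum k (1 / 2) (w / π + 1 / 2) (τ / 2))
      (-(2 * I) ^ (k + 1) * gSum (k + 1) (1 / 2) (z / π + 1 / 2) (τ / 2)) z := by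
  have hτ' : 0 < (τ / 2).im := by simpa using hτ
  have hπ : (π : ℂ) ≠ 0 := by exact_mod_cast Real.pi_ne_zero
  have h := (hasDerivAt_gSum_fst k (1 / 2) (z / π + 1 / 2) hτ').comp z
    (((hasDerivAt_id z).div_const (π : ℂ)).add_const (1 / 2))
  refine (h.const_mul (-(2 * I) ^ k)).congr_deriv ?_
  field_simp
  ring

lemma thetaD_eq_gSum (k : ℕ) (z : ℂ) {τ : ℂ} (hτ : 0 < τ.im) :
    thetaD k z τ = -(2 * I) ^ k * gSum k (1 / 2) (z / π + 1 / 2) (τ / 2) := by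
  induction k generalizing z with
  | zero => simp [thetaD, theta_eq_gSum z hτ]
  | succ k ih =>
    rw [thetaD, iteratedDeriv_succ]
    have : iteratedDeriv k (fun w => theta w τ) =
        fun z => -(2 * I) ^ k * gSum k (1 / 2) (z / π + 1 / 2) (τ / 2) := funext fun z => ih z
    rw [this, (hasDerivAt_gSum_theta k z hτ).deriv]

lemma thetaD_zero (z τ : ℂ) : thetaD 0 z τ = theta z τ := by simp [thetaD]

lemma hasDerivAt_thetaD (k : ℕ) (z : ℂ) {τ : ℂ} (hτ : 0 < τ.im) :
    HasDerivAt (fun w => thetaD k w τ) (thetaD (k + 1) z τ) z := by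
  have := hasDerivAt_gSum_theta k z hτ
  simpa only [← thetaD_eq_gSum _ _ hτ] using this

/-- The heat equation for `θ`. -/
lemma hasDerivAt_thetaD_snd (k : ℕ) (z : ℂ) {τ : ℂ} (hτ : 0 < τ.im) :
    HasDerivAt (fun t => thetaD k z t) (2 * π * I * (-thetaD (k + 2) z τ / 8)) τ := by
  have hτ' : 0 < (τ / 2).im := by simpa using hτ
  have h := ((hasDerivAt_gSum_snd k (1 / 2) (z / π + 1 / 2) hτ').comp τ
    ((hasDerivAt_id τ).div_const (2 : ℂ))).const_mul (-(2 * I) ^ k)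
  have h' : HasDerivAt (fun t => -(2 * I) ^ k * gSum k (1 / 2) (z / π + 1 / 2) (t / 2))
      (2 * π * I * (-thetaD (k + 2) z τ / 8)) τ := by
    refine h.congr_deriv ?_
    rw [thetaD_eq_gSum _ _ hτ, pow_add, mul_pow 2 I 2, I_sq]
    ring
  refine h'.congr_of_eventuallyEq ?_
  filter_upwards [(isOpen_halfPlane 0).mem_nhds hτ] with t ht
  exact thetaD_eq_gSum k z ht

lemma gSum_neg (k : ℕ) (z τ : ℂ) :
    gSum k (1 / 2) (-z) τ = (-1) ^ k * gSum k (1 / 2) z τ := by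
  rw [gSum, gSum, ← tsum_mul_left, ← (Equiv.subLeft (-1 : ℤ)).tsum_eq]
  refine tsum_congr fun n => ?_
  rw [gTerm, gTerm, ← mul_assoc, ← mul_pow]
  simp only [Equiv.subLeft_apply]
  push_cast
  congr 2 <;> ring

lemma gSum_add_one (k : ℕ) (z τ : ℂ) :
    gSum k (1 / 2) (z + 1) τ = -gSum k (1 / 2) z τ := by
  rw [gSum, gSum, ← tsum_neg]
  refine tsum_congr fun n => ?_
  rw [gTerm, gTerm]
  have : (2 * π * I * (τ * ((n : ℂ) + (1 / 2 : ℝ)) ^ 2 + ((n : ℂ) + (1 / 2 : ℝ)) * (z + 1))) =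
      2 * π * I * (τ * ((n : ℂ) + (1 / 2 : ℝ)) ^ 2 + ((n : ℂ) + (1 / 2 : ℝ)) * z) + π * I +
        n * (2 * π * I) := by
    push_cast; ring
  rw [this, Complex.exp_periodic.int_mul n, Complex.exp_add, exp_pi_mul_I]
  ring

lemma thetaD_pi_sub (k : ℕ) (z : ℂ) {τ : ℂ} (hτ : 0 < τ.im) :
    thetaD k (π - z) τ = (-1) ^ k * thetaD k z τ := by
  have hπ : (π : ℂ) ≠ 0 := by exact_mod_cast Real.pi_ne_zero
  rw [thetaD_eq_gSum _ _ hτ, thetaD_eq_gSum _ _ hτ]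
  have : (π - z) / π + 1 / 2 = -(z / π + 1 / 2) + 1 + 1 := by field_simp; ring
  rw [this, gSum_add_one, gSum_add_one, neg_neg, gSum_neg]
  ring

lemma thetaD_neg (k : ℕ) (z : ℂ) {τ : ℂ} (hτ : 0 < τ.im) :
    thetaD k (-z) τ = (-1) ^ (k + 1) * thetaD k z τ := by
  have hπ : (π : ℂ) ≠ 0 := by exact_mod_cast Real.pi_ne_zero
  rw [thetaD_eq_gSum _ _ hτ, thetaD_eq_gSum _ _ hτ]
  have : -(z / π + 1 / 2) + 1 = -z / π + 1 / 2 := by ring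
  rw [← this, gSum_add_one, gSum_neg]
  ring

lemma thetaD_even_zero (k : ℕ) {τ : ℂ} (hτ : 0 < τ.im) : thetaD (2 * k) 0 τ = 0 := by
  have h := thetaD_neg (2 * k) 0 hτ
  rw [neg_zero, pow_succ, pow_mul] at h
  simp only [even_two, Even.neg_pow, one_pow, one_mul, neg_mul] at h
  linear_combination h / 2

end SixVertex

end

noncomputable section

namespace SixVertex

open Complex Filter Topology
open scoped Real

/-! ### The addition theorem -/

lemma HasSum.of_two_ranges {α β γ : Type*} {f : γ → ℂ} {i : α → γ} {j : β → γ} {a b : ℂ}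
    (hi : Function.Injective i) (hj : Function.Injective j)
    (hc : IsCompl (Set.range i) (Set.range j)) (ha : HasSum (fun x => f (i x)) a)
    (hb : HasSum (fun x => f (j x)) b) : HasSum f (a + b) := by
  have h1 := hi.hasSum_range_iff.2 ha
  have h2 := hj.hasSum_range_iff.2 hb
  exact h1.add_isCompl hc h2

/-- The `k`-th `x`-derivative of `∑ q^{(n+δ)²} e^{4i(n+δ)x}`. -/
def gD (δ : ℝ) (k : ℕ) (x τ : ℂ) : ℂ := (4 * I) ^ k * gSum k δ (2 * x / π) τ

lemma hasDerivAt_gD (δ : ℝ) (k : ℕ) (x : ℂ) {τ : ℂ} (hτ : 0 < τ.im) :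
    HasDerivAt (fun w => gD δ k w τ) (gD δ (k + 1) x τ) x := by
  have hπ : (π : ℂ) ≠ 0 := by exact_mod_cast Real.pi_ne_zero
  have h := ((hasDerivAt_gSum_fst k δ (2 * x / π) hτ).comp x
    (((hasDerivAt_id x).const_mul 2).div_const (π : ℂ))).const_mul ((4 * I) ^ k)
  refine h.congr_deriv ?_
  rw [gD]
  field_simp
  ring

lemma hasDerivAt_gD_snd (δ : ℝ) (k : ℕ) (x : ℂ) {τ : ℂ} (hτ : 0 < τ.im) :
    HasDerivAt (fun t => gD δ k x t) (2 * π * I * (-gD δ (k + 2) x τ / 16)) τ := by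
  have h := (hasDerivAt_gSum_snd k δ (2 * x / π) hτ).const_mul ((4 * I) ^ k)
  refine h.congr_deriv ?_
  rw [gD, pow_add, mul_pow 4 I 2, I_sq]
  ring

lemma isCompl_range_sum_diff :
    IsCompl (Set.range fun p : ℤ × ℤ => (p.1 + p.2, p.1 - p.2))
      (Set.range fun p : ℤ × ℤ => (p.1 + p.2, p.1 - p.2 - 1)) := by
  constructor
  · rw [Set.disjoint_left]
    rintro _ ⟨⟨a, b⟩, rfl⟩ ⟨⟨c, d⟩, h⟩
    simp only [Prod.mk.injEq] at h
    omega
  · rw [codisjoint_iff_le_sup]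
    rintro ⟨m, n⟩ -
    rcases Int.emod_two_eq_zero_or_one (m + n) with h | h
    · exact Or.inl ⟨((m + n) / 2, (m - n) / 2), Prod.ext (by dsimp; omega) (by dsimp; omega)⟩
    · exact Or.inr ⟨((m + n + 1) / 2, (m - n - 1) / 2),
        Prod.ext (by dsimp; omega) (by dsimp; omega)⟩

lemma hasSum_gTerm_mul (k l : ℕ) (δ ε : ℝ) (z w : ℂ) {τ σ : ℂ} (hτ : 0 < τ.im) (hσ : 0 < σ.im) :
    HasSum (fun p : ℤ × ℤ => gTerm k δ z τ p.1 * gTerm l ε w σ p.2)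
      (gSum k δ z τ * gSum l ε w σ) :=
  (hasSum_gTerm k δ z hτ).mul (hasSum_gTerm l ε w hσ)
    (summable_mul_of_summable_norm (summable_norm_gTerm k δ z hτ) (summable_norm_gTerm l ε w hσ))

/-- The addition theorem for `θ`. -/
lemma theta_add_mul_theta_sub (x y : ℂ) {τ : ℂ} (hτ : 0 < τ.im) :
    thetaD 0 (x + y) τ * thetaD 0 (x - y) τ =
      gD 0 0 x τ * gD (1 / 2) 0 y τ - gD (1 / 2) 0 x τ * gD 0 0 y τ := by
  have hτ' : 0 < (τ / 2).im := by simpa using hτ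
  have hπ : (π : ℂ) ≠ 0 := by exact_mod_cast Real.pi_ne_zero
  simp only [thetaD_eq_gSum _ _ hτ, gD, pow_zero, one_mul, neg_mul, mul_neg, neg_neg]
  refine (hasSum_gTerm_mul 0 0 (1 / 2) (1 / 2) ((x + y) / π + 1 / 2) ((x - y) / π + 1 / 2)
    hτ' hτ').unique ?_
  rw [sub_eq_neg_add (_ * _), ← neg_mul]
  refine HasSum.of_two_ranges (i := fun p : ℤ × ℤ => (p.1 + p.2, p.1 - p.2))
    (j := fun p : ℤ × ℤ => (p.1 + p.2, p.1 - p.2 - 1)) ?_ ?_ isCompl_range_sum_diff ?_ ?_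
  · rintro ⟨a, b⟩ ⟨c, d⟩ h
    simp only [Prod.mk.injEq] at h ⊢
    omega
  · rintro ⟨a, b⟩ ⟨c, d⟩ h
    simp only [Prod.mk.injEq] at h ⊢
    omega
  · have h := (hasSum_gTerm_mul 0 0 (1 / 2) 0 (2 * x / π) (2 * y / π) hτ hτ).neg
    rw [neg_mul]
    refine h.congr_fun fun p => ?_
    simp only [gTerm, pow_zero, one_mul, ← Complex.exp_add]
    rw [← neg_one_mul, ← Complex.exp_pi_mul_I, ← Complex.exp_add,
      ← Complex.exp_periodic.int_mul (-p.1)]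
    congr 1
    push_cast
    field_simp
    ring
  · refine (hasSum_gTerm_mul 0 0 0 (1 / 2) (2 * x / π) (2 * y / π) hτ hτ).congr_fun fun p => ?_
    simp only [gTerm, pow_zero, one_mul, ← Complex.exp_add]
    rw [← Complex.exp_periodic.int_mul (-p.1)]
    congr 1
    push_cast
    field_simp
    ring

/-- A sequence of successive derivatives `f k` of an odd function `f 0`, with an addition theorem
of Weierstrass type. -/
structure HasAdditionTheorem (f u v : ℕ → ℂ → ℂ) : Prop where
  hf : ∀ k x, HasDerivAt (f k) (f (k + 1) x) x
  hu : ∀ k x, HasDerivAt (u k) (u (k + 1) x) x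
  hv : ∀ k x, HasDerivAt (v k) (v (k + 1) x) x
  add : ∀ x y, f 0 (x + y) * f 0 (x - y) = u 0 x * v 0 y - v 0 x * u 0 y
  even : ∀ k, f (2 * k) 0 = 0

namespace HasAdditionTheorem

variable {f u v : ℕ → ℂ → ℂ}

lemma hasDerivAt_mul_snd (h : HasAdditionTheorem f u v) (a b : ℕ) (x y : ℂ) :
    HasDerivAt (fun y => f a (x + y) * f b (x - y))
      (f (a + 1) (x + y) * f b (x - y) - f a (x + y) * f (b + 1) (x - y)) y := by
  have h1 := (h.hf a (x + y)).comp_const_add x y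
  have h2 := (h.hf b (x - y)).comp_const_sub x y
  exact (h1.mul h2).congr_deriv (by ring)

lemma hasDerivAt_bracket_snd (h : HasAdditionTheorem f u v) (k : ℕ) (x y : ℂ) :
    HasDerivAt (fun y => u 0 x * v k y - v 0 x * u k y)
      (u 0 x * v (k + 1) y - v 0 x * u (k + 1) y) y :=
  ((h.hv k y).const_mul _).sub ((h.hu k y).const_mul _)

lemma hasDerivAt_bracket_fst (h : HasAdditionTheorem f u v) (i k : ℕ) (x y : ℂ) :
    HasDerivAt (fun x => u i x * v k y - v i x * u k y)
      (u (i + 1) x * v k y - v (i + 1) x * u k y) x :=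
  ((h.hu i x).mul_const _).sub ((h.hv i x).mul_const _)

lemma hasDerivAt_mul (h : HasAdditionTheorem f u v) (a b : ℕ) (x : ℂ) :
    HasDerivAt (fun x => f a x * f b x) (f (a + 1) x * f b x + f a x * f (b + 1) x) x :=
  (h.hf a x).mul (h.hf b x)

lemma add_snd (h : HasAdditionTheorem f u v) (x y : ℂ) : f 1 (x + y) * f 0 (x - y) - f 0 (x + y) * f 1 (x - y) =
    u 0 x * v 1 y - v 0 x * u 1 y := by
  have h1 := h.hasDerivAt_mul_snd 0 0 x y
  rw [funext (h.add x)] at h1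
  exact h1.unique (h.hasDerivAt_bracket_snd 0 x y)

lemma add_snd_two (h : HasAdditionTheorem f u v) (x y : ℂ) : f 2 (x + y) * f 0 (x - y) - 2 * (f 1 (x + y) * f 1 (x - y)) +
    f 0 (x + y) * f 2 (x - y) = u 0 x * v 2 y - v 0 x * u 2 y := by
  have h1 := (h.hasDerivAt_mul_snd 1 0 x y).sub (h.hasDerivAt_mul_snd 0 1 x y)
  simp only [Pi.sub_def] at h1
  rw [funext (h.add_snd x)] at h1
  rw [← h1.unique (h.hasDerivAt_bracket_snd 1 x y)]
  ring

lemma add_snd_three (h : HasAdditionTheorem f u v) (x y : ℂ) : f 3 (x + y) * f 0 (x - y) - 3 * (f 2 (x + y) * f 1 (x - y)) +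
    3 * (f 1 (x + y) * f 2 (x - y)) - f 0 (x + y) * f 3 (x - y) =
    u 0 x * v 3 y - v 0 x * u 3 y := by
  have h1 := ((h.hasDerivAt_mul_snd 2 0 x y).sub
    ((h.hasDerivAt_mul_snd 1 1 x y).const_mul 2)).add (h.hasDerivAt_mul_snd 0 2 x y)
  simp only [Pi.sub_def, Pi.add_def] at h1
  rw [funext (h.add_snd_two x)] at h1
  rw [← h1.unique (h.hasDerivAt_bracket_snd 2 x y)]
  ring

lemma add_snd_four (h : HasAdditionTheorem f u v) (x y : ℂ) : f 4 (x + y) * f 0 (x - y) - 4 * (f 3 (x + y) * f 1 (x - y)) +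
    6 * (f 2 (x + y) * f 2 (x - y)) - 4 * (f 1 (x + y) * f 3 (x - y)) +
    f 0 (x + y) * f 4 (x - y) = u 0 x * v 4 y - v 0 x * u 4 y := by
  have h1 := (((h.hasDerivAt_mul_snd 3 0 x y).sub
    ((h.hasDerivAt_mul_snd 2 1 x y).const_mul 3)).add
      ((h.hasDerivAt_mul_snd 1 2 x y).const_mul 3)).sub (h.hasDerivAt_mul_snd 0 3 x y)
  simp only [Pi.sub_def, Pi.add_def] at h1
  rw [funext (h.add_snd_three x)] at h1
  rw [← h1.unique (h.hasDerivAt_bracket_snd 3 x y)]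
  ring

lemma bracket_zero (h : HasAdditionTheorem f u v) (x : ℂ) : f 0 x * f 0 x = u 0 x * v 0 0 - v 0 x * u 0 0 := by
  simpa using h.add x 0

lemma bracket_two (h : HasAdditionTheorem f u v) (x : ℂ) :
    2 * (f 2 x * f 0 x) - 2 * (f 1 x * f 1 x) = u 0 x * v 2 0 - v 0 x * u 2 0 := by
  rw [← h.add_snd_two x 0, add_zero, sub_zero]
  ring

lemma bracket_four (h : HasAdditionTheorem f u v) (x : ℂ) :
    2 * (f 4 x * f 0 x) - 8 * (f 3 x * f 1 x) + 6 * (f 2 x * f 2 x) =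
      u 0 x * v 4 0 - v 0 x * u 4 0 := by
  rw [← h.add_snd_four x 0, add_zero, sub_zero]
  ring

lemma bracket_one_zero (h : HasAdditionTheorem f u v) (x : ℂ) : 2 * (f 0 x * f 1 x) = u 1 x * v 0 0 - v 1 x * u 0 0 := by
  have h1 := h.hasDerivAt_mul 0 0 x
  rw [funext h.bracket_zero] at h1
  rw [← h1.unique (h.hasDerivAt_bracket_fst 0 0 x 0)]
  ring

lemma bracket_one_two (h : HasAdditionTheorem f u v) (x : ℂ) :
    2 * (f 3 x * f 0 x) - 2 * (f 1 x * f 2 x) = u 1 x * v 2 0 - v 1 x * u 2 0 := by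
  have h1 := ((h.hasDerivAt_mul 2 0 x).const_mul 2).sub ((h.hasDerivAt_mul 1 1 x).const_mul 2)
  simp only [Pi.sub_def] at h1
  rw [funext h.bracket_two] at h1
  rw [← h1.unique (h.hasDerivAt_bracket_fst 0 2 x 0)]
  ring

lemma bracket_one_four (h : HasAdditionTheorem f u v) (x : ℂ) :
    2 * (f 5 x * f 0 x) - 6 * (f 4 x * f 1 x) + 4 * (f 3 x * f 2 x) =
      u 1 x * v 4 0 - v 1 x * u 4 0 := by
  have h1 := (((h.hasDerivAt_mul 4 0 x).const_mul 2).sub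
    ((h.hasDerivAt_mul 3 1 x).const_mul 8)).add ((h.hasDerivAt_mul 2 2 x).const_mul 6)
  simp only [Pi.sub_def, Pi.add_def] at h1
  rw [funext h.bracket_four] at h1
  rw [← h1.unique (h.hasDerivAt_bracket_fst 0 4 x 0)]
  ring

lemma bracket_two_four (h : HasAdditionTheorem f u v) (x : ℂ) :
    2 * (f 6 x * f 0 x) - 4 * (f 5 x * f 1 x) - 2 * (f 4 x * f 2 x) + 4 * (f 3 x * f 3 x) =
      u 2 x * v 4 0 - v 2 x * u 4 0 := by
  have h1 := (((h.hasDerivAt_mul 5 0 x).const_mul 2).sub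
    ((h.hasDerivAt_mul 4 1 x).const_mul 6)).add ((h.hasDerivAt_mul 3 2 x).const_mul 4)
  simp only [Pi.sub_def, Pi.add_def] at h1
  rw [funext h.bracket_one_four] at h1
  rw [← h1.unique (h.hasDerivAt_bracket_fst 1 4 x 0)]
  ring

lemma add_fst (h : HasAdditionTheorem f u v) (x y : ℂ) : f 1 (x + y) * f 0 (x - y) + f 0 (x + y) * f 1 (x - y) =
    u 1 x * v 0 y - v 1 x * u 0 y := by
  have h1 := ((h.hf 0 (x + y)).comp_add_const x y).mul ((h.hf 0 (x - y)).comp_sub_const x y)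
  have h2 : HasDerivAt (fun x => u 0 x * v 0 y - v 0 x * u 0 y)
      (f 1 (x + y) * f 0 (x - y) + f 0 (x + y) * f 1 (x - y)) x := by
    rw [← funext fun x => h.add x y]
    exact h1
  exact h2.unique (h.hasDerivAt_bracket_fst 0 0 x y)

/-- The duplication formula. -/
lemma duplication (h : HasAdditionTheorem f u v) (y : ℂ) : f 1 0 ^ 3 * f 0 (2 * y) =
    f 0 y ^ 3 * f 3 y - 3 * f 0 y ^ 2 * f 1 y * f 2 y + 2 * f 0 y * f 1 y ^ 3 := by
  have e0 : f 0 0 = 0 := h.even 0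
  have h1 := h.add_fst y y
  have h2 := h.bracket_two 0
  rw [sub_self, ← two_mul, e0] at h1
  rw [e0] at h2
  have h3 := h.bracket_zero y
  have h4 := h.bracket_two y
  have h5 := h.bracket_one_zero y
  have h6 := h.bracket_one_two y
  linear_combination ((u 2 0 * v 0 0 - v 2 0 * u 0 0) / 2) * h1 +
    (-(f 0 (2 * y) * f 1 0 / 2)) * h2 +
    (1 / 2) * (-(f 0 y * f 0 y) * h6 - (u 1 y * v 2 0 - v 1 y * u 2 0) * h3
      + 2 * (f 0 y * f 1 y) * h4 + (u 0 y * v 2 0 - v 0 y * u 2 0) * h5)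

/-- The first derivative of the duplication formula. -/
lemma duplication_deriv (h : HasAdditionTheorem f u v) (y : ℂ) : 2 * f 1 0 ^ 3 * f 1 (2 * y) =
    f 0 y ^ 3 * f 4 y - 3 * f 0 y ^ 2 * f 2 y ^ 2 + 2 * f 1 y ^ 4 := by
  have h1 := ((h.hf 0 (2 * y)).comp y ((hasDerivAt_id y).const_mul 2)).const_mul (f 1 0 ^ 3)
  have h2 := ((((h.hf 0 y).pow 3).mul (h.hf 3 y)).sub
    (((((h.hf 0 y).pow 2).const_mul 3).mul (h.hf 1 y)).mul (h.hf 2 y))).add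
    (((h.hf 0 y).const_mul 2).mul ((h.hf 1 y).pow 3))
  have h3 := h1.unique (h2.congr_of_eventuallyEq (.of_forall fun y => h.duplication y))
  simp only [Pi.mul_apply, Pi.pow_apply] at h3
  push_cast at h3
  linear_combination h3

/-- The second derivative of the duplication formula. -/
lemma duplication_deriv_two (h : HasAdditionTheorem f u v) (y : ℂ) : 4 * f 1 0 ^ 3 * f 2 (2 * y) =
    f 0 y ^ 3 * f 5 y + 3 * f 0 y ^ 2 * f 1 y * f 4 y - 6 * f 0 y * f 1 y * f 2 y ^ 2
      - 6 * f 0 y ^ 2 * f 2 y * f 3 y + 8 * f 1 y ^ 3 * f 2 y := by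
  have h1 := ((h.hf 1 (2 * y)).comp y ((hasDerivAt_id y).const_mul 2)).const_mul (2 * f 1 0 ^ 3)
  have h2 := ((((h.hf 0 y).pow 3).mul (h.hf 4 y)).sub
    ((((h.hf 0 y).pow 2).const_mul 3).mul ((h.hf 2 y).pow 2))).add
    (((h.hf 1 y).pow 4).const_mul 2)
  have h3 := h1.unique (h2.congr_of_eventuallyEq (.of_forall fun y => h.duplication_deriv y))
  simp only [Pi.pow_apply] at h3
  push_cast at h3
  linear_combination h3

/-- The differential equation `℘'' = 6 ℘² - g₂ / 2`. -/
lemma weierstrass_ode (h : HasAdditionTheorem f u v) (x : ℂ) :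
    f 1 0 ^ 2 * (f 0 x * f 4 x - 4 * f 1 x * f 3 x + 3 * f 2 x ^ 2) =
      4 * f 1 0 * f 3 0 * (f 0 x * f 2 x - f 1 x ^ 2)
        - (f 1 0 * f 5 0 - f 3 0 ^ 2) * f 0 x ^ 2 := by
  have e0 : f 0 0 = 0 := h.even 0
  have e2 : f 2 0 = 0 := h.even 1
  have e4 : f 4 0 = 0 := h.even 2
  have h1 := h.bracket_two 0
  have h2 := h.bracket_four 0
  have h3 := h.bracket_two_four 0
  rw [e0, e2] at h1
  rw [e0, e2, e4] at h2 h3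
  have h4 := h.bracket_zero x
  have h5 := h.bracket_two x
  have h6 := h.bracket_four x
  linear_combination (1 / 4) * (2 * f 1 0 ^ 2 * h6 - (u 0 x * v 4 0 - v 0 x * u 4 0) * h1
    - 8 * f 1 0 * f 3 0 * h5 + (u 0 x * v 2 0 - v 0 x * u 2 0) * h2
    + 4 * (f 1 0 * f 5 0 - f 3 0 ^ 2) * h4 - (u 0 x * v 0 0 - v 0 x * u 0 0) * h3)

/-- The derivative of the differential equation `℘'' = 6 ℘² - g₂ / 2`. -/
lemma weierstrass_ode_deriv (h : HasAdditionTheorem f u v) (x : ℂ) :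
    f 1 0 ^ 2 * (f 0 x * f 5 x - 3 * f 1 x * f 4 x + 2 * f 2 x * f 3 x) =
      4 * f 1 0 * f 3 0 * (f 0 x * f 3 x - f 1 x * f 2 x)
        - 2 * (f 1 0 * f 5 0 - f 3 0 ^ 2) * f 0 x * f 1 x := by
  have h1 := ((((h.hf 0 x).mul (h.hf 4 x)).sub (((h.hf 1 x).const_mul 4).mul (h.hf 3 x))).add
    (((h.hf 2 x).pow 2).const_mul 3)).const_mul (f 1 0 ^ 2)
  have h2 := ((((h.hf 0 x).mul (h.hf 2 x)).sub ((h.hf 1 x).pow 2)).const_mul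
    (4 * f 1 0 * f 3 0)).sub (((h.hf 0 x).pow 2).const_mul (f 1 0 * f 5 0 - f 3 0 ^ 2))
  have h3 := h1.unique (h2.congr_of_eventuallyEq (.of_forall fun y => h.weierstrass_ode y))
  push_cast at h3
  linear_combination h3

end HasAdditionTheorem

lemma hasAdditionTheorem_theta {τ : ℂ} (hτ : 0 < τ.im) :
    HasAdditionTheorem (fun k x => thetaD k x τ) (fun k x => gD 0 k x τ)
      (fun k x => gD (1 / 2) k x τ) where
  hf k x := hasDerivAt_thetaD k x hτ
  hu k x := hasDerivAt_gD 0 k x hτ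
  hv k x := hasDerivAt_gD (1 / 2) k x hτ
  add x y := theta_add_mul_theta_sub x y hτ
  even k := thetaD_even_zero k hτ

end SixVertex

end

noncomputable section

namespace SixVertex

open Complex Filter Topology
open scoped Real

/-! ### The Jacobi triple product -/

/-- The finite product `∏_{j=1}^n (1 - q^j)`. -/
def qPoch (q : ℂ) (n : ℕ) : ℂ := ∏ j ∈ Finset.range n, (1 - q ^ (j + 1))

/-- The Gaussian binomial coefficient, as a quotient of products. -/
def qBinom (q : ℂ) (n k : ℕ) : ℂ := qPoch q n / (qPoch q k * qPoch q (n - k))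

lemma one_sub_pow_ne_zero {q : ℂ} (hq : ‖q‖ < 1) (j : ℕ) : 1 - q ^ (j + 1) ≠ 0 := by
  intro h
  have : ‖q ^ (j + 1)‖ = 1 := by rw [← sub_eq_zero.1 h, norm_one]
  rw [norm_pow] at this
  exact (pow_lt_one₀ (norm_nonneg q) hq (Nat.succ_ne_zero j)).ne this

lemma qPoch_ne_zero {q : ℂ} (hq : ‖q‖ < 1) (n : ℕ) : qPoch q n ≠ 0 :=
  Finset.prod_ne_zero_iff.2 fun j _ => one_sub_pow_ne_zero hq j

lemma qPoch_succ (q : ℂ) (n : ℕ) : qPoch q (n + 1) = qPoch q n * (1 - q ^ (n + 1)) :=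
  Finset.prod_range_succ _ _

lemma qPoch_zero (q : ℂ) : qPoch q 0 = 1 := rfl

/-- Rothe's `q`-binomial theorem. -/
lemma prod_add_mul_pow {q : ℂ} (hq : ‖q‖ < 1) (x y : ℂ) (n : ℕ) :
    ∏ j ∈ Finset.range n, (y + x * q ^ j) =
      ∑ k ∈ Finset.range (n + 1), q ^ k.choose 2 * qBinom q n k * x ^ k * y ^ (n - k) := by
  have hP := qPoch_ne_zero hq
  induction n with
  | zero => simp [qBinom, qPoch_zero]
  | succ n ih =>
    rw [Finset.prod_range_succ, ih, mul_add, Finset.sum_mul, Finset.sum_mul,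
      Finset.sum_range_succ' _ n, Finset.sum_range_succ' _ (n + 1), Finset.sum_range_succ _ n,
      Finset.sum_range_succ _ n]
    have h0 : q ^ Nat.choose 0 2 * qBinom q (n + 1) 0 * x ^ 0 * y ^ (n + 1 - 0) =
        q ^ Nat.choose 0 2 * qBinom q n 0 * x ^ 0 * y ^ (n - 0) * y := by
      simp only [qBinom, qPoch_zero, Nat.sub_zero, one_mul, div_self (hP _)]
      ring
    have hn : q ^ Nat.choose (n + 1) 2 * qBinom q (n + 1) (n + 1) * x ^ (n + 1) *
        y ^ (n + 1 - (n + 1)) = q ^ Nat.choose n 2 * qBinom q n n * x ^ n * y ^ (n - n) *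
          (x * q ^ n) := by
      simp only [qBinom, qPoch_zero, Nat.sub_self, mul_one, div_self (hP _), Nat.choose_succ_succ',
        Nat.choose_one_right, Nat.reduceAdd]
      ring
    rw [h0, hn]
    have hk : ∀ k ∈ Finset.range n, q ^ Nat.choose (k + 1) 2 * qBinom q (n + 1) (k + 1) *
        x ^ (k + 1) * y ^ (n + 1 - (k + 1)) =
        q ^ Nat.choose (k + 1) 2 * qBinom q n (k + 1) * x ^ (k + 1) * y ^ (n - (k + 1)) * y +
          q ^ Nat.choose k 2 * qBinom q n k * x ^ k * y ^ (n - k) * (x * q ^ n) := by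
      intro k hk
      obtain ⟨d, rfl⟩ := Nat.exists_eq_add_of_lt (Finset.mem_range.1 hk)
      have e1 : k + d + 1 + 1 - (k + 1) = d + 1 := by omega
      have e2 : k + d + 1 - (k + 1) = d := by omega
      have e3 : k + d + 1 - k = d + 1 := by omega
      simp only [qBinom, e1, e2, e3, Nat.choose_succ_succ' k 1, Nat.choose_one_right]
      rw [qPoch_succ q (k + d + 1), qPoch_succ q d, qPoch_succ q k]
      have := hP k
      have := hP d
      have := one_sub_pow_ne_zero hq d
      have := one_sub_pow_ne_zero hq k
      field_simp
      ring
    rw [Finset.sum_congr rfl hk, Finset.sum_add_distrib]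
    ring

/-- The triangular number `m (m + 1) / 2` of an integer. -/
def triangular (m : ℤ) : ℕ := (m * (m + 1) / 2).toNat

lemma triangular_spec (m : ℤ) : 2 * (triangular m : ℤ) = m * (m + 1) := by
  have h1 : 0 ≤ m * (m + 1) := by
    rcases le_or_gt 0 m with h | h
    · positivity
    · nlinarith
  have h2 := Int.even_mul_succ_self m
  rw [triangular, Int.toNat_of_nonneg (by positivity), Int.mul_ediv_cancel' h2.two_dvd]

lemma prod_two_mul {q : ℂ} (X : ℂ) (n : ℕ) :
    ∏ j ∈ Finset.range (2 * n), (q ^ n + (-X * q) * q ^ j) =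
      q ^ (n ^ 2 + triangular n) * ((-1) ^ n * (∏ j ∈ Finset.range n, (X - q ^ j)) *
        ∏ j ∈ Finset.range n, (1 - q ^ (j + 1) * X)) := by
  rw [two_mul, Finset.prod_range_add]
  have h1 : ∏ j ∈ Finset.range n, (q ^ n + (-X * q) * q ^ j) =
      q ^ (triangular n) * ((-1) ^ n * ∏ j ∈ Finset.range n, (X - q ^ j)) := by
    rw [← Finset.prod_range_reflect]
    have : ∀ j ∈ Finset.range n, q ^ n + -X * q * q ^ (n - 1 - j) =
        q ^ (n - j) * ((-1) * (X - q ^ j)) := by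
      intro j hj
      have hj' := Finset.mem_range.1 hj
      obtain ⟨d, rfl⟩ := Nat.exists_eq_add_of_lt hj'
      have e1 : j + d + 1 - 1 - j = d := by omega
      have e2 : j + d + 1 - j = d + 1 := by omega
      rw [e1, e2]
      ring
    rw [Finset.prod_congr rfl this, Finset.prod_mul_distrib, Finset.prod_mul_distrib,
      Finset.prod_pow_eq_pow_sum, Finset.prod_const, Finset.card_range]
    congr 2
    have h2 : ∀ n : ℕ, ∑ j ∈ Finset.range n, (n - j) = triangular n := by
      intro n
      rw [← Finset.sum_range_reflect]
      have : ∑ j ∈ Finset.range n, (n - (n - 1 - j)) = ∑ j ∈ Finset.range n, (j + 1) :=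
        Finset.sum_congr rfl fun j hj => by have := Finset.mem_range.1 hj; omega
      rw [this]
      have h3 := triangular_spec n
      have h4 := Finset.sum_range_succ' (fun j => j) n
      have h5 := Finset.sum_range_id_mul_two (n + 1)
      rw [Nat.add_sub_cancel] at h5
      zify at h4 h5 ⊢
      nlinarith
    exact h2 n
  have h2 : ∏ j ∈ Finset.range n, (q ^ n + (-X * q) * q ^ (n + j)) =
      q ^ (n ^ 2) * ∏ j ∈ Finset.range n, (1 - q ^ (j + 1) * X) := by
    have : ∀ j ∈ Finset.range n, q ^ n + -X * q * q ^ (n + j) = q ^ n * (1 - q ^ (j + 1) * X) := by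
      intro j _
      ring
    rw [Finset.prod_congr rfl this, Finset.prod_mul_distrib, Finset.prod_const, Finset.card_range,
      ← pow_mul, ← sq]
  rw [h1, h2]
  ring

/-- The summand of the finite triple product identity. -/
def jtpTerm (q X : ℂ) (n : ℕ) (m : ℤ) : ℂ :=
  if m ∈ Finset.Icc (-n : ℤ) n then
    qBinom q (2 * n) (m + n).toNat * ((-1) ^ m * q ^ triangular m * X ^ m) else 0

/-- The finite form of the Jacobi triple product identity. -/
lemma tsum_jtpTerm {q : ℂ} (hq : ‖q‖ < 1) (hq0 : q ≠ 0) {X : ℂ} (hX : X ≠ 0) (n : ℕ) :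
    ∑' m : ℤ, jtpTerm q X n m =
      (∏ j ∈ Finset.range n, (1 - q ^ j * X⁻¹)) * ∏ j ∈ Finset.range n, (1 - q ^ (j + 1) * X) := by
  have h1 := prod_add_mul_pow hq (-X * q) (q ^ n) (2 * n)
  rw [prod_two_mul] at h1
  have h2 : ∏ j ∈ Finset.range n, (X - q ^ j) =
      X ^ n * ∏ j ∈ Finset.range n, (1 - q ^ j * X⁻¹) := by
    have : X ^ n = ∏ _j ∈ Finset.range n, X := by simp
    rw [this, ← Finset.prod_mul_distrib]
    exact Finset.prod_congr rfl fun j _ => by field_simp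
  rw [h2] at h1
  have h3 : q ^ (n ^ 2 + triangular n) * ((-1) ^ n * X ^ n) ≠ 0 := by
    refine mul_ne_zero (pow_ne_zero _ hq0) (mul_ne_zero (by simp) (pow_ne_zero _ hX))
  refine mul_left_cancel₀ h3 ?_
  rw [show q ^ (n ^ 2 + triangular n) * ((-1) ^ n * X ^ n) *
    ((∏ j ∈ Finset.range n, (1 - q ^ j * X⁻¹)) * ∏ j ∈ Finset.range n, (1 - q ^ (j + 1) * X)) =
    q ^ (n ^ 2 + triangular n) * ((-1) ^ n * (X ^ n * ∏ j ∈ Finset.range n, (1 - q ^ j * X⁻¹)) *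
      ∏ j ∈ Finset.range n, (1 - q ^ (j + 1) * X)) by ring, h1]
  rw [tsum_eq_sum (s := Finset.Icc (-n : ℤ) n) (fun m hm => by rw [jtpTerm, if_neg hm]),
    Finset.mul_sum]
  refine Finset.sum_nbij' (fun m => (m + n).toNat) (fun k => (k : ℤ) - n) ?_ ?_ ?_ ?_ ?_
  · intro m hm
    simp only [Finset.mem_Icc, Finset.mem_range] at hm ⊢
    omega
  · intro k hk
    simp only [Finset.mem_Icc, Finset.mem_range] at hk ⊢
    omega
  · intro m hm
    simp only [Finset.mem_Icc] at hm ⊢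
    omega
  · intro k hk
    simp
  · intro m hm
    rw [jtpTerm, if_pos hm]
    rw [Finset.mem_Icc] at hm
    obtain ⟨k, hk⟩ : ∃ k : ℕ, (k : ℤ) = m + n := ⟨(m + n).toNat, by omega⟩
    obtain rfl : m = k - n := by omega
    have hk2 : k ≤ 2 * n := by omega
    rw [show ((k : ℤ) - n + n).toNat = k by omega]
    have e1 : ((-1 : ℂ)) ^ ((k : ℤ) - n) * (-1) ^ n = (-1) ^ k := by
      rw [zpow_sub₀ (by norm_num), zpow_natCast, zpow_natCast]
      field_simp
    have e2 : X ^ ((k : ℤ) - n) * X ^ n = X ^ k := by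
      rw [zpow_sub₀ hX, zpow_natCast, zpow_natCast]
      field_simp
    have e3 : q ^ (n ^ 2 + triangular n) * q ^ triangular ((k : ℤ) - n) =
        q ^ k.choose 2 * q ^ k * (q ^ n) ^ (2 * n - k) := by
      rw [← pow_add, ← pow_mul, ← pow_add, ← pow_add]
      congr 1
      have t1 := triangular_spec n
      have t2 := triangular_spec (k - n)
      have t3 := triangular_spec k
      have t4 : (k.choose 2 : ℤ) + k = triangular k := by
        have := Nat.choose_two_right k
        have h5 := Finset.sum_range_id_mul_two k
        have h6 := Finset.sum_range_id k
        rw [h6, ← this] at h5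
        rcases k with _ | k
        · simp [triangular]
        · rw [Nat.add_sub_cancel] at h5
          zify at h5
          push_cast at t3 h5 ⊢
          linarith
      zify [hk2]
      linarith
    rw [show ((-X * q) ^ k) = (-1) ^ k * X ^ k * q ^ k by rw [← mul_pow, ← mul_pow]; ring_nf,
      ← e1, ← e2]
    linear_combination (qBinom q (2 * n) k * ((-1) ^ ((k : ℤ) - n) * (-1) ^ n) *
      (X ^ ((k : ℤ) - n) * X ^ n)) * e3

/-- The infinite product `∏_{n ≥ 1} (1 - q^n X)`. -/
def eProd (q X : ℂ) : ℂ := ∏' n : ℕ, (1 - q ^ (n + 1) * X)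

lemma summable_norm_pow_succ {q : ℂ} (hq : ‖q‖ < 1) : Summable fun n : ℕ => ‖q‖ ^ (n + 1) :=
  (summable_nat_add_iff 1).mpr (summable_geometric_of_lt_one (norm_nonneg _) hq)

lemma summable_norm_pow_mul {q : ℂ} (hq : ‖q‖ < 1) (X : ℂ) :
    Summable fun n : ℕ => ‖-(q ^ (n + 1) * X)‖ := by
  simpa using (summable_norm_pow_succ hq).mul_right ‖X‖

lemma multipliable_eProd {q : ℂ} (hq : ‖q‖ < 1) (X : ℂ) :
    Multipliable fun n : ℕ => 1 - q ^ (n + 1) * X := by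
  simpa only [← sub_eq_add_neg] using
    multipliable_one_add_of_summable (f := fun n => -(q ^ (n + 1) * X)) (summable_norm_pow_mul hq X)

lemma tendsto_eProd {q : ℂ} (hq : ‖q‖ < 1) (X : ℂ) :
    Tendsto (fun n => ∏ j ∈ Finset.range n, (1 - q ^ (j + 1) * X)) atTop (𝓝 (eProd q X)) :=
  (multipliable_eProd hq X).hasProd.tendsto_prod_nat

lemma eProd_ne_zero {q : ℂ} (hq : ‖q‖ < 1) {X : ℂ} (hX : ‖X‖ ≤ 1) : eProd q X ≠ 0 := by
  have h := tprod_one_add_ne_zero_of_summable (f := fun n => -(q ^ (n + 1) * X)) (fun n => ?_)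
    (summable_norm_pow_mul hq X)
  · simpa only [eProd, ← sub_eq_add_neg] using h
  · rw [← sub_eq_add_neg]
    intro h
    have h1 : ‖q ^ (n + 1) * X‖ = 1 := by rw [← sub_eq_zero.1 h, norm_one]
    rw [norm_mul, norm_pow] at h1
    have h2 : ‖q‖ ^ (n + 1) < 1 := pow_lt_one₀ (norm_nonneg q) hq (Nat.succ_ne_zero n)
    have h3 := mul_le_mul_of_nonneg_left hX (pow_nonneg (norm_nonneg q) (n + 1))
    linarith

lemma tendsto_qPoch {q : ℂ} (hq : ‖q‖ < 1) :
    Tendsto (qPoch q) atTop (𝓝 (eProd q 1)) := by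
  have h := tendsto_eProd hq 1
  simp only [mul_one] at h
  exact h

lemma norm_nome_lt_one {τ : ℂ} (hτ : 0 < τ.im) : ‖nome τ‖ < 1 :=
  UpperHalfPlane.norm_exp_two_pi_I_lt_one ⟨τ, hτ⟩

lemma nome_ne_zero (τ : ℂ) : nome τ ≠ 0 := Complex.exp_ne_zero _

lemma jtp_summand_eq (z τ : ℂ) (m : ℤ) :
    (-1 : ℂ) ^ m * nome τ ^ triangular m * cexp (2 * I * z) ^ m =
      -I * cexp (-(π * I * τ / 4 + I * z)) * gTerm 0 (1 / 2) (z / π + 1 / 2) (τ / 2) m := by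
  have hπ : (π : ℂ) ≠ 0 := by exact_mod_cast Real.pi_ne_zero
  have h2 : 2 * (triangular m : ℂ) = m * (m + 1) := by exact_mod_cast triangular_spec m
  rw [gTerm, pow_zero, one_mul, nome, ← Complex.exp_nat_mul, ← Complex.exp_int_mul,
    ← exp_pi_int_mul_I]
  have : (2 * π * I * (τ / 2 * ((m : ℂ) + (1 / 2 : ℝ)) ^ 2 +
      ((m : ℂ) + (1 / 2 : ℝ)) * (z / π + 1 / 2))) =
      π * I * m + triangular m * (2 * π * I * τ) + m * (2 * I * z) + (π * I * τ / 4 + I * z) +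
        π / 2 * I := by
    rw [show triangular m * (2 * π * I * τ) = (2 * (triangular m : ℂ)) * (π * I * τ) by ring, h2]
    push_cast
    field_simp
    ring
  rw [this, Complex.exp_add _ (π / 2 * I), Complex.exp_pi_div_two_mul_I]
  simp only [Complex.exp_neg, Complex.exp_add]
  have := Complex.exp_ne_zero (π * I * τ / 4)
  have := Complex.exp_ne_zero (I * z)
  field_simp
  rw [I_sq]
  ring

lemma summable_norm_jtp (z : ℂ) {τ : ℂ} (hτ : 0 < τ.im) : Summable fun m : ℤ =>
    ‖(-1 : ℂ) ^ m * nome τ ^ triangular m * cexp (2 * I * z) ^ m‖ := by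
  simp only [jtp_summand_eq, norm_mul _ (gTerm _ _ _ _ _)]
  exact (summable_norm_gTerm _ _ _ (by simpa using hτ)).mul_left _

/-- The Jacobi triple product identity. -/
lemma jacobi_triple_product (z : ℂ) {τ : ℂ} (hτ : 0 < τ.im) :
    ∑' m : ℤ, (-1 : ℂ) ^ m * nome τ ^ triangular m * cexp (2 * I * z) ^ m =
      eProd (nome τ) 1 * ((1 - (cexp (2 * I * z))⁻¹) * eProd (nome τ) (cexp (2 * I * z))⁻¹ *
        eProd (nome τ) (cexp (2 * I * z))) := by
  set q := nome τ with hq_def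
  set X := cexp (2 * I * z) with hX_def
  have hq : ‖q‖ < 1 := norm_nome_lt_one hτ
  have hq0 : q ≠ 0 := nome_ne_zero τ
  have hX : X ≠ 0 := Complex.exp_ne_zero _
  have hE : eProd q 1 ≠ 0 := eProd_ne_zero hq (by simp)
  have hP := tendsto_qPoch hq
  obtain ⟨C, hC⟩ : ∃ C, ∀ n, ‖qPoch q n‖ ≤ C := by
    obtain ⟨C, hC⟩ := hP.norm.bddAbove_range
    exact ⟨C, fun n => hC ⟨n, rfl⟩⟩
  obtain ⟨c, hc⟩ : ∃ c, ∀ n, ‖(qPoch q n)⁻¹‖ ≤ c := by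
    obtain ⟨C, hC⟩ := (hP.inv₀ hE).norm.bddAbove_range
    exact ⟨C, fun n => hC ⟨n, rfl⟩⟩
  have hC0 : 0 ≤ C := (norm_nonneg _).trans (hC 0)
  have hc0 : 0 ≤ c := (norm_nonneg _).trans (hc 0)
  have hB : ∀ n k, ‖qBinom q n k‖ ≤ C * (c * c) := by
    intro n k
    rw [qBinom, div_eq_mul_inv, mul_inv, norm_mul, norm_mul]
    exact mul_le_mul (hC _) (mul_le_mul (hc _) (hc _) (norm_nonneg _) hc0)
      (by positivity) hC0
  have hlim := tendsto_tsum_of_dominated_convergence (𝓕 := atTop) (f := jtpTerm q X)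
    (g := fun m => (eProd q 1)⁻¹ * ((-1) ^ m * q ^ triangular m * X ^ m))
    (bound := fun m => (C * (c * c)) * ‖(-1) ^ m * q ^ triangular m * X ^ m‖)
    ((summable_norm_jtp z hτ).mul_left _) (fun m => ?_) (.of_forall fun n m => ?_)
  · have h2 : Tendsto (fun n => (∏ j ∈ Finset.range n, (1 - q ^ j * X⁻¹)) *
        ∏ j ∈ Finset.range n, (1 - q ^ (j + 1) * X)) atTop
        (𝓝 (((1 - X⁻¹) * eProd q X⁻¹) * eProd q X)) := by
      refine Tendsto.mul ?_ (tendsto_eProd hq X)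
      rw [← tendsto_add_atTop_iff_nat 1]
      simp only [Finset.prod_range_succ', pow_zero, one_mul]
      rw [mul_comm]
      exact (tendsto_eProd hq X⁻¹).mul_const _
    simp only [tsum_jtpTerm hq hq0 hX] at hlim
    have h3 := tendsto_nhds_unique hlim h2
    rw [tsum_mul_left, inv_mul_eq_iff_eq_mul₀ hE] at h3
    exact h3
  · have h1 : Tendsto (fun n : ℕ => qBinom q (2 * n) (m + n).toNat) atTop
        (𝓝 (eProd q 1 / (eProd q 1 * eProd q 1))) := by
      refine (hP.comp (tendsto_atTop_mono (fun n => ?_) tendsto_id)).div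
        ((hP.comp (tendsto_atTop_mono (fun n => ?_) (tendsto_sub_atTop_nat m.natAbs))).mul
        (hP.comp (tendsto_atTop_mono (fun n => ?_) (tendsto_sub_atTop_nat m.natAbs))))
        (mul_ne_zero hE hE)
      · simp only [id]; omega
      · omega
      · omega
    rw [show eProd q 1 / (eProd q 1 * eProd q 1) = (eProd q 1)⁻¹ by field_simp] at h1
    refine (h1.mul_const _).congr' ?_
    filter_upwards [eventually_ge_atTop m.natAbs] with n hn
    rw [jtpTerm, if_pos (by rw [Finset.mem_Icc]; omega)]
  · rw [jtpTerm]
    split_ifs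
    · rw [norm_mul]
      exact mul_le_mul_of_nonneg_right (hB _ _) (norm_nonneg _)
    · rw [norm_zero]
      positivity

/-- The product formula for `θ`. -/
lemma theta_eq_prod (z : ℂ) {τ : ℂ} (hτ : 0 < τ.im) :
    theta z τ = 2 * cexp (π * I * τ / 4) * eProd (nome τ) 1 * Complex.sin z *
      (eProd (nome τ) (cexp (2 * I * z)) * eProd (nome τ) (cexp (-(2 * I * z)))) := by
  have h := jacobi_triple_product z hτ
  simp only [jtp_summand_eq, tsum_mul_left] at h
  rw [← gSum, ← neg_neg (gSum _ _ _ _), ← theta_eq_gSum z hτ, Complex.exp_neg,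
    Complex.exp_add] at h
  rw [Complex.sin, Complex.exp_neg (2 * I * z)]
  have e1 : cexp (2 * I * z) = cexp (I * z) * cexp (I * z) := by
    rw [← Complex.exp_add]; ring_nf
  rw [show -z * I = -(I * z) by ring, show z * I = I * z by ring, Complex.exp_neg]
  have h1 := Complex.exp_ne_zero (I * z)
  have h2 := Complex.exp_ne_zero (π * I * τ / 4)
  generalize eProd (nome τ) (cexp (2 * I * z))⁻¹ = a at *
  generalize eProd (nome τ) (cexp (2 * I * z)) = b at *
  rw [e1] at h
  field_simp at h ⊢
  linear_combination (-I) * h + (theta z τ * cexp (I * z)) * I_sq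

end SixVertex

end

noncomputable section

namespace SixVertex

open Complex Filter Topology
open scoped Real

/-! ### Consequences of the product formula -/

lemma multipliableLocallyUniformlyOn_eProd {q : ℂ} (hq : ‖q‖ < 1) :
    MultipliableLocallyUniformlyOn (fun n X => 1 - q ^ (n + 1) * X) (Metric.ball (0 : ℂ) 2) := by
  simp_rw [sub_eq_add_neg]
  refine Summable.multipliableLocallyUniformlyOn_nat_one_add Metric.isOpen_ball
    ((summable_norm_pow_succ hq).mul_right 2) (.of_forall fun n X hX => ?_) (fun n => by fun_prop)
  rw [norm_neg, norm_mul, norm_pow]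
  exact mul_le_mul_of_nonneg_left (by simpa using (Metric.mem_ball.1 hX).le) (by positivity)

lemma differentiableOn_eProd {q : ℂ} (hq : ‖q‖ < 1) :
    DifferentiableOn ℂ (eProd q) (Metric.ball (0 : ℂ) 2) :=
  (multipliableLocallyUniformlyOn_eProd hq).hasProdLocallyUniformlyOn.differentiableOn
    (.of_forall fun _ => by simpa [Finset.prod_fn] using
      DifferentiableOn.finsetProd (fun _ _ => by fun_prop)) Metric.isOpen_ball

lemma mem_ball_two {X : ℂ} (hX : ‖X‖ ≤ 1) : X ∈ Metric.ball (0 : ℂ) 2 := by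
  rw [mem_ball_zero_iff]; linarith

lemma differentiableAt_eProd {q : ℂ} (hq : ‖q‖ < 1) {X : ℂ} (hX : ‖X‖ ≤ 1) :
    DifferentiableAt ℂ (eProd q) X :=
  (differentiableOn_eProd hq).differentiableAt (Metric.isOpen_ball.mem_nhds (mem_ball_two hX))

lemma norm_one_sub_ge {q : ℂ} (hq : ‖q‖ < 1) {X : ℂ} (hX : ‖X‖ ≤ 1) (n : ℕ) :
    1 - ‖q‖ ≤ ‖1 - q ^ (n + 1) * X‖ := by
  have h1 : ‖q ^ (n + 1) * X‖ ≤ ‖q‖ := by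
    rw [norm_mul, norm_pow]
    calc ‖q‖ ^ (n + 1) * ‖X‖ ≤ ‖q‖ ^ 1 * 1 :=
          mul_le_mul (pow_le_pow_of_le_one (norm_nonneg _) hq.le (by omega)) hX (norm_nonneg _)
            (by positivity)
      _ = ‖q‖ := by ring
  have h2 := norm_sub_norm_le (1 : ℂ) (q ^ (n + 1) * X)
  rw [norm_one] at h2
  linarith

lemma one_sub_mul_ne_zero {q : ℂ} (hq : ‖q‖ < 1) {X : ℂ} (hX : ‖X‖ ≤ 1) (n : ℕ) :
    1 - q ^ (n + 1) * X ≠ 0 :=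
  norm_pos_iff.1 ((sub_pos.2 hq).trans_le (norm_one_sub_ge hq hX n))

lemma hasSum_logDeriv_eProd {q : ℂ} (hq : ‖q‖ < 1) {X : ℂ} (hX : ‖X‖ ≤ 1) :
    HasSum (fun n : ℕ => -q ^ (n + 1) / (1 - q ^ (n + 1) * X)) (logDeriv (eProd q) X) := by
  have hl : ∀ n : ℕ, logDeriv (fun X => 1 - q ^ (n + 1) * X) X =
      -q ^ (n + 1) / (1 - q ^ (n + 1) * X) := by
    intro n
    rw [logDeriv_apply]
    congr 1
    simp
  have hs : Summable fun n : ℕ => -q ^ (n + 1) / (1 - q ^ (n + 1) * X) := by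
    refine Summable.of_norm_bounded ((summable_norm_pow_succ hq).div_const (1 - ‖q‖)) fun n => ?_
    rw [norm_div, norm_neg, norm_pow]
    have := sub_pos.2 hq
    have := norm_one_sub_ge hq hX n
    gcongr
  have h := logDeriv_tprod_eq_tsum (f := fun n X => 1 - q ^ (n + 1) * X) Metric.isOpen_ball
    (mem_ball_two hX) (one_sub_mul_ne_zero hq hX) (fun n => by fun_prop)
    (by simpa only [hl] using hs) (multipliableLocallyUniformlyOn_eProd hq) (eProd_ne_zero hq hX)
  simp only [hl] at h
  have h2 := hs.hasSum
  rw [← h] at h2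
  exact h2

lemma eta_eq_eProd (τ : ℂ) : ModularForm.eta τ = cexp (π * I * τ / 12) * eProd (nome τ) 1 := by
  rw [ModularForm.eta, eProd]
  congr 1
  · rw [Function.Periodic.qParam]
    congr 1
    push_cast
    ring
  · refine tprod_congr fun n => ?_
    rw [ModularForm.eta_q_eq_pow, nome, mul_one]

lemma eta_ne_zero {τ : ℂ} (hτ : 0 < τ.im) : ModularForm.eta τ ≠ 0 := ModularForm.eta_ne_zero hτ

lemma three_mul_im_pos {τ : ℂ} (hτ : 0 < τ.im) : 0 < (3 * τ).im := by
  simpa using hτ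

/-- A primitive cube root of unity. -/
def omega : ℂ := cexp (2 * I * (π / 3))

lemma norm_omega : ‖omega‖ = 1 := by
  rw [omega, Complex.norm_exp]
  simp

lemma omega_ne_zero : omega ≠ 0 := Complex.exp_ne_zero _

lemma omega_inv : omega⁻¹ = cexp (-(2 * I * (π / 3))) := (Complex.exp_neg _).symm

lemma norm_omega_inv : ‖omega⁻¹‖ = 1 := by rw [norm_inv, norm_omega, inv_one]

lemma cos_pi_div_three' : Complex.cos (π / 3) = 1 / 2 := by
  have := congrArg ((↑) : ℝ → ℂ) Real.cos_pi_div_three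
  push_cast at this
  exact this

lemma sin_pi_div_three' : Complex.sin (π / 3) = (√3 : ℝ) / 2 := by
  have := congrArg ((↑) : ℝ → ℂ) Real.sin_pi_div_three
  push_cast at this
  exact this

lemma sqrt_three_sq : ((√3 : ℝ) : ℂ) ^ 2 = 3 := by
  rw [← ofReal_pow, Real.sq_sqrt (by norm_num)]
  norm_num

lemma sqrt_three_ne_zero : ((√3 : ℝ) : ℂ) ≠ 0 := by
  intro h
  have := sqrt_three_sq
  rw [h] at this
  norm_num at this

lemma omega_eq : omega = -1 / 2 + (√3 : ℝ) / 2 * I := by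
  have : 2 * I * (π / 3 : ℂ) = (2 * (π / 3)) * I := by ring
  rw [omega, this, Complex.exp_mul_I, Complex.cos_two_mul, Complex.sin_two_mul,
    cos_pi_div_three', sin_pi_div_three']
  ring

lemma omega_inv_eq : omega⁻¹ = -1 / 2 - (√3 : ℝ) / 2 * I := by
  refine (eq_inv_of_mul_eq_one_right ?_).symm
  rw [omega_eq]
  linear_combination (-(((√3 : ℝ) : ℂ) ^ 2) / 4) * I_sq + (1 / 4) * sqrt_three_sq

lemma omega_add_inv : omega + omega⁻¹ = -1 := by rw [omega_inv_eq, omega_eq]; ring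

lemma omega_sub_inv : omega - omega⁻¹ = (√3 : ℝ) * I := by rw [omega_inv_eq, omega_eq]; ring

lemma omega_mul_inv : omega * omega⁻¹ = 1 := mul_inv_cancel₀ omega_ne_zero

lemma one_sub_omega_mul (x : ℂ) : (1 - x * omega) * (1 - x * omega⁻¹) = 1 + x + x ^ 2 := by
  linear_combination (-x) * omega_add_inv + x ^ 2 * omega_mul_inv

lemma nome_three_mul (τ : ℂ) : nome (3 * τ) = nome τ ^ 3 := by
  rw [nome, nome, ← Complex.exp_nat_mul]
  push_cast
  ring_nf

lemma eProd_mul_omega {q : ℂ} (hq : ‖q‖ < 1) :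
    eProd q 1 * (eProd q omega * eProd q omega⁻¹) = eProd (q ^ 3) 1 := by
  rw [eProd, eProd, eProd, eProd, ← (multipliable_eProd hq _).tprod_mul (multipliable_eProd hq _),
    ← (multipliable_eProd hq _).tprod_mul
      ((multipliable_eProd hq _).mul (multipliable_eProd hq _))]
  refine tprod_congr fun n => ?_
  rw [one_sub_omega_mul]
  ring

lemma theta_third {τ : ℂ} (hτ : 0 < τ.im) :
    theta (π / 3) τ = (√3 : ℝ) * ModularForm.eta (3 * τ) := by
  rw [theta_eq_prod _ hτ, ← omega_inv, ← omega, eta_eq_eProd, nome_three_mul,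
    ← eProd_mul_omega (norm_nome_lt_one hτ), sin_pi_div_three',
    show π * I * (3 * τ) / 12 = π * I * τ / 4 by ring]
  ring

lemma theta_third_ne_zero {τ : ℂ} (hτ : 0 < τ.im) : theta (π / 3) τ ≠ 0 := by
  rw [theta_third hτ]
  exact mul_ne_zero sqrt_three_ne_zero (eta_ne_zero (three_mul_im_pos hτ))

lemma hasDerivAt_theta {τ : ℂ} (hτ : 0 < τ.im) (z : ℂ) :
    HasDerivAt (fun w => theta w τ) (thetaD 1 z τ) z := by
  simpa only [thetaD_zero] using hasDerivAt_thetaD 0 z hτ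

lemma thetaD_one_zero {τ : ℂ} (hτ : 0 < τ.im) :
    thetaD 1 0 τ = 2 * ModularForm.eta τ ^ 3 := by
  have hq := norm_nome_lt_one hτ
  have h1 : HasDerivAt (fun z : ℂ => eProd (nome τ) (cexp (2 * I * z)) *
      eProd (nome τ) (cexp (-(2 * I * z)))) (deriv (fun z : ℂ => eProd (nome τ) (cexp (2 * I * z)) *
      eProd (nome τ) (cexp (-(2 * I * z)))) 0) 0 := by
    refine DifferentiableAt.hasDerivAt (DifferentiableAt.mul ?_ ?_)
    · exact DifferentiableAt.comp (0 : ℂ) (differentiableAt_eProd hq (by simp)) (by fun_prop)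
    · exact DifferentiableAt.comp (0 : ℂ) (differentiableAt_eProd hq (by simp)) (by fun_prop)
  have h2 := ((Complex.hasDerivAt_sin 0).const_mul
    (2 * cexp (π * I * τ / 4) * eProd (nome τ) 1)).mul h1
  have h3 := (hasDerivAt_theta hτ 0).unique
    (h2.congr_of_eventuallyEq (.of_forall fun z => theta_eq_prod z hτ))
  rw [h3, eta_eq_eProd, mul_pow, ← Complex.exp_nat_mul]
  simp only [Complex.sin_zero, Complex.cos_zero, mul_zero, neg_zero, Complex.exp_zero, zero_mul,
    add_zero, mul_one]
  rw [show ((3 : ℕ) : ℂ) * (π * I * τ / 12) = π * I * τ / 4 by push_cast; ring]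
  ring

lemma thetaD_one_zero_ne_zero {τ : ℂ} (hτ : 0 < τ.im) : thetaD 1 0 τ ≠ 0 := by
  rw [thetaD_one_zero hτ]
  exact mul_ne_zero two_ne_zero (pow_ne_zero _ (eta_ne_zero hτ))

lemma AFun_eq_logDeriv {τ : ℂ} (hτ : 0 < τ.im) :
    AFun (π / 3) τ = 1 / (√3 : ℝ) + (2 * I * omega) * logDeriv (eProd (nome τ)) omega -
      (2 * I * omega⁻¹) * logDeriv (eProd (nome τ)) omega⁻¹ := by
  have hq := norm_nome_lt_one hτ
  have e1 := eProd_ne_zero hq norm_omega.le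
  have e2 := eProd_ne_zero hq norm_omega_inv.le
  have e3 : eProd (nome τ) 1 ≠ 0 := eProd_ne_zero hq (by simp)
  have d1 := (differentiableAt_eProd hq norm_omega.le).hasDerivAt
  have d2 := (differentiableAt_eProd hq norm_omega_inv.le).hasDerivAt
  rw [omega] at d1
  rw [omega_inv] at d2
  have c1 := d1.comp (π / 3 : ℂ) ((hasDerivAt_id (π / 3 : ℂ)).const_mul (2 * I)).cexp
  have c2 := d2.comp (π / 3 : ℂ) ((hasDerivAt_id (π / 3 : ℂ)).const_mul (2 * I)).neg.cexp
  have h2 := ((Complex.hasDerivAt_sin (π / 3)).const_mul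
    (2 * cexp (π * I * τ / 4) * eProd (nome τ) 1)).mul (c1.mul c2)
  have h3 := (hasDerivAt_theta hτ (π / 3)).unique
    (h2.congr_of_eventuallyEq (.of_forall fun z => theta_eq_prod z hτ))
  rw [AFun, h3, theta_eq_prod _ hτ, logDeriv_apply, logDeriv_apply]
  simp only [Function.comp_apply, Pi.mul_apply, Pi.neg_apply, id]
  rw [show cexp (2 * I * (π / 3)) = omega from rfl,
    show cexp (-(2 * I * (π / 3))) = omega⁻¹ from omega_inv.symm]
  rw [sin_pi_div_three', cos_pi_div_three']
  have := sqrt_three_ne_zero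
  have := Complex.exp_ne_zero (π * I * τ / 4)
  generalize omega⁻¹ = w at *
  field_simp
  ring

/-- The Lambert series of `√3 A`. -/
lemma hasSum_lambert {τ : ℂ} (hτ : 0 < τ.im) :
    HasSum (fun n : ℕ => 6 * (nome τ ^ (n + 1) /
      (1 + nome τ ^ (n + 1) + nome τ ^ (2 * (n + 1))))) ((√3 : ℝ) * AFun (π / 3) τ - 1) := by
  have hq := norm_nome_lt_one hτ
  have h := (((hasSum_logDeriv_eProd hq norm_omega.le).mul_left (2 * I * omega)).sub
    ((hasSum_logDeriv_eProd hq norm_omega_inv.le).mul_left (2 * I * omega⁻¹))).mul_left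
      (((√3 : ℝ) : ℂ))
  have hs := sqrt_three_ne_zero
  rw [AFun_eq_logDeriv hτ, show (√3 : ℝ) * (1 / (√3 : ℝ) +
    (2 * I * omega) * logDeriv (eProd (nome τ)) omega -
      (2 * I * omega⁻¹) * logDeriv (eProd (nome τ)) omega⁻¹) - 1 = (√3 : ℝ) *
    ((2 * I * omega) * logDeriv (eProd (nome τ)) omega -
      (2 * I * omega⁻¹) * logDeriv (eProd (nome τ)) omega⁻¹) by
    linear_combination mul_one_div_cancel hs]
  refine h.congr_fun fun n => ?_
  have n1 := one_sub_mul_ne_zero hq norm_omega.le n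
  have n2 := one_sub_mul_ne_zero hq norm_omega_inv.le n
  have n3 := one_sub_omega_mul (nome τ ^ (n + 1))
  have n4 := omega_sub_inv
  rw [show 2 * (n + 1) = (n + 1) * 2 by ring, pow_mul, ← n3]
  clear n3
  generalize nome τ ^ (n + 1) = x at *
  generalize omega⁻¹ = w at *
  field_simp
  linear_combination (2 * I * (√3 : ℝ) * x) * n4 + (2 * x * I ^ 2) * sqrt_three_sq + 6 * x * I_sq

end SixVertex

end

noncomputable section

namespace SixVertex

open Complex Filter Topology
open scoped Real

/-! ### The differential system at the three-torsion point -/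

/-- The elimination at a three-torsion point, for the normalised derivatives of `θ`. -/
lemma torsion_elimination {A B c P2 P3 P4 P5 S : ℂ} (hB : B ≠ 0)
    (d1 : B = P3 - 3 * A * P2 + 2 * A ^ 3) (d2 : -2 * B * A = P4 - 3 * P2 ^ 2 + 2 * A ^ 4)
    (d3 : 4 * B * P2 = P5 + 3 * A * P4 - 6 * A * P2 ^ 2 - 6 * P2 * P3 + 8 * A ^ 3 * P2)
    (N : P4 - 4 * A * P3 + 3 * P2 ^ 2 = 12 * c * (P2 - A ^ 2) - (S - 9 * c ^ 2))
    (N' : P5 - 3 * A * P4 + 2 * P2 * P3 = 12 * c * (P3 - A * P2) - 2 * (S - 9 * c ^ 2) * A) :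
    P2 = c - 2 * A ^ 2 ∧ P3 = 3 * A * c - 8 * A ^ 3 + B ∧
      S = 15 * c ^ 2 - 54 * A ^ 4 + 6 * A * B := by
  have h2 : P2 = c - 2 * A ^ 2 := by
    refine mul_left_cancel₀ (mul_ne_zero (by norm_num : (12 : ℂ) ≠ 0) hB) ?_
    obtain rfl : P3 = B + 3 * A * P2 - 2 * A ^ 3 := by linear_combination -d1
    obtain rfl : P4 = 3 * P2 ^ 2 - 2 * A ^ 4 - 2 * B * A := by linear_combination -d2
    linear_combination d3 + N' - 2 * A * N
  have h3 : P3 = 3 * A * c - 8 * A ^ 3 + B := by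
    linear_combination -d1 + 3 * A * h2
  refine ⟨h2, h3, ?_⟩
  have h4 : P4 = 3 * P2 ^ 2 - 2 * A ^ 4 - 2 * B * A := by linear_combination -d2
  rw [h4, h3, h2] at N
  linear_combination N

/-- The quotient `(θ'(0) / θ(π/3))³`. -/
def BFun (τ : ℂ) : ℂ := thetaD 1 0 τ ^ 3 / thetaD 0 (π / 3) τ ^ 3

/-- The quotient `θ'''(0) / (3 θ'(0))`. -/
def CFun (τ : ℂ) : ℂ := thetaD 3 0 τ / (3 * thetaD 1 0 τ)

lemma thetaD_zero_third_ne_zero {τ : ℂ} (hτ : 0 < τ.im) : thetaD 0 (π / 3) τ ≠ 0 := by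
  rw [thetaD_zero]
  exact theta_third_ne_zero hτ

lemma BFun_ne_zero {τ : ℂ} (hτ : 0 < τ.im) : BFun τ ≠ 0 :=
  div_ne_zero (pow_ne_zero _ (thetaD_one_zero_ne_zero hτ))
    (pow_ne_zero _ (thetaD_zero_third_ne_zero hτ))

lemma thetaD_two_third (k : ℕ) {τ : ℂ} (hτ : 0 < τ.im) :
    thetaD k (2 * (π / 3)) τ = (-1) ^ k * thetaD k (π / 3) τ := by
  rw [← thetaD_pi_sub _ _ hτ]
  congr 1
  ring

lemma AFun_def' (τ : ℂ) :
    AFun (π / 3) τ = thetaD 1 (π / 3) τ / thetaD 0 (π / 3) τ := by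
  rw [AFun, thetaD_zero]

lemma thetaD_one_third {τ : ℂ} (hτ : 0 < τ.im) :
    thetaD 1 (π / 3) τ = thetaD 0 (π / 3) τ * AFun (π / 3) τ := by
  rw [AFun_def', mul_div_cancel₀ _ (thetaD_zero_third_ne_zero hτ)]

lemma torsion_relations {τ : ℂ} (hτ : 0 < τ.im) :
    thetaD 2 (π / 3) τ = thetaD 0 (π / 3) τ * (CFun τ - 2 * AFun (π / 3) τ ^ 2) ∧
    thetaD 3 (π / 3) τ = thetaD 0 (π / 3) τ *
      (3 * AFun (π / 3) τ * CFun τ - 8 * AFun (π / 3) τ ^ 3 + BFun τ) ∧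
    thetaD 5 0 τ = thetaD 1 0 τ *
      (15 * CFun τ ^ 2 - 54 * AFun (π / 3) τ ^ 4 + 6 * AFun (π / 3) τ * BFun τ) := by
  have hadd := hasAdditionTheorem_theta hτ
  have d1 := hadd.duplication (π / 3)
  have d2 := hadd.duplication_deriv (π / 3)
  have d3 := hadd.duplication_deriv_two (π / 3)
  have N := hadd.weierstrass_ode (π / 3)
  have N' := hadd.weierstrass_ode_deriv (π / 3)
  rw [thetaD_two_third _ hτ] at d1 d2 d3
  have h1 := thetaD_one_third hτ
  have hp := thetaD_zero_third_ne_zero hτ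
  have hs := thetaD_one_zero_ne_zero hτ
  have hB0 := BFun_ne_zero hτ
  have hB : thetaD 1 0 τ ^ 3 = BFun τ * thetaD 0 (π / 3) τ ^ 3 := by
    rw [BFun, div_mul_cancel₀ _ (pow_ne_zero _ hp)]
  have hC : thetaD 3 0 τ = 3 * CFun τ * thetaD 1 0 τ := by
    rw [CFun]; field_simp
  obtain ⟨S, hS⟩ : ∃ S, thetaD 5 0 τ = thetaD 1 0 τ * S := ⟨_, (mul_div_cancel₀ _ hs).symm⟩
  obtain ⟨P2, hP2⟩ : ∃ P, thetaD 2 (π / 3) τ = thetaD 0 (π / 3) τ * P :=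
    ⟨_, (mul_div_cancel₀ _ hp).symm⟩
  obtain ⟨P3, hP3⟩ : ∃ P, thetaD 3 (π / 3) τ = thetaD 0 (π / 3) τ * P :=
    ⟨_, (mul_div_cancel₀ _ hp).symm⟩
  obtain ⟨P4, hP4⟩ : ∃ P, thetaD 4 (π / 3) τ = thetaD 0 (π / 3) τ * P :=
    ⟨_, (mul_div_cancel₀ _ hp).symm⟩
  obtain ⟨P5, hP5⟩ : ∃ P, thetaD 5 (π / 3) τ = thetaD 0 (π / 3) τ * P :=
    ⟨_, (mul_div_cancel₀ _ hp).symm⟩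
  rw [h1, hP2, hP3, hB] at d1
  rw [h1, hP2, hP4, hB] at d2
  rw [h1, hP2, hP3, hP4, hP5, hB] at d3
  rw [h1, hP2, hP3, hP4, hS, hC] at N
  rw [h1, hP2, hP3, hP4, hP5, hS, hC] at N'
  rw [hP2, hP3, hS]
  generalize thetaD 0 (π / 3) τ = p at *
  generalize thetaD 1 0 τ = s at *
  generalize AFun (π / 3) τ = A at *
  generalize BFun τ = B at *
  generalize CFun τ = c at *
  have hp4 : p ^ 4 ≠ 0 := pow_ne_zero _ hp
  have hsp : s ^ 2 * p ^ 2 ≠ 0 := mul_ne_zero (pow_ne_zero _ hs) (pow_ne_zero _ hp)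
  obtain ⟨e1, e2, e3⟩ := torsion_elimination (A := A) (B := B) (c := c) (P2 := P2) (P3 := P3)
    (P4 := P4) (P5 := P5) (S := S) hB0
    (mul_left_cancel₀ hp4 (by linear_combination d1))
    (mul_left_cancel₀ hp4 (by linear_combination d2))
    (mul_left_cancel₀ hp4 (by linear_combination d3))
    (mul_left_cancel₀ hsp (by linear_combination N))
    (mul_left_cancel₀ hsp (by linear_combination N'))
  exact ⟨by rw [e1], by rw [e2], by rw [e3]⟩

lemma hasDerivAt_AFun {τ : ℂ} (hτ : 0 < τ.im) :
    HasDerivAt (AFun (π / 3)) (2 * π * I * (-(BFun τ + 2 * AFun (π / 3) τ * CFun τ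
      - 6 * AFun (π / 3) τ ^ 3) / 8)) τ := by
  have hp := thetaD_zero_third_ne_zero hτ
  obtain ⟨h2, h3, -⟩ := torsion_relations hτ
  have h := (hasDerivAt_thetaD_snd 1 (π / 3) hτ).div (hasDerivAt_thetaD_snd 0 (π / 3) hτ) hp
  refine (h.congr_deriv ?_).congr_of_eventuallyEq (.of_forall fun t => AFun_def' t)
  rw [show 1 + 2 = 3 from rfl, show 0 + 2 = 2 from rfl, h2, h3, thetaD_one_third hτ]
  field_simp
  ring

lemma hasDerivAt_BFun {τ : ℂ} (hτ : 0 < τ.im) :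
    HasDerivAt BFun (2 * π * I * (-(3 / 4) * BFun τ * (CFun τ + AFun (π / 3) τ ^ 2))) τ := by
  have hp := thetaD_zero_third_ne_zero hτ
  have hs := thetaD_one_zero_ne_zero hτ
  obtain ⟨h2, -, -⟩ := torsion_relations hτ
  have h := ((hasDerivAt_thetaD_snd 1 0 hτ).pow 3).div
    ((hasDerivAt_thetaD_snd 0 (π / 3) hτ).pow 3) (pow_ne_zero _ hp)
  refine h.congr_deriv ?_
  have hC : thetaD 3 0 τ = 3 * CFun τ * thetaD 1 0 τ := by
    rw [CFun]; field_simp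
  rw [show 1 + 2 = 3 from rfl, show 0 + 2 = 2 from rfl, h2, hC, BFun]
  simp only [Pi.pow_apply]
  push_cast
  field_simp
  ring

lemma hasDerivAt_CFun {τ : ℂ} (hτ : 0 < τ.im) :
    HasDerivAt CFun (2 * π * I * (-(CFun τ ^ 2 - 9 * AFun (π / 3) τ ^ 4 +
      AFun (π / 3) τ * BFun τ) / 4)) τ := by
  have hs := thetaD_one_zero_ne_zero hτ
  obtain ⟨-, -, h5⟩ := torsion_relations hτ
  have h := (hasDerivAt_thetaD_snd 3 0 hτ).div
    ((hasDerivAt_thetaD_snd 1 0 hτ).const_mul 3) (mul_ne_zero three_ne_zero hs)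
  refine h.congr_deriv ?_
  have hC : thetaD 3 0 τ = 3 * CFun τ * thetaD 1 0 τ := by
    rw [CFun]; field_simp
  rw [show 1 + 2 = 3 from rfl, show 3 + 2 = 5 from rfl, h5, hC]
  field_simp
  ring

/-! ### `t` and `R` in terms of the differential system -/

lemma tFun_eq {τ : ℂ} (hτ : 0 < τ.im) (hA : AFun (π / 3) τ ≠ 0) :
    tFun (π / 3) τ = (6 * AFun (π / 3) τ ^ 3 - 2 * AFun (π / 3) τ * CFun τ - BFun τ) /
      (48 * (√3 : ℝ) * AFun (π / 3) τ ^ 2) := by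
  have hp := thetaD_zero_third_ne_zero hτ
  obtain ⟨h2, h3, -⟩ := torsion_relations hτ
  have hs := sqrt_three_ne_zero
  rw [tFun, ← thetaD_zero, h2, h3, thetaD_one_third hτ, cos_pi_div_three', sin_pi_div_three',
    div_pow, show ((√3 : ℝ) : ℂ) ^ 3 = ((√3 : ℝ) : ℂ) ^ 2 * (√3 : ℝ) by ring, sqrt_three_sq]
  field_simp
  ring

lemma RFun_eq {τ : ℂ} (hτ : 0 < τ.im) (hA : AFun (π / 3) τ ≠ 0) :
    RFun (π / 3) τ = (8 * AFun (π / 3) τ ^ 3 - BFun τ) / (216 * AFun (π / 3) τ ^ 3) := by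
  have hp := thetaD_zero_third_ne_zero hτ
  have hs := thetaD_one_zero_ne_zero hτ
  obtain ⟨h2, h3, -⟩ := torsion_relations hτ
  have hC : thetaD 3 0 τ = 3 * CFun τ * thetaD 1 0 τ := by
    rw [CFun]; field_simp
  rw [RFun, ← thetaD_zero, h3, hC, thetaD_one_third hτ, cos_pi_div_three', sin_pi_div_three',
    div_pow ((√3 : ℝ) : ℂ), show ((√3 : ℝ) : ℂ) ^ 4 = (((√3 : ℝ) : ℂ) ^ 2) ^ 2 by ring, sqrt_three_sq]
  field_simp
  ring

lemma hFun_eq {τ : ℂ} (hτ : 0 < τ.im) :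
    hFun τ = 16 / 729 * (thetaD 0 (π / 3) τ ^ 12 / thetaD 1 0 τ ^ 4) := by
  have h1 := eta_ne_zero hτ
  rw [hFun, thetaD_zero, theta_third hτ, thetaD_one_zero hτ, mul_pow ((√3 : ℝ) : ℂ),
    show ((√3 : ℝ) : ℂ) ^ 12 = (((√3 : ℝ) : ℂ) ^ 2) ^ 6 by ring, sqrt_three_sq]
  field_simp
  ring

lemma hFun_ne_zero {τ : ℂ} (hτ : 0 < τ.im) : hFun τ ≠ 0 :=
  pow_ne_zero _ (div_ne_zero (eta_ne_zero (three_mul_im_pos hτ)) (eta_ne_zero hτ))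

lemma hasDerivAt_hFun {τ : ℂ} (hτ : 0 < τ.im) :
    HasDerivAt hFun (2 * π * I * (3 * AFun (π / 3) τ ^ 2 * hFun τ)) τ := by
  have hp := thetaD_zero_third_ne_zero hτ
  have hs := thetaD_one_zero_ne_zero hτ
  obtain ⟨h2, -, -⟩ := torsion_relations hτ
  have h := (((hasDerivAt_thetaD_snd 0 (π / 3) hτ).pow 12).div
    ((hasDerivAt_thetaD_snd 1 0 hτ).pow 4) (pow_ne_zero _ hs)).const_mul (16 / 729)
  have hC : thetaD 3 0 τ = 3 * CFun τ * thetaD 1 0 τ := by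
    rw [CFun]; field_simp
  refine (h.congr_deriv ?_).congr_of_eventuallyEq ?_
  · rw [show 1 + 2 = 3 from rfl, show 0 + 2 = 2 from rfl, h2, hC, hFun_eq hτ]
    simp only [Pi.pow_apply]
    push_cast
    field_simp
    ring
  · filter_upwards [(isOpen_halfPlane 0).mem_nhds hτ] with t ht
    exact hFun_eq ht

lemma isPreconnected_halfPlane : IsPreconnected {w : ℂ | 0 < w.im} :=
  (convex_halfSpace_im_gt 0).isPreconnected

lemma exists_const_of_hasDerivAt_zero {f : ℂ → ℂ}
    (hf : ∀ τ : ℂ, 0 < τ.im → HasDerivAt f 0 τ) : ∃ C, ∀ τ : ℂ, 0 < τ.im → f τ = C :=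
  (isOpen_halfPlane 0).exists_is_const_of_deriv_eq_zero isPreconnected_halfPlane
    (fun τ hτ => (hf τ hτ).differentiableAt.differentiableWithinAt)
    (fun τ hτ => (hf τ hτ).deriv)

lemma exists_hauptmodul_const :
    ∃ C, ∀ τ : ℂ, 0 < τ.im → 8 * AFun (π / 3) τ ^ 3 - BFun τ = C * (BFun τ * hFun τ) := by
  obtain ⟨C, hC⟩ := exists_const_of_hasDerivAt_zero
    (f := fun τ => (8 * AFun (π / 3) τ ^ 3 - BFun τ) / (BFun τ * hFun τ)) (fun τ hτ => by
      have hB := BFun_ne_zero hτ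
      have hh := hFun_ne_zero hτ
      have h := ((((hasDerivAt_AFun hτ).pow 3).const_mul 8).sub (hasDerivAt_BFun hτ)).div
        ((hasDerivAt_BFun hτ).mul (hasDerivAt_hFun hτ)) (mul_ne_zero hB hh)
      refine h.congr_deriv ?_
      simp only [Pi.pow_apply, Pi.mul_apply, Pi.sub_apply]
      push_cast
      field_simp
      ring)
  refine ⟨C, fun τ hτ => ?_⟩
  rw [← hC τ hτ, div_mul_cancel₀ _ (mul_ne_zero (BFun_ne_zero hτ) (hFun_ne_zero hτ))]

end SixVertex

end

noncomputable section

namespace SixVertex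

open Complex Filter Topology
open scoped Real

/-! ### Derivatives of `t` and `R` -/

lemma eventually_AFun_ne_zero {τ : ℂ} (hτ : 0 < τ.im) (hA : AFun (π / 3) τ ≠ 0) :
    ∀ᶠ t in 𝓝 τ, 0 < t.im ∧ AFun (π / 3) t ≠ 0 :=
  ((isOpen_halfPlane 0).eventually_mem hτ).and
    ((hasDerivAt_AFun hτ).continuousAt.eventually_ne hA)

lemma hasDerivAt_RFun {τ : ℂ} (hτ : 0 < τ.im) (hA : AFun (π / 3) τ ≠ 0) :
    HasDerivAt (RFun (π / 3)) (2 * π * I * (3 * AFun (π / 3) τ ^ 2 *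
      (RFun (π / 3) τ * (1 - 27 * RFun (π / 3) τ)))) τ := by
  have h := ((((hasDerivAt_AFun hτ).pow 3).const_mul 8).sub (hasDerivAt_BFun hτ)).div
    (((hasDerivAt_AFun hτ).pow 3).const_mul 216)
    (mul_ne_zero (by norm_num) (pow_ne_zero 3 hA))
  refine (h.congr_deriv ?_).congr_of_eventuallyEq ?_
  · rw [RFun_eq hτ hA]
    simp only [Pi.pow_apply, Pi.sub_apply]
    push_cast
    field_simp
    ring
  · filter_upwards [eventually_AFun_ne_zero hτ hA] with t ht
    exact RFun_eq ht.1 ht.2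

lemma hasDerivAt_tFun {τ : ℂ} (hτ : 0 < τ.im) (hA : AFun (π / 3) τ ≠ 0) :
    HasDerivAt (tFun (π / 3)) (2 * π * I * ((√3 : ℝ) * AFun (π / 3) τ * (3 * AFun (π / 3) τ ^ 2 *
      (RFun (π / 3) τ * (1 - 27 * RFun (π / 3) τ))))) τ := by
  have hs := sqrt_three_ne_zero
  have h := (((((hasDerivAt_AFun hτ).pow 3).const_mul 6).sub
    (((hasDerivAt_AFun hτ).const_mul 2).mul (hasDerivAt_CFun hτ))).sub (hasDerivAt_BFun hτ)).div
    (((hasDerivAt_AFun hτ).pow 2).const_mul (48 * ((√3 : ℝ) : ℂ)))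
    (mul_ne_zero (mul_ne_zero (by norm_num) hs) (pow_ne_zero 2 hA))
  refine (h.congr_deriv ?_).congr_of_eventuallyEq ?_
  · rw [RFun_eq hτ hA]
    simp only [Pi.pow_apply, Pi.sub_apply, Pi.mul_apply]
    push_cast
    field_simp
    rw [sqrt_three_sq]
    ring
  · filter_upwards [eventually_AFun_ne_zero hτ hA] with t ht
    exact tFun_eq ht.1 ht.2

/-- The derivative of `√3 A`, in terms of `t`. -/
lemma hasDerivAt_sqrt_three_mul_AFun {τ : ℂ} (hτ : 0 < τ.im) (hA : AFun (π / 3) τ ≠ 0) :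
    HasDerivAt (fun t => (√3 : ℝ) * AFun (π / 3) t) (2 * π * I *
      (6 * ((√3 : ℝ) * AFun (π / 3) τ) ^ 2 * tFun (π / 3) τ)) τ := by
  refine ((hasDerivAt_AFun hτ).const_mul ((√3 : ℝ) : ℂ)).congr_deriv ?_
  have hs := sqrt_three_ne_zero
  rw [tFun_eq hτ hA]
  field_simp
  ring

/-! ### The functions of `τ` as functions of `q` -/

/-- The sum of the Lambert series of `√3 A`, as a function of `q`. -/
def aSer (q : ℂ) : ℂ :=
  1 + ∑' n : ℕ, 6 * (q ^ (n + 1) / (1 + q ^ (n + 1) + q ^ (2 * (n + 1))))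

/-- The function `h`, as a function of `q`. -/
def hSer (q : ℂ) : ℂ := q * (eProd (q ^ 3) 1 / eProd q 1) ^ 12

/-- The function `R`, as a function of `q`. -/
def RSer (q : ℂ) : ℂ := hSer q / (1 + 27 * hSer q)

/-- The function `t`, as a function of `q`. -/
def tSer (q : ℂ) : ℂ := q * deriv aSer q / (6 * aSer q ^ 2)

lemma aSer_nome {τ : ℂ} (hτ : 0 < τ.im) : aSer (nome τ) = (√3 : ℝ) * AFun (π / 3) τ := by
  rw [aSer, (hasSum_lambert hτ).tsum_eq]
  ring

lemma hSer_nome {τ : ℂ} : hSer (nome τ) = hFun τ := by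
  rw [hSer, hFun, eta_eq_eProd, eta_eq_eProd, nome_three_mul, nome]
  have h1 : cexp (2 * π * I * τ) = (cexp (π * I * (3 * τ) / 12) / cexp (π * I * τ / 12)) ^ 12 := by
    rw [← Complex.exp_sub, ← Complex.exp_nat_mul]
    congr 1
    push_cast
    ring
  rw [mul_div_mul_comm, mul_pow, ← h1]

lemma quarter_le_norm {w : ℂ} (hw : ‖w‖ ≤ 1 / 2) : 1 / 4 ≤ ‖1 + w + w ^ 2‖ := by
  have h1 : ‖w + w ^ 2‖ ≤ 3 / 4 := by
    refine (norm_add_le _ _).trans ?_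
    rw [norm_pow]
    nlinarith [norm_nonneg w]
  have h2 := norm_sub_norm_le (1 : ℂ) (-(w + w ^ 2))
  rw [norm_one, norm_neg, sub_neg_eq_add, ← add_assoc] at h2
  linarith

lemma norm_pow_succ_le_half {q : ℂ} (hq : ‖q‖ < 1 / 2) (n : ℕ) : ‖q ^ (n + 1)‖ ≤ 1 / 2 := by
  rw [norm_pow]
  calc ‖q‖ ^ (n + 1) ≤ ‖q‖ ^ 1 := pow_le_pow_of_le_one (norm_nonneg _) (by linarith) (by omega)
    _ ≤ 1 / 2 := by rw [pow_one]; exact hq.le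

lemma lambert_denom_ne_zero {q : ℂ} (hq : ‖q‖ < 1 / 2) (n : ℕ) :
    1 + q ^ (n + 1) + q ^ (2 * (n + 1)) ≠ 0 := by
  rw [mul_comm 2, pow_mul]
  exact norm_pos_iff.1 (lt_of_lt_of_le (by norm_num) (quarter_le_norm (norm_pow_succ_le_half hq n)))

lemma norm_lambert_le {q : ℂ} (hq : ‖q‖ < 1 / 2) (n : ℕ) :
    ‖6 * (q ^ (n + 1) / (1 + q ^ (n + 1) + q ^ (2 * (n + 1))))‖ ≤ 24 * (1 / 2) ^ (n + 1) := by
  rw [norm_mul, norm_div, mul_comm 2 (n + 1), pow_mul]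
  have h1 := quarter_le_norm (norm_pow_succ_le_half hq n)
  have h2 : ‖q ^ (n + 1)‖ ≤ (1 / 2) ^ (n + 1) := by
    rw [norm_pow]
    exact pow_le_pow_left₀ (norm_nonneg _) hq.le _
  have h3 : ‖q ^ (n + 1)‖ / ‖1 + q ^ (n + 1) + (q ^ (n + 1)) ^ 2‖ ≤ (1 / 2) ^ (n + 1) / (1 / 4) :=
    div_le_div₀ (by positivity) h2 (by norm_num) h1
  have h4 : ‖(6 : ℂ)‖ = 6 := by norm_num
  rw [h4]
  linarith

lemma summable_half_pow : Summable fun n : ℕ => 24 * (1 / 2 : ℝ) ^ (n + 1) :=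
  ((summable_nat_add_iff 1).mpr summable_geometric_two).mul_left 24

lemma differentiableOn_lambert (n : ℕ) :
    DifferentiableOn ℂ (fun q : ℂ => 6 * (q ^ (n + 1) / (1 + q ^ (n + 1) + q ^ (2 * (n + 1)))))
      (Metric.ball 0 (1 / 2)) := by
  intro q hq
  have hq' : ‖q‖ < 1 / 2 := by simpa using hq
  have := lambert_denom_ne_zero hq' n
  exact DifferentiableAt.differentiableWithinAt (by fun_prop (disch := assumption))

lemma differentiableOn_aSer : DifferentiableOn ℂ aSer (Metric.ball 0 (1 / 2)) :=
  (differentiableOn_tsum_of_summable_norm summable_half_pow differentiableOn_lambert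
    Metric.isOpen_ball fun n q hq => norm_lambert_le (by simpa using hq) n).const_add 1

lemma zero_mem_ball_half : (0 : ℂ) ∈ Metric.ball (0 : ℂ) (1 / 2) := by simp

lemma analyticAt_aSer : AnalyticAt ℂ aSer 0 :=
  differentiableOn_aSer.analyticAt (Metric.isOpen_ball.mem_nhds zero_mem_ball_half)

lemma aSer_zero : aSer 0 = 1 := by simp [aSer]

lemma deriv_aSer_zero : deriv aSer 0 = 6 := by
  have h := hasSum_deriv_of_summable_norm summable_half_pow differentiableOn_lambert
    Metric.isOpen_ball (fun n q hq => norm_lambert_le (by simpa using hq) n) zero_mem_ball_half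
  have h1 : ∀ n : ℕ, deriv (fun q : ℂ => 6 * (q ^ (n + 1) / (1 + q ^ (n + 1) +
      q ^ (2 * (n + 1))))) 0 = if n = 0 then 6 else 0 := by
    intro n
    have hn : HasDerivAt (fun q : ℂ => q ^ (n + 1)) (((n + 1 : ℕ) : ℂ) * 0 ^ n) 0 := by
      simpa using hasDerivAt_pow (n + 1) (0 : ℂ)
    have hn2 : HasDerivAt (fun q : ℂ => q ^ (2 * (n + 1)))
        (((2 * (n + 1) : ℕ) : ℂ) * 0 ^ (2 * (n + 1) - 1)) 0 := hasDerivAt_pow _ (0 : ℂ)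
    have := ((hn.div ((hn.const_add 1).add hn2) (by simp)).const_mul 6).deriv
    refine this.trans ?_
    rcases n with _ | n <;> simp
  simp only [h1] at h
  have h2 := h.unique (hasSum_ite_eq 0 (6 : ℂ))
  rw [← h2]
  exact congrFun (deriv_const_add' (1 : ℂ)) 0

lemma eProd_one (q : ℂ) : eProd q 1 = ∏' n : ℕ, (1 - q ^ (n + 1)) := by
  simp [eProd]

lemma differentiableOn_eProd_one :
    DifferentiableOn ℂ (fun q => eProd q 1) (Metric.ball 0 1) := by
  simp only [eProd_one]
  exact ModularForm.differentiableOn_tprod_one_sub_pow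

lemma differentiableAt_eProd_one {q : ℂ} (hq : ‖q‖ < 1) :
    DifferentiableAt ℂ (fun q => eProd q 1) q :=
  differentiableOn_eProd_one.differentiableAt (Metric.isOpen_ball.mem_nhds (by simpa using hq))

lemma eProd_zero : eProd 0 1 = 1 := by simp [eProd]

lemma differentiableAt_eta_quotient {q : ℂ} (hq : ‖q‖ < 1) :
    DifferentiableAt ℂ (fun q => (eProd (q ^ 3) 1 / eProd q 1) ^ 12) q := by
  have h3 : ‖q ^ 3‖ < 1 := by
    rw [norm_pow]
    exact pow_lt_one₀ (norm_nonneg _) hq (by norm_num)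
  refine DifferentiableAt.pow (DifferentiableAt.div ?_ (differentiableAt_eProd_one hq)
    (eProd_ne_zero hq (by simp))) 12
  exact DifferentiableAt.comp (g := fun q => eProd q 1) q (differentiableAt_eProd_one h3)
    (by fun_prop)

lemma analyticAt_hSer : AnalyticAt ℂ hSer 0 := by
  have : DifferentiableOn ℂ hSer (Metric.ball 0 1) := fun q hq =>
    (differentiableAt_id.mul
      (differentiableAt_eta_quotient (by simpa using hq))).differentiableWithinAt
  exact this.analyticAt (Metric.isOpen_ball.mem_nhds (by simp))

lemma hSer_zero : hSer 0 = 0 := by simp [hSer]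

lemma hasDerivAt_hSer_zero : HasDerivAt hSer 1 0 := by
  have h := (hasDerivAt_id (0 : ℂ)).mul
    (differentiableAt_eta_quotient (q := 0) (by simp)).hasDerivAt
  refine h.congr_deriv ?_
  simp [eProd_zero]

lemma exists_nome_eq {q : ℂ} (hq0 : q ≠ 0) (hq : ‖q‖ < 1) : ∃ τ : ℂ, 0 < τ.im ∧ nome τ = q := by
  refine ⟨Function.Periodic.invQParam 1 q, ?_, ?_⟩
  · rw [Function.Periodic.im_invQParam]
    have : Real.log ‖q‖ < 0 := Real.log_neg (norm_pos_iff.2 hq0) hq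
    have : 0 < 1 / (2 * π) := by positivity
    have h3 := mul_pos this (neg_pos.2 ‹Real.log ‖q‖ < 0›)
    rw [neg_div]
    linarith
  · have := Function.Periodic.qParam_right_inv (h := 1) one_ne_zero hq0
    rw [Function.Periodic.qParam] at this
    rw [nome, ← this, this]
    simpa using this

/-- Near `q = 0`, every `q ≠ 0` comes from some `τ` with `A ≠ 0`. -/
lemma eventually_exists_nome :
    ∀ᶠ q in 𝓝[≠] (0 : ℂ), ∃ τ : ℂ, 0 < τ.im ∧ nome τ = q ∧ AFun (π / 3) τ ≠ 0 := by
  have h1 : ∀ᶠ q in 𝓝 (0 : ℂ), aSer q ≠ 0 :=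
    analyticAt_aSer.continuousAt.eventually_ne (by rw [aSer_zero]; exact one_ne_zero)
  have h2 : ∀ᶠ q in 𝓝 (0 : ℂ), ‖q‖ < 1 := by
    filter_upwards [Metric.ball_mem_nhds (0 : ℂ) one_pos] with q hq using by simpa using hq
  filter_upwards [self_mem_nhdsWithin, nhdsWithin_le_nhds h1, nhdsWithin_le_nhds h2]
    with q hq0 ha hq
  obtain ⟨τ, hτ, rfl⟩ := exists_nome_eq hq0 hq
  exact ⟨τ, hτ, rfl, fun h => ha (by rw [aSer_nome hτ, h, mul_zero])⟩

lemma hasDerivAt_nome (τ : ℂ) : HasDerivAt nome (2 * π * I * nome τ) τ := by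
  refine ((hasDerivAt_id τ).const_mul (2 * π * I)).cexp.congr_deriv ?_
  rw [nome]
  simp only [id]
  ring

/-- The operator `q d/dq` in terms of `τ`. -/
lemma nome_mul_deriv {F f : ℂ → ℂ} {τ d : ℂ} (hF : DifferentiableAt ℂ F (nome τ))
    (hf : HasDerivAt f (2 * π * I * d) τ) (h : ∀ᶠ t in 𝓝 τ, F (nome t) = f t) :
    nome τ * deriv F (nome τ) = d := by
  have h1 : HasDerivAt f (deriv F (nome τ) * (2 * π * I * nome τ)) τ :=
    (hF.hasDerivAt.comp τ (hasDerivAt_nome τ)).congr_of_eventuallyEq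
      (h.mono fun t ht => ht.symm)
  have h2 := h1.unique hf
  refine mul_left_cancel₀ Complex.two_pi_I_ne_zero ?_
  linear_combination h2

lemma eventually_nome_norm_lt {τ : ℂ} (r : ℝ) (h : ‖nome τ‖ < r) : ∀ᶠ t in 𝓝 τ, ‖nome t‖ < r :=
  (hasDerivAt_nome τ).continuousAt.norm.eventually_lt continuousAt_const h

lemma tSer_nome {τ : ℂ} (hτ : 0 < τ.im) (hA : AFun (π / 3) τ ≠ 0) (hq : ‖nome τ‖ < 1 / 2) :
    tSer (nome τ) = tFun (π / 3) τ := by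
  have hd : DifferentiableAt ℂ aSer (nome τ) :=
    differentiableOn_aSer.differentiableAt (Metric.isOpen_ball.mem_nhds (by simpa using hq))
  have h := nome_mul_deriv hd (hasDerivAt_sqrt_three_mul_AFun hτ hA)
    (((isOpen_halfPlane 0).eventually_mem hτ).mono fun t ht => aSer_nome ht)
  have hs := sqrt_three_ne_zero
  rw [tSer, h, aSer_nome hτ]
  field_simp

lemma analyticAt_tSer : AnalyticAt ℂ tSer 0 := by
  refine AnalyticAt.div (analyticAt_id.mul analyticAt_aSer.deriv)
    (analyticAt_const.mul (analyticAt_aSer.pow 2)) ?_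
  simp [aSer_zero]

lemma tSer_zero : tSer 0 = 0 := by simp [tSer]

lemma hasDerivAt_tSer_zero : HasDerivAt tSer 1 0 := by
  have h := ((hasDerivAt_id (0 : ℂ)).mul analyticAt_aSer.deriv.differentiableAt.hasDerivAt).div
    ((analyticAt_aSer.differentiableAt.hasDerivAt.pow 2).const_mul 6) (by simp [aSer_zero])
  refine h.congr_deriv ?_
  simp only [aSer_zero, deriv_aSer_zero, Pi.mul_apply, Pi.pow_apply, id]
  norm_num

lemma RFun_eq_of_const {C : ℂ} (hC : ∀ τ : ℂ, 0 < τ.im →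
    8 * AFun (π / 3) τ ^ 3 - BFun τ = C * (BFun τ * hFun τ)) {τ : ℂ} (hτ : 0 < τ.im)
    (hA : AFun (π / 3) τ ≠ 0) :
    1 + C * hFun τ ≠ 0 ∧ 27 * RFun (π / 3) τ = C * hFun τ / (1 + C * hFun τ) := by
  have hB := BFun_ne_zero hτ
  have h1 : BFun τ * (1 + C * hFun τ) = 8 * AFun (π / 3) τ ^ 3 := by
    linear_combination -hC τ hτ
  have h2 : 1 + C * hFun τ ≠ 0 := by
    intro h
    rw [h, mul_zero] at h1
    exact mul_ne_zero (by norm_num) (pow_ne_zero 3 hA) h1.symm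
  refine ⟨h2, ?_⟩
  have h3 : 216 * AFun (π / 3) τ ^ 3 = 27 * (BFun τ * (1 + C * hFun τ)) := by
    linear_combination -27 * h1
  rw [RFun_eq hτ hA, hC τ hτ, h3]
  field_simp

lemma hauptmodul_const {C : ℂ} (hC : ∀ τ : ℂ, 0 < τ.im →
    8 * AFun (π / 3) τ ^ 3 - BFun τ = C * (BFun τ * hFun τ)) : C = 27 := by
  set F : ℂ → ℂ := fun q => C * hSer q / (1 + C * hSer q) / 27 with hF
  have hFa : AnalyticAt ℂ F 0 := by
    refine AnalyticAt.div (AnalyticAt.div (analyticAt_const.mul analyticAt_hSer)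
      (analyticAt_const.add (analyticAt_const.mul analyticAt_hSer)) ?_) analyticAt_const
      (by norm_num)
    simp [hSer_zero]
  have hF0 : HasDerivAt F (C / 27) 0 := by
    have h := ((hasDerivAt_hSer_zero.const_mul C).div
      ((hasDerivAt_hSer_zero.const_mul C).const_add 1) (by simp [hSer_zero])).div_const 27
    refine h.congr_deriv ?_
    simp [hSer_zero]
  have hrel : ∀ᶠ q in 𝓝[≠] (0 : ℂ), deriv tSer q = aSer q * deriv F q := by
    have h1 : ∀ᶠ q in 𝓝 (0 : ℂ), ‖q‖ < 1 / 2 := by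
      filter_upwards [Metric.ball_mem_nhds (0 : ℂ) (by norm_num : (0 : ℝ) < 1 / 2)] with q hq
        using by simpa using hq
    filter_upwards [self_mem_nhdsWithin, eventually_exists_nome, nhdsWithin_le_nhds h1,
      nhdsWithin_le_nhds hFa.eventually_analyticAt,
      nhdsWithin_le_nhds analyticAt_tSer.eventually_analyticAt] with q hq0 hq hq1 hFq htq
    obtain ⟨τ, hτ, rfl, hA⟩ := hq
    have e1 := nome_mul_deriv htq.differentiableAt (hasDerivAt_tFun hτ hA) (by
      filter_upwards [eventually_AFun_ne_zero hτ hA, eventually_nome_norm_lt _ hq1] with t ht ht'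
      exact tSer_nome ht.1 ht.2 ht')
    have e2 := nome_mul_deriv hFq.differentiableAt (hasDerivAt_RFun hτ hA) (by
      filter_upwards [eventually_AFun_ne_zero hτ hA] with t ht
      have := (RFun_eq_of_const hC ht.1 ht.2).2
      rw [hF]
      simp only [hSer_nome]
      rw [← this]
      ring)
    refine mul_left_cancel₀ (nome_ne_zero τ) ?_
    rw [e1, mul_left_comm (nome τ), e2, aSer_nome hτ]
  have hl : Tendsto (deriv tSer) (𝓝[≠] 0) (𝓝 1) := by
    have := analyticAt_tSer.deriv.continuousAt.tendsto
    rw [hasDerivAt_tSer_zero.deriv] at this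
    exact this.mono_left nhdsWithin_le_nhds
  have hr : Tendsto (fun q => aSer q * deriv F q) (𝓝[≠] 0) (𝓝 (1 * (C / 27))) := by
    have := analyticAt_aSer.continuousAt.tendsto.mul hFa.deriv.continuousAt.tendsto
    rw [hF0.deriv, aSer_zero] at this
    exact this.mono_left nhdsWithin_le_nhds
  have := tendsto_nhds_unique (hl.congr' hrel) hr
  linear_combination -27 * this

lemma hauptmodul {τ : ℂ} (hτ : 0 < τ.im) :
    8 * AFun (π / 3) τ ^ 3 - BFun τ = 27 * (BFun τ * hFun τ) := by
  obtain ⟨C, hC⟩ := exists_hauptmodul_const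
  obtain rfl := hauptmodul_const hC
  exact hC τ hτ

lemma one_add_hFun_ne_zero {τ : ℂ} (hτ : 0 < τ.im) (hA : AFun (π / 3) τ ≠ 0) :
    1 + 27 * hFun τ ≠ 0 :=
  (RFun_eq_of_const (fun _ h => hauptmodul h) hτ hA).1

lemma RFun_eq_hFun {τ : ℂ} (hτ : 0 < τ.im) (hA : AFun (π / 3) τ ≠ 0) :
    RFun (π / 3) τ = hFun τ / (1 + 27 * hFun τ) := by
  have := (RFun_eq_of_const (fun _ h => hauptmodul h) hτ hA).2
  linear_combination (1 / 27) * this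

lemma RSer_nome {τ : ℂ} (hτ : 0 < τ.im) (hA : AFun (π / 3) τ ≠ 0) :
    RSer (nome τ) = RFun (π / 3) τ := by
  rw [RSer, hSer_nome, RFun_eq_hFun hτ hA]

lemma analyticAt_RSer : AnalyticAt ℂ RSer 0 := by
  refine AnalyticAt.div analyticAt_hSer
    (analyticAt_const.add (analyticAt_const.mul analyticAt_hSer)) ?_
  simp [hSer_zero]

lemma RSer_zero : RSer 0 = 0 := by simp [RSer, hSer_zero]

lemma hasDerivAt_RSer_zero : HasDerivAt RSer 1 0 := by
  have h := hasDerivAt_hSer_zero.div ((hasDerivAt_hSer_zero.const_mul 27).const_add 1)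
    (by simp [hSer_zero])
  refine h.congr_deriv ?_
  simp [hSer_zero]

lemma AnalyticAt.eventually_eq_of_punctured {F G : ℂ → ℂ} (hF : AnalyticAt ℂ F 0)
    (hG : AnalyticAt ℂ G 0) (h : ∀ᶠ q in 𝓝[≠] (0 : ℂ), F q = G q) : ∀ᶠ q in 𝓝 (0 : ℂ), F q = G q :=
  (hF.frequently_eq_iff_eventually_eq hG).1 h.frequently

/-- The differential equations in `q` satisfied by `R`, `t` and `√3 A`. -/
lemma eventually_qODE :
    (∀ᶠ q in 𝓝 (0 : ℂ), q * deriv RSer q = aSer q ^ 2 * (RSer q * (1 - 27 * RSer q))) ∧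
    (∀ᶠ q in 𝓝 (0 : ℂ), q * deriv tSer q =
      aSer q * (aSer q ^ 2 * (RSer q * (1 - 27 * RSer q)))) ∧
    (∀ᶠ q in 𝓝 (0 : ℂ), q * deriv aSer q = 6 * aSer q ^ 2 * tSer q) := by
  have ha := analyticAt_aSer
  have ht := analyticAt_tSer
  have hR := analyticAt_RSer
  have hp : AnalyticAt ℂ (fun q => aSer q ^ 2 * (RSer q * (1 - 27 * RSer q))) 0 :=
    (ha.pow 2).mul (hR.mul (analyticAt_const.sub (analyticAt_const.mul hR)))
  refine ⟨AnalyticAt.eventually_eq_of_punctured (analyticAt_id.mul hR.deriv) hp ?_,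
    AnalyticAt.eventually_eq_of_punctured (analyticAt_id.mul ht.deriv) (ha.mul hp) ?_, ?_⟩
  · filter_upwards [eventually_exists_nome, nhdsWithin_le_nhds hR.eventually_analyticAt]
      with q hq hRq
    obtain ⟨τ, hτ, rfl, hA⟩ := hq
    have e := nome_mul_deriv hRq.differentiableAt (hasDerivAt_RFun hτ hA)
      ((eventually_AFun_ne_zero hτ hA).mono fun t ht => RSer_nome ht.1 ht.2)
    rw [e, RSer_nome hτ hA, aSer_nome hτ, mul_pow, sqrt_three_sq]
  · have h1 : ∀ᶠ q in 𝓝 (0 : ℂ), ‖q‖ < 1 / 2 := by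
      filter_upwards [Metric.ball_mem_nhds (0 : ℂ) (by norm_num : (0 : ℝ) < 1 / 2)] with q hq
        using by simpa using hq
    filter_upwards [eventually_exists_nome, nhdsWithin_le_nhds ht.eventually_analyticAt,
      nhdsWithin_le_nhds h1] with q hq htq hq1
    obtain ⟨τ, hτ, rfl, hA⟩ := hq
    have e := nome_mul_deriv htq.differentiableAt (hasDerivAt_tFun hτ hA) (by
      filter_upwards [eventually_AFun_ne_zero hτ hA, eventually_nome_norm_lt _ hq1] with t ht ht'
      exact tSer_nome ht.1 ht.2 ht')
    rw [e, RSer_nome hτ hA, aSer_nome hτ, mul_pow, sqrt_three_sq]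
  · filter_upwards [ha.continuousAt.eventually_ne (by rw [aSer_zero]; exact one_ne_zero)]
      with q hq
    rw [tSer]
    field_simp

end SixVertex

end

noncomputable section

namespace SixVertex

open Complex Filter Topology
open scoped Real

/-! ### Sums over the hexagonal lattice -/

/-- The linear form `2x + y` at the point `(x, y) = p + (s, s)`. -/
def latForm (s : ℂ) (p : ℤ × ℤ) : ℂ := 2 * ((p.1 : ℂ) + s) + ((p.2 : ℂ) + s)

/-- The summand of the lattice sum with a character. -/
def latChar (s x τ : ℂ) (p : ℤ × ℤ) : ℂ := latticeTerm s τ p * cexp (2 * I * (latForm s p * x))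

lemma latChar_eq (s x τ : ℂ) (p : ℤ × ℤ) : latChar s x τ p =
    cexp (2 * π * I * (τ * (latForm s p / 2) ^ 2 + latForm s p / 2 * (2 * x / π))) *
      cexp (2 * π * I * (3 * τ * (((p.2 : ℂ) + s) / 2) ^ 2)) := by
  have hπ : (π : ℂ) ≠ 0 := by exact_mod_cast Real.pi_ne_zero
  rw [latChar, latticeTerm, ← Complex.exp_add, ← Complex.exp_add, latForm]
  congr 1
  field_simp
  ring

lemma isCompl_range_parity (c : ℤ) :
    IsCompl (Set.range fun p : ℤ × ℤ => (p.1 - p.2, 2 * p.2))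
      (Set.range fun p : ℤ × ℤ => (p.1 - p.2 - c, 2 * p.2 + 1)) := by
  constructor
  · rw [Set.disjoint_left]
    rintro _ ⟨⟨a, b⟩, rfl⟩ ⟨⟨c, d⟩, h⟩
    simp only [Prod.mk.injEq] at h
    omega
  · rw [codisjoint_iff_le_sup]
    rintro ⟨m, n⟩ -
    rcases Int.emod_two_eq_zero_or_one n with h | h
    · exact Or.inl ⟨(m + n / 2, n / 2), Prod.ext (by dsimp; omega) (by dsimp; omega)⟩
    · exact Or.inr ⟨(m + n / 2 + c, n / 2), Prod.ext (by dsimp; omega) (by dsimp; omega)⟩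

/-- Decomposition of a lattice sum by the parity of the second coordinate. -/
lemma HasSum.of_parity {f : ℤ × ℤ → ℂ} (c : ℤ) {a b : ℂ}
    (ha : HasSum (fun p : ℤ × ℤ => f (p.1 - p.2, 2 * p.2)) a)
    (hb : HasSum (fun p : ℤ × ℤ => f (p.1 - p.2 - c, 2 * p.2 + 1)) b) : HasSum f (a + b) := by
  refine HasSum.of_two_ranges (i := fun p : ℤ × ℤ => (p.1 - p.2, 2 * p.2))
    (j := fun p : ℤ × ℤ => (p.1 - p.2 - c, 2 * p.2 + 1)) ?_ ?_ (isCompl_range_parity c) ha hb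
  · rintro ⟨a, b⟩ ⟨c, d⟩ h
    simp only [Prod.mk.injEq] at h ⊢
    omega
  · rintro ⟨a, b⟩ ⟨c, d⟩ h
    simp only [Prod.mk.injEq] at h ⊢
    omega

/-- The moments of the lattice sums. -/
def latMoment (δ ε : ℝ) (j k : ℕ) (x τ : ℂ) : ℂ :=
  gSum j 0 (2 * x / π) τ * gSum k δ 0 (3 * τ) + gSum j (1 / 2) (2 * x / π) τ * gSum k ε 0 (3 * τ)

lemma hasSum_latChar_zero (j k : ℕ) (x : ℂ) {τ : ℂ} (hτ : 0 < τ.im) :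
    HasSum (fun p : ℤ × ℤ => (latForm 0 p / 2) ^ j * (((p.2 : ℂ) + 0) / 2) ^ k * latChar 0 x τ p)
      (latMoment 0 (1 / 2) j k x τ) := by
  have h3 := three_mul_im_pos hτ
  refine HasSum.of_parity 0 ?_ ?_
  · refine (hasSum_gTerm_mul j k 0 0 (2 * x / π) 0 hτ h3).congr_fun fun p => ?_
    rw [latChar_eq, latForm, gTerm, gTerm]
    push_cast
    ring_nf
  · refine (hasSum_gTerm_mul j k (1 / 2) (1 / 2) (2 * x / π) 0 hτ h3).congr_fun fun p => ?_
    rw [latChar_eq, latForm, gTerm, gTerm]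
    push_cast
    ring_nf

lemma hasSum_latChar_third (j k : ℕ) (x : ℂ) {τ : ℂ} (hτ : 0 < τ.im) :
    HasSum (fun p : ℤ × ℤ => (latForm (1 / 3) p / 2) ^ j * (((p.2 : ℂ) + 1 / 3) / 2) ^ k *
      latChar (1 / 3) x τ p) (latMoment (2 / 3) (1 / 6) j k x τ) := by
  have h3 := three_mul_im_pos hτ
  rw [latMoment, add_comm]
  refine HasSum.of_parity 1 ?_ ?_
  · refine (hasSum_gTerm_mul j k (1 / 2) (1 / 6) (2 * x / π) 0 hτ h3).congr_fun fun p => ?_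
    rw [latChar_eq, latForm, gTerm, gTerm]
    push_cast
    ring_nf
  · refine (hasSum_gTerm_mul j k 0 (2 / 3) (2 * x / π) 0 hτ h3).congr_fun fun p => ?_
    rw [latChar_eq, latForm, gTerm, gTerm]
    push_cast
    ring_nf

/-- The rotation of order three of the lattice, preserving the coset of `(d/3, d/3)`. -/
def latRotation (d : ℤ) : ℤ × ℤ ≃ ℤ × ℤ where
  toFun p := (-p.1 - p.2 - d, p.1)
  invFun p := (p.2, -p.1 - p.2 - d)
  left_inv p := Prod.ext (by dsimp) (by dsimp; omega)
  right_inv p := Prod.ext (by dsimp; omega) (by dsimp)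

lemma latticeTerm_rotation (d : ℤ) (τ : ℂ) (p : ℤ × ℤ) :
    latticeTerm (d / 3) τ (latRotation d p) = latticeTerm (d / 3) τ p := by
  rw [latticeTerm, latticeTerm, latRotation]
  congr 1
  dsimp
  push_cast
  ring

/-- The consequence of rotation invariance for the second moments. -/
lemma moment_rotation (d : ℤ) {w : ℤ × ℤ → ℂ} (hw : ∀ p, w (latRotation d p) = w p) {X Y : ℂ}
    (hX : HasSum (fun p : ℤ × ℤ => (latForm (d / 3) p / 2) ^ 2 * (((p.2 : ℂ) + d / 3) / 2) ^ 0 *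
      w p) X)
    (hY : HasSum (fun p : ℤ × ℤ => (latForm (d / 3) p / 2) ^ 0 * (((p.2 : ℂ) + d / 3) / 2) ^ 2 *
      w p) Y) : X = 3 * Y := by
  have h1 := (latRotation d).hasSum_iff.2 hX
  have h2 := (latRotation d).hasSum_iff.2 h1
  have h3 := (hX.add h1).add h2
  have h4 := ((hX.add (hY.mul_left 3)).mul_left (3 / 2)).congr_fun (g := fun p => _) fun p => rfl
  have h5 := h3.unique (h4.congr_fun fun p => by
    simp only [Function.comp_apply, hw, latForm]
    simp only [latRotation, Equiv.coe_fn_mk]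
    push_cast
    ring)
  linear_combination 2 / 3 * h5

lemma latChar_rotation_zero (x τ : ℂ) (hx : x = 0 ∨ x = π / 3) (p : ℤ × ℤ) :
    latChar 0 x τ (latRotation 0 p) = latChar 0 x τ p := by
  have h := latticeTerm_rotation 0 τ p
  rw [Int.cast_zero, zero_div] at h
  rw [latChar, latChar, h]
  congr 1
  rcases hx with rfl | rfl
  · simp
  · rw [← Complex.exp_periodic.int_mul (-(p.1 + p.2)) (2 * I * (latForm 0 p * (π / 3)))]
    congr 1
    simp only [latForm, latRotation, Equiv.coe_fn_mk]
    push_cast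
    ring

lemma latChar_rotation_third (τ : ℂ) (p : ℤ × ℤ) :
    latChar (1 / 3) 0 τ (latRotation 1 p) = latChar (1 / 3) 0 τ p := by
  have h := latticeTerm_rotation 1 τ p
  rw [Int.cast_one] at h
  rw [latChar, latChar, h]
  simp

lemma latMoment_rotation_zero (x : ℂ) {τ : ℂ} (hτ : 0 < τ.im) (hx : x = 0 ∨ x = π / 3) :
    latMoment 0 (1 / 2) 2 0 x τ = 3 * latMoment 0 (1 / 2) 0 2 x τ := by
  refine moment_rotation 0 (latChar_rotation_zero x τ hx) ?_ ?_
  · simpa using hasSum_latChar_zero 2 0 x hτ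
  · simpa using hasSum_latChar_zero 0 2 x hτ

lemma latMoment_rotation_third {τ : ℂ} (hτ : 0 < τ.im) :
    latMoment (2 / 3) (1 / 6) 2 0 0 τ = 3 * latMoment (2 / 3) (1 / 6) 0 2 0 τ := by
  refine moment_rotation 1 (latChar_rotation_third τ) ?_ ?_
  · simpa using hasSum_latChar_third 2 0 0 hτ
  · simpa using hasSum_latChar_third 0 2 0 hτ

/-- The twisted sum over the non-trivial coset vanishes. -/
lemma latMoment_third_eq_zero {τ : ℂ} (hτ : 0 < τ.im) :
    latMoment (2 / 3) (1 / 6) 0 0 (π / 3) τ = 0 := by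
  have h := hasSum_latChar_third 0 0 (π / 3) hτ
  simp only [pow_zero, one_mul] at h
  have h1 := (latRotation 1).hasSum_iff.2 h
  have h2 := h1.unique ((h.mul_left (omega⁻¹ ^ 2)).congr_fun fun p => by
    have h := latticeTerm_rotation 1 τ p
    rw [Int.cast_one] at h
    rw [Function.comp_apply, latChar, latChar, h, omega_inv, ← Complex.exp_nat_mul,
      mul_left_comm (cexp _), ← Complex.exp_add]
    congr 1
    rw [← Complex.exp_periodic.int_mul (-(p.1 + p.2)) (_ + _)]
    congr 1
    simp only [latForm, latRotation, Equiv.coe_fn_mk]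
    push_cast
    ring)
  have h3 : omega⁻¹ ^ 2 - 1 ≠ 0 := by
    rw [omega_inv_eq]
    intro h
    have h4 := congrArg Complex.re h
    simp [sq] at h4
    have := Real.mul_self_sqrt (show (0 : ℝ) ≤ 3 by norm_num)
    nlinarith
  refine (mul_eq_zero.1 (?_ : (omega⁻¹ ^ 2 - 1) * _ = 0)).resolve_left h3
  linear_combination -h2

end SixVertex

end

noncomputable section

namespace SixVertex

open Complex Filter Topology
open scoped Real

namespace HasAdditionTheorem

variable {f u v : ℕ → ℂ → ℂ}

lemma bracket_two_zero (h : HasAdditionTheorem f u v) (x : ℂ) :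
    2 * (f 1 x * f 1 x) + 2 * (f 0 x * f 2 x) = u 2 x * v 0 0 - v 2 x * u 0 0 := by
  have h1 := (h.hasDerivAt_mul 0 1 x).const_mul 2
  rw [funext h.bracket_one_zero] at h1
  rw [← h1.unique (h.hasDerivAt_bracket_fst 1 0 x 0)]
  ring

lemma add_fst_two (h : HasAdditionTheorem f u v) (x y : ℂ) :
    f 2 (x + y) * f 0 (x - y) + 2 * (f 1 (x + y) * f 1 (x - y)) + f 0 (x + y) * f 2 (x - y) =
      u 2 x * v 0 y - v 2 x * u 0 y := by
  have h0 : ∀ k, HasDerivAt (fun x => f k (x + y)) (f (k + 1) (x + y)) x :=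
    fun k => (h.hf k (x + y)).comp_add_const x y
  have h0' : ∀ k, HasDerivAt (fun x => f k (x - y)) (f (k + 1) (x - y)) x :=
    fun k => (h.hf k (x - y)).comp_sub_const x y
  have h1 := ((h0 1).mul (h0' 0)).add ((h0 0).mul (h0' 1))
  have h2 : HasDerivAt (fun x => u 1 x * v 0 y - v 1 x * u 0 y)
      (f 2 (x + y) * f 0 (x - y) + f 1 (x + y) * f 1 (x - y) +
        (f 1 (x + y) * f 1 (x - y) + f 0 (x + y) * f 2 (x - y))) x := by
    rw [← funext fun x => h.add_fst x y]
    exact h1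
  rw [← h2.unique (h.hasDerivAt_bracket_fst 1 0 x y)]
  ring

/-- Second derivative at `0` of a combination of `u` and `v`. -/
lemma interpolation_zero (h : HasAdditionTheorem f u v) (U V y : ℂ) :
    (u 2 0 * U + v 2 0 * V) * f 0 y ^ 2 = 2 * f 1 0 ^ 2 * (u 0 y * U + v 0 y * V) +
      (2 * (f 2 y * f 0 y) - 2 * (f 1 y * f 1 y)) * (u 0 0 * U + v 0 0 * V) := by
  have e0 : f 0 0 = 0 := h.even 0
  have h1 := h.bracket_two_zero 0
  rw [e0] at h1
  have h2 := h.bracket_two y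
  have h3 := h.bracket_zero y
  linear_combination (u 2 0 * U + v 2 0 * V) * h3 - (u 0 y * U + v 0 y * V) * h1 -
    (u 0 0 * U + v 0 0 * V) * h2

/-- Second derivative at `y` of a combination of `u` and `v`. -/
lemma interpolation (h : HasAdditionTheorem f u v) (U V y : ℂ) :
    (u 2 y * U + v 2 y * V) * f 0 y ^ 2 =
      (2 * (f 1 y * f 1 y) + 2 * (f 0 y * f 2 y)) * (u 0 y * U + v 0 y * V) -
        2 * f 1 (2 * y) * f 1 0 * (u 0 0 * U + v 0 0 * V) := by
  have e0 : f 0 0 = 0 := h.even 0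
  have e2 : f 2 0 = 0 := h.even 1
  have h1 := h.add_fst_two y y
  rw [sub_self, e0, e2, ← two_mul] at h1
  have h2 := h.bracket_two_zero y
  have h3 := h.bracket_zero y
  linear_combination (u 2 y * U + v 2 y * V) * h3 - (u 0 y * U + v 0 y * V) * h2 +
    (u 0 0 * U + v 0 0 * V) * h1

end HasAdditionTheorem

/-! ### Differential equations for the lattice sums -/

/-- The `k`-th derivative of the lattice sum with a character. -/
def latPhi (δ ε : ℝ) (k : ℕ) (x τ : ℂ) : ℂ :=
  gD 0 k x τ * gSum 0 δ 0 (3 * τ) + gD (1 / 2) k x τ * gSum 0 ε 0 (3 * τ)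

lemma latPhi_eq_latMoment (δ ε : ℝ) (k : ℕ) (x τ : ℂ) :
    latPhi δ ε k x τ = (4 * I) ^ k * latMoment δ ε k 0 x τ := by
  rw [latPhi, latMoment, gD, gD]
  ring

lemma hasDerivAt_latPhi {δ ε : ℝ} {x τ : ℂ} (hτ : 0 < τ.im)
    (h : latMoment δ ε 2 0 x τ = 3 * latMoment δ ε 0 2 x τ) :
    HasDerivAt (latPhi δ ε 0 x) (2 * π * I * (-latPhi δ ε 2 x τ / 8)) τ := by
  have h3 := three_mul_im_pos hτ
  have hg : ∀ δ : ℝ, HasDerivAt (fun t => gSum 0 δ 0 (3 * t))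
      (2 * π * I * (3 * gSum 2 δ 0 (3 * τ))) τ := fun δ =>
    ((hasDerivAt_gSum_snd 0 δ 0 h3).comp τ ((hasDerivAt_id τ).const_mul 3)).congr_deriv (by ring)
  have h1 := ((hasDerivAt_gD_snd 0 0 x hτ).mul (hg δ)).add
    ((hasDerivAt_gD_snd (1 / 2) 0 x hτ).mul (hg ε))
  refine h1.congr_deriv ?_
  rw [latMoment, latMoment] at h
  simp only [latPhi, gD, pow_zero, one_mul, zero_add, mul_pow, I_sq]
  linear_combination (-2 * π * I) * h

lemma latPhi_zero_two {δ ε : ℝ} {τ : ℂ} (hτ : 0 < τ.im) :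
    latPhi δ ε 2 0 τ * thetaD 0 (π / 3) τ ^ 2 =
      2 * thetaD 1 0 τ ^ 2 * latPhi δ ε 0 (π / 3) τ + thetaD 0 (π / 3) τ ^ 2 *
        (2 * (CFun τ - 3 * AFun (π / 3) τ ^ 2)) * latPhi δ ε 0 0 τ := by
  have h := (hasAdditionTheorem_theta hτ).interpolation_zero (gSum 0 δ 0 (3 * τ))
    (gSum 0 ε 0 (3 * τ)) (π / 3)
  obtain ⟨h2, -, -⟩ := torsion_relations hτ
  rw [h2, thetaD_one_third hτ] at h
  simp only [latPhi]
  linear_combination h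

lemma latPhi_third_two {δ ε : ℝ} {τ : ℂ} (hτ : 0 < τ.im) :
    latPhi δ ε 2 (π / 3) τ * thetaD 0 (π / 3) τ ^ 2 =
      thetaD 0 (π / 3) τ ^ 2 * (2 * (CFun τ - AFun (π / 3) τ ^ 2)) * latPhi δ ε 0 (π / 3) τ +
      2 * thetaD 0 (π / 3) τ * AFun (π / 3) τ * thetaD 1 0 τ * latPhi δ ε 0 0 τ := by
  have h := (hasAdditionTheorem_theta hτ).interpolation (gSum 0 δ 0 (3 * τ))
    (gSum 0 ε 0 (3 * τ)) (π / 3)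
  obtain ⟨h2, -, -⟩ := torsion_relations hτ
  rw [thetaD_two_third _ hτ, h2, thetaD_one_third hτ] at h
  simp only [latPhi]
  linear_combination h

/-- The quotient `θ'(0) / θ(π/3)`. -/
def rhoFun (τ : ℂ) : ℂ := thetaD 1 0 τ / thetaD 0 (π / 3) τ

lemma rhoFun_ne_zero {τ : ℂ} (hτ : 0 < τ.im) : rhoFun τ ≠ 0 :=
  div_ne_zero (thetaD_one_zero_ne_zero hτ) (thetaD_zero_third_ne_zero hτ)

lemma thetaD_one_zero_eq {τ : ℂ} (hτ : 0 < τ.im) :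
    thetaD 1 0 τ = rhoFun τ * thetaD 0 (π / 3) τ := by
  rw [rhoFun, div_mul_cancel₀ _ (thetaD_zero_third_ne_zero hτ)]

lemma BFun_eq_rhoFun (τ : ℂ) : BFun τ = rhoFun τ ^ 3 := by
  rw [BFun, rhoFun, div_pow]

lemma hasDerivAt_rhoFun {τ : ℂ} (hτ : 0 < τ.im) :
    HasDerivAt rhoFun (2 * π * I * (-(1 / 4) * rhoFun τ * (CFun τ + AFun (π / 3) τ ^ 2))) τ := by
  have hp := thetaD_zero_third_ne_zero hτ
  have hs := thetaD_one_zero_ne_zero hτ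
  obtain ⟨h2, -, -⟩ := torsion_relations hτ
  have h := (hasDerivAt_thetaD_snd 1 0 hτ).div (hasDerivAt_thetaD_snd 0 (π / 3) hτ) hp
  refine h.congr_deriv ?_
  have hC : thetaD 3 0 τ = 3 * CFun τ * thetaD 1 0 τ := by
    rw [CFun]; field_simp
  rw [show 1 + 2 = 3 from rfl, show 0 + 2 = 2 from rfl, h2, hC, rhoFun]
  field_simp
  ring

lemma hasDerivAt_latPhi_zero {δ ε : ℝ} {τ : ℂ} (hτ : 0 < τ.im)
    (h : latMoment δ ε 2 0 0 τ = 3 * latMoment δ ε 0 2 0 τ) :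
    HasDerivAt (latPhi δ ε 0 0) (2 * π * I * (-(rhoFun τ ^ 2 * latPhi δ ε 0 (π / 3) τ +
      (CFun τ - 3 * AFun (π / 3) τ ^ 2) * latPhi δ ε 0 0 τ) / 4)) τ := by
  refine (hasDerivAt_latPhi hτ h).congr_deriv ?_
  have hp := pow_ne_zero 2 (thetaD_zero_third_ne_zero hτ)
  have h1 := latPhi_zero_two (δ := δ) (ε := ε) hτ
  rw [thetaD_one_zero_eq hτ] at h1
  have h2 : latPhi δ ε 2 0 τ = 2 * (rhoFun τ ^ 2 * latPhi δ ε 0 (π / 3) τ +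
      (CFun τ - 3 * AFun (π / 3) τ ^ 2) * latPhi δ ε 0 0 τ) :=
    mul_right_cancel₀ hp (by linear_combination h1)
  rw [h2]
  ring

lemma hasDerivAt_latPhi_third {δ ε : ℝ} {τ : ℂ} (hτ : 0 < τ.im)
    (h : latMoment δ ε 2 0 (π / 3) τ = 3 * latMoment δ ε 0 2 (π / 3) τ) :
    HasDerivAt (latPhi δ ε 0 (π / 3)) (2 * π * I *
      (-((CFun τ - AFun (π / 3) τ ^ 2) * latPhi δ ε 0 (π / 3) τ +
        AFun (π / 3) τ * rhoFun τ * latPhi δ ε 0 0 τ) / 4)) τ := by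
  refine (hasDerivAt_latPhi hτ h).congr_deriv ?_
  have hp := pow_ne_zero 2 (thetaD_zero_third_ne_zero hτ)
  have h1 := latPhi_third_two (δ := δ) (ε := ε) hτ
  rw [thetaD_one_zero_eq hτ] at h1
  have h2 : latPhi δ ε 2 (π / 3) τ = 2 * ((CFun τ - AFun (π / 3) τ ^ 2) *
      latPhi δ ε 0 (π / 3) τ + AFun (π / 3) τ * rhoFun τ * latPhi δ ε 0 0 τ) :=
    mul_right_cancel₀ hp (by linear_combination h1)
  rw [h2]
  ring

/-! ### Periodicity in `τ` -/

lemma add_one_im_pos {τ : ℂ} (hτ : 0 < τ.im) : 0 < (τ + 1).im := by simpa using hτ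

lemma theta_add_one (z τ : ℂ) : theta z (τ + 1) = cexp (π * I / 4) * theta z τ := by
  have key : ∀ n : ℤ, (-1 : ℂ) ^ n * cexp (((n : ℂ) + 1 / 2) ^ 2 * π * I * (τ + 1) +
      (2 * (n : ℂ) + 1) * I * z) = cexp (π * I / 4) * ((-1 : ℂ) ^ n *
        cexp (((n : ℂ) + 1 / 2) ^ 2 * π * I * τ + (2 * (n : ℂ) + 1) * I * z)) := fun n => by
    have h : 2 * (triangular n : ℂ) = n * (n + 1) := by exact_mod_cast triangular_spec n
    rw [mul_left_comm (cexp _), ← Complex.exp_add, ← Complex.exp_periodic.nat_mul (triangular n)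
      (π * I / 4 + _)]
    congr 2
    linear_combination (-π * I) * h
  simp only [theta, key]
  rw [tsum_mul_left]
  ring

lemma thetaD_add_one (k : ℕ) (z τ : ℂ) :
    thetaD k z (τ + 1) = cexp (π * I / 4) * thetaD k z τ := by
  rw [thetaD, thetaD, funext fun w => theta_add_one w τ, iteratedDeriv_const_mul_field]

lemma AFun_add_one (τ : ℂ) : AFun (π / 3) (τ + 1) = AFun (π / 3) τ := by
  rw [AFun, AFun, thetaD_add_one, theta_add_one, mul_div_mul_left _ _ (Complex.exp_ne_zero _)]

lemma rhoFun_add_one (τ : ℂ) : rhoFun (τ + 1) = rhoFun τ := by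
  rw [rhoFun, rhoFun, thetaD_add_one, thetaD_add_one,
    mul_div_mul_left _ _ (Complex.exp_ne_zero _)]

lemma latChar_zero_add_one (x τ : ℂ) (p : ℤ × ℤ) : latChar 0 x (τ + 1) p = latChar 0 x τ p := by
  rw [latChar, latChar, latticeTerm, latticeTerm]
  congr 1
  rw [← Complex.exp_periodic.int_mul (p.1 ^ 2 + p.1 * p.2 + p.2 ^ 2) (2 * π * I * τ *
    (((p.1 : ℂ) + (0 : ℂ)) ^ 2 + ((p.1 : ℂ) + (0 : ℂ)) * ((p.2 : ℂ) + (0 : ℂ)) +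
      ((p.2 : ℂ) + (0 : ℂ)) ^ 2))]
  congr 1
  push_cast
  ring

lemma hasSum_latPhi_zero (x : ℂ) {τ : ℂ} (hτ : 0 < τ.im) :
    HasSum (latChar 0 x τ) (latPhi 0 (1 / 2) 0 x τ) := by
  have := hasSum_latChar_zero 0 0 x hτ
  rw [latPhi_eq_latMoment]
  simpa using this

lemma latPhi_add_one (x : ℂ) {τ : ℂ} (hτ : 0 < τ.im) :
    latPhi 0 (1 / 2) 0 x (τ + 1) = latPhi 0 (1 / 2) 0 x τ :=
  (hasSum_latPhi_zero x (add_one_im_pos hτ)).unique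
    ((hasSum_latPhi_zero x hτ).congr_fun fun p => latChar_zero_add_one x τ p)

/-! ### Identification of the lattice sums -/

lemma latPhi_wronskian {τ : ℂ} (hτ : 0 < τ.im) :
    latPhi 0 (1 / 2) 0 0 τ * rhoFun τ = 2 * (latPhi 0 (1 / 2) 0 (π / 3) τ * AFun (π / 3) τ) := by
  obtain ⟨C, hC⟩ := exists_const_of_hasDerivAt_zero
    (f := fun τ => (latPhi 0 (1 / 2) 0 0 τ * rhoFun τ -
      2 * (latPhi 0 (1 / 2) 0 (π / 3) τ * AFun (π / 3) τ)) / thetaD 0 (π / 3) τ ^ 4)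
    (fun τ hτ => by
      have hp := thetaD_zero_third_ne_zero hτ
      obtain ⟨h2, -, -⟩ := torsion_relations hτ
      have h := (((hasDerivAt_latPhi_zero hτ (latMoment_rotation_zero 0 hτ (Or.inl rfl))).mul
        (hasDerivAt_rhoFun hτ)).sub (((hasDerivAt_latPhi_third hτ
          (latMoment_rotation_zero _ hτ (Or.inr rfl))).mul (hasDerivAt_AFun hτ)).const_mul 2)).div
        ((hasDerivAt_thetaD_snd 0 (π / 3) hτ).pow 4) (pow_ne_zero 4 hp)
      refine h.congr_deriv ?_
      simp only [Pi.pow_apply, Pi.mul_apply, Pi.sub_apply]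
      rw [zero_add, h2, BFun_eq_rhoFun]
      push_cast
      field_simp
      ring)
  have hp := thetaD_zero_third_ne_zero hτ
  have h1 := hC τ hτ
  have h2 := hC (τ + 1) (add_one_im_pos hτ)
  simp only [latPhi_add_one _ hτ, rhoFun_add_one, AFun_add_one, thetaD_add_one, mul_pow,
    ← Complex.exp_nat_mul] at h2
  rw [show ((4 : ℕ) : ℂ) * (π * I / 4) = π * I by push_cast; ring, exp_pi_mul_I, neg_one_mul,
    div_neg, h1] at h2
  have h3 : C = 0 := by linear_combination -h2 / 2
  rw [h3, div_eq_zero_iff] at h1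
  exact sub_eq_zero.1 (h1.resolve_right (pow_ne_zero 4 hp))

lemma exists_latPhi_zero_const :
    ∃ C, ∀ τ : ℂ, 0 < τ.im → latPhi 0 (1 / 2) 0 0 τ = C * AFun (π / 3) τ := by
  obtain ⟨C, hC⟩ := exists_const_of_hasDerivAt_zero
    (f := fun τ => latPhi 0 (1 / 2) 0 (π / 3) τ / rhoFun τ) (fun τ hτ => by
      have hr := rhoFun_ne_zero hτ
      have hw := latPhi_wronskian hτ
      have h := (hasDerivAt_latPhi_third hτ (latMoment_rotation_zero _ hτ (Or.inr rfl))).div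
        (hasDerivAt_rhoFun hτ) hr
      refine h.congr_deriv ?_
      rw [div_eq_zero_iff]
      left
      linear_combination (-(1 / 2) * π * I * AFun (π / 3) τ * rhoFun τ) * hw)
  refine ⟨2 * C, fun τ hτ => ?_⟩
  have hr := rhoFun_ne_zero hτ
  refine mul_right_cancel₀ hr ?_
  rw [latPhi_wronskian hτ, ← hC τ hτ]
  field_simp

lemma hasSum_latPhi_third {τ : ℂ} (hτ : 0 < τ.im) :
    HasSum (latticeTerm (1 / 3) τ) (latPhi (2 / 3) (1 / 6) 0 0 τ) := by
  have := hasSum_latChar_third 0 0 0 hτ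
  rw [latPhi_eq_latMoment]
  simpa [latChar] using this

lemma exists_latPhi_third_const :
    ∃ C, ∀ τ : ℂ, 0 < τ.im → latPhi (2 / 3) (1 / 6) 0 0 τ ^ 3 = C * (BFun τ * hFun τ) := by
  obtain ⟨C, hC⟩ := exists_const_of_hasDerivAt_zero
    (f := fun τ => latPhi (2 / 3) (1 / 6) 0 0 τ ^ 3 / (BFun τ * hFun τ)) (fun τ hτ => by
      have hB := BFun_ne_zero hτ
      have hh := hFun_ne_zero hτ
      have h0 : latPhi (2 / 3) (1 / 6) 0 (π / 3) τ = 0 := by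
        rw [latPhi_eq_latMoment, latMoment_third_eq_zero hτ, mul_zero]
      have h := ((hasDerivAt_latPhi_zero hτ (latMoment_rotation_third hτ)).pow 3).div
        ((hasDerivAt_BFun hτ).mul (hasDerivAt_hFun hτ)) (mul_ne_zero hB hh)
      refine h.congr_deriv ?_
      simp only [Pi.pow_apply, Pi.mul_apply, h0]
      push_cast
      field_simp
      ring)
  refine ⟨C, fun τ hτ => ?_⟩
  rw [← hC τ hτ, div_mul_cancel₀ _ (mul_ne_zero (BFun_ne_zero hτ) (hFun_ne_zero hτ))]

end SixVertex

end

noncomputable section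

namespace SixVertex

open Complex Filter Topology
open scoped Real

/-! ### Limits at the cusp -/

lemma tendsto_tsum_exp_neg_mul {ι : Type*} {E : ι → ℝ} (hE : ∀ p, 0 ≤ E p)
    (hs : Summable fun p => Real.exp (-E p)) :
    Tendsto (fun y : ℝ => ∑' p, Real.exp (-(y * E p))) atTop
      (𝓝 (∑' p, if E p = 0 then 1 else 0)) := by
  refine tendsto_tsum_of_dominated_convergence hs (fun p => ?_) ?_
  · split_ifs with h
    · simp [h]
    · exact Real.tendsto_exp_neg_atTop_nhds_zero.comp
        (tendsto_id.atTop_mul_const ((hE p).lt_of_ne' h))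
  · filter_upwards [eventually_ge_atTop 1] with y hy p
    rw [Real.norm_eq_abs, Real.abs_exp, Real.exp_le_exp, neg_le_neg_iff]
    exact le_mul_of_one_le_left (hE p) hy

/-- The quadratic form `m² + mn + n² + e (m + n)`. -/
def shiftedForm (e : ℤ) (p : ℤ × ℤ) : ℤ := p.1 ^ 2 + p.1 * p.2 + p.2 ^ 2 + e * (p.1 + p.2)

lemma latticeTerm_I_mul (e : ℤ) (y : ℝ) (p : ℤ × ℤ) : latticeTerm (e / 3) (I * y) p =
    (Real.exp (-(2 * π * y * (e ^ 2 / 3))) * Real.exp (-(y * (2 * π * shiftedForm e p))) : ℝ) := by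
  rw [← Real.exp_add, latticeTerm, shiftedForm, Complex.ofReal_exp]
  congr 1
  push_cast
  linear_combination (2 * π * y * (((p.1 : ℂ) + e / 3) ^ 2 +
    ((p.1 : ℂ) + e / 3) * ((p.2 : ℂ) + e / 3) + ((p.2 : ℂ) + e / 3) ^ 2)) * I_mul_I

lemma I_mul_im_pos {y : ℝ} (hy : 0 < y) : 0 < (I * y).im := by simpa using hy

lemma tendsto_lattice {e : ℤ} (he : ∀ p, 0 ≤ shiftedForm e p) {L : ℂ → ℂ}
    (hL : ∀ τ : ℂ, 0 < τ.im → HasSum (latticeTerm (e / 3) τ) (L τ)) :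
    Tendsto (fun y : ℝ => (Real.exp (2 * π * y * (e ^ 2 / 3)) : ℂ) * L (I * y)) atTop
      (𝓝 ((∑' p, if shiftedForm e p = 0 then 1 else 0 : ℝ) : ℂ)) := by
  have hE : ∀ p, (0 : ℝ) ≤ 2 * π * shiftedForm e p := fun p => by
    have : (0 : ℝ) ≤ shiftedForm e p := by exact_mod_cast he p
    positivity
  have key : ∀ y : ℝ, 0 < y → HasSum (fun p => ((Real.exp (-(y * (2 * π * shiftedForm e p))) : ℝ) : ℂ))
      ((Real.exp (2 * π * y * (e ^ 2 / 3)) : ℂ) * L (I * y)) := fun y hy => by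
    refine ((hL _ (I_mul_im_pos hy)).mul_left (Real.exp (2 * π * y * (e ^ 2 / 3)) : ℂ)).congr_fun
      fun p => ?_
    rw [latticeTerm_I_mul, ← Complex.ofReal_mul, ← mul_assoc (Real.exp _), ← Real.exp_add,
      add_neg_cancel, Real.exp_zero, one_mul]
  have hs : Summable fun p => Real.exp (-(2 * π * shiftedForm e p)) := by
    simpa using Complex.summable_ofReal.1 (key 1 one_pos).summable
  have h := tendsto_tsum_exp_neg_mul hE hs
  have h1 : ∀ p, (2 * π * (shiftedForm e p : ℝ) = 0) = (shiftedForm e p = 0) := fun p => by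
    simp [Real.pi_ne_zero]
  simp only [h1] at h
  refine ((Complex.continuous_ofReal.tendsto _).comp h).congr' ?_
  filter_upwards [eventually_gt_atTop 0] with y hy
  rw [← (key y hy).tsum_eq, Function.comp_apply, Complex.ofReal_tsum]

lemma shiftedForm_zero_eq (p : ℤ × ℤ) :
    2 * shiftedForm 0 p = (p.1 + p.2) ^ 2 + p.1 ^ 2 + p.2 ^ 2 := by
  rw [shiftedForm]
  ring

lemma shiftedForm_one_eq (p : ℤ × ℤ) :
    2 * shiftedForm 1 p = (p.1 + p.2 + 1) ^ 2 + p.1 ^ 2 + p.2 ^ 2 - 1 := by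
  rw [shiftedForm]
  ring

lemma shiftedForm_zero_nonneg (p : ℤ × ℤ) : 0 ≤ shiftedForm 0 p := by
  nlinarith [shiftedForm_zero_eq p]

lemma shiftedForm_one_nonneg (p : ℤ × ℤ) : 0 ≤ shiftedForm 1 p := by
  have h := shiftedForm_one_eq p
  rcases eq_or_ne p.1 0 with h1 | h1
  · rcases eq_or_ne p.2 0 with h2 | h2
    · rw [h1, h2] at h
      omega
    · have := Int.one_le_abs h2
      nlinarith [sq_abs p.2]
  · have := Int.one_le_abs h1
    nlinarith [sq_abs p.1]

lemma tsum_shiftedForm_zero : (∑' p, if shiftedForm 0 p = 0 then 1 else 0 : ℝ) = 1 := by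
  rw [tsum_eq_single (0, 0)]
  · simp [shiftedForm]
  · rintro ⟨m, n⟩ hp
    rw [if_neg]
    intro h
    have h1 := shiftedForm_zero_eq (m, n)
    rw [h] at h1
    refine hp (Prod.ext ?_ ?_) <;> dsimp at h1 ⊢ <;> nlinarith

lemma tsum_shiftedForm_one : (∑' p, if shiftedForm 1 p = 0 then 1 else 0 : ℝ) = 3 := by
  rw [tsum_eq_sum (s := {(0, 0), (-1, 0), (0, -1)})]
  · rw [Finset.sum_insert (by decide), Finset.sum_insert (by decide), Finset.sum_singleton]
    norm_num [shiftedForm]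
  · rintro ⟨m, n⟩ hp
    rw [if_neg]
    intro h
    have h1 := shiftedForm_one_eq (m, n)
    rw [h] at h1
    dsimp at h1
    have hm : m ≤ 1 := by nlinarith
    have hm' : -1 ≤ m := by nlinarith
    have hn : n ≤ 1 := by nlinarith
    have hn' : -1 ≤ n := by nlinarith
    interval_cases m <;> interval_cases n <;>
      first | (norm_num at h1; done) | simp at hp

lemma nome_I_mul (y : ℝ) : nome (I * y) = Real.exp (-(2 * π * y)) := by
  rw [nome, Complex.ofReal_exp]
  congr 1
  push_cast
  linear_combination (2 * π * y) * I_mul_I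

lemma tendsto_nome_I_mul : Tendsto (fun y : ℝ => nome (I * y)) atTop (𝓝[≠] 0) := by
  refine tendsto_nhdsWithin_iff.2 ⟨?_, Eventually.of_forall fun y => nome_ne_zero _⟩
  have : Tendsto (fun y : ℝ => Real.exp (-(2 * π * y))) atTop (𝓝 0) :=
    Real.tendsto_exp_neg_atTop_nhds_zero.comp (tendsto_id.const_mul_atTop (by positivity))
  have h := (Complex.continuous_ofReal.tendsto _).comp this
  rw [Complex.ofReal_zero] at h
  exact h.congr fun y => (nome_I_mul y).symm

lemma tendsto_sqrt_three_mul_AFun :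
    Tendsto (fun y : ℝ => (√3 : ℝ) * AFun (π / 3) (I * y)) atTop (𝓝 1) := by
  have h := analyticAt_aSer.continuousAt.tendsto.comp
    (tendsto_nome_I_mul.mono_right nhdsWithin_le_nhds)
  rw [aSer_zero] at h
  refine h.congr' ?_
  filter_upwards [eventually_gt_atTop 0] with y hy using aSer_nome (I_mul_im_pos hy)

lemma tendsto_hFun : Tendsto (fun y : ℝ => hFun (I * y)) atTop (𝓝 0) := by
  have h := analyticAt_hSer.continuousAt.tendsto.comp
    (tendsto_nome_I_mul.mono_right nhdsWithin_le_nhds)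
  rw [hSer_zero] at h
  exact h.congr fun y => hSer_nome

lemma tendsto_hFun_div_nome :
    Tendsto (fun y : ℝ => hFun (I * y) * Real.exp (2 * π * y)) atTop (𝓝 1) := by
  have h := (hasDerivAt_iff_tendsto_slope.1 hasDerivAt_hSer_zero).comp tendsto_nome_I_mul
  refine h.congr fun y => ?_
  rw [Function.comp_apply, slope_def_field, hSer_zero, sub_zero, sub_zero, hSer_nome, nome_I_mul,
    Real.exp_neg, Complex.ofReal_inv, div_inv_eq_mul]

/-! ### The two lattice sums -/

lemma hasSum_lattice_zero {τ : ℂ} (hτ : 0 < τ.im) :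
    HasSum (latticeTerm 0 τ) ((√3 : ℝ) * AFun (π / 3) τ) := by
  have h0 : ∀ τ : ℂ, 0 < τ.im → HasSum (latticeTerm ((0 : ℤ) / 3) τ) (latPhi 0 (1 / 2) 0 0 τ) :=
    fun τ hτ => (hasSum_latPhi_zero 0 hτ).congr_fun fun p => by simp [latChar]
  obtain ⟨C, hC⟩ := exists_latPhi_zero_const
  have h1 := tendsto_lattice shiftedForm_zero_nonneg h0
  rw [tsum_shiftedForm_zero] at h1
  have h2 := tendsto_sqrt_three_mul_AFun.const_mul C
  have h3 : C = (√3 : ℝ) := by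
    have h4 := tendsto_nhds_unique (h2.congr' ?_) (h1.const_mul ((√3 : ℝ) : ℂ))
    · simpa using h4
    · filter_upwards [eventually_gt_atTop 0] with y hy
      rw [hC _ (I_mul_im_pos hy)]
      norm_num
      ring
  have h4 := h0 τ hτ
  rw [hC τ hτ, h3] at h4
  simpa using h4

lemma latPhi_third_pow_three {τ : ℂ} (hτ : 0 < τ.im) :
    8 * latPhi (2 / 3) (1 / 6) 0 0 τ ^ 3 = 81 * (√3 : ℝ) * (BFun τ * hFun τ) := by
  have h0 : ∀ τ : ℂ, 0 < τ.im →
      HasSum (latticeTerm ((1 : ℤ) / 3) τ) (latPhi (2 / 3) (1 / 6) 0 0 τ) :=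
    fun τ hτ => by simpa using hasSum_latPhi_third hτ
  obtain ⟨C, hC⟩ := exists_latPhi_third_const
  have h1 := (tendsto_lattice shiftedForm_one_nonneg h0).pow 3
  rw [tsum_shiftedForm_one] at h1
  have h2 := (((tendsto_hFun.const_mul 27).const_add 1).const_mul (3 * ((√3 : ℝ) : ℂ))).mul h1
  have h3 := ((tendsto_sqrt_three_mul_AFun.pow 3).mul tendsto_hFun_div_nome).const_mul (8 * C)
  have h4 : 8 * C = 81 * (√3 : ℝ) := by
    have h4 := tendsto_nhds_unique (h3.congr' ?_) h2
    · rw [one_pow, mul_one, mul_one, mul_zero, add_zero] at h4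
      rw [h4]
      push_cast
      ring
    · filter_upwards [eventually_gt_atTop 0] with y hy
      have e1 := hC _ (I_mul_im_pos hy)
      have e2 := hauptmodul (I_mul_im_pos hy)
      have e3 : (Real.exp (2 * π * y * ((1 : ℤ) ^ 2 / 3)) : ℂ) ^ 3 = Real.exp (2 * π * y) := by
        rw [← Complex.ofReal_pow, ← Real.exp_nat_mul]
        congr 2
        push_cast
        ring
      simp only [mul_pow]
      rw [e3, e1]
      linear_combination (3 * (√3 : ℝ) * C * hFun (I * y) * Real.exp (2 * π * y)) * e2 +
        (8 * C * (√3 : ℝ) * AFun (π / 3) (I * y) ^ 3 * hFun (I * y) * Real.exp (2 * π * y)) *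
          sqrt_three_sq
  linear_combination 8 * hC τ hτ + (BFun τ * hFun τ) * h4

end SixVertex

end

noncomputable section

namespace SixVertex

open Complex Filter Topology
open scoped Real

/-! ### `R` and `S` as modular functions -/

lemma AFun_ne_zero {τ : ℂ} (hτ : 0 < τ.im) (h : thetaD 1 (π / 3) τ ≠ 0) : AFun (π / 3) τ ≠ 0 :=
  div_ne_zero h (theta_third_ne_zero hτ)

lemma RFun_eq_latticeSum {τ : ℂ} (hτ : 0 < τ.im) (hA : AFun (π / 3) τ ≠ 0) :
    RFun (π / 3) τ = 1 / 27 * (latticeSum (1 / 3) τ / latticeSum 0 τ) ^ 3 := by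
  have hs := sqrt_three_ne_zero
  have hh := one_add_hFun_ne_zero hτ hA
  rw [latticeSum, latticeSum, (hasSum_latPhi_third hτ).tsum_eq, (hasSum_lattice_zero hτ).tsum_eq,
    RFun_eq_hFun hτ hA, div_pow, mul_pow, div_eq_iff hh]
  field_simp
  linear_combination (27 * (√3 : ℝ) * hFun τ * AFun (π / 3) τ ^ 3) * sqrt_three_sq -
    (1 + 27 * hFun τ) / 8 * latPhi_third_pow_three hτ +
    (81 / 8 * (√3 : ℝ) * hFun τ) * hauptmodul hτ

lemma D_RFun {τ : ℂ} (hτ : 0 < τ.im) (hA : AFun (π / 3) τ ≠ 0) : D (RFun (π / 3)) τ =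
    3 * AFun (π / 3) τ ^ 2 * (RFun (π / 3) τ * (1 - 27 * RFun (π / 3) τ)) := by
  rw [D, (hasDerivAt_RFun hτ hA).deriv, mul_div_cancel_left₀ _ Complex.two_pi_I_ne_zero]

lemma RFun_mul_eq {τ : ℂ} (hτ : 0 < τ.im) (hA : AFun (π / 3) τ ≠ 0) :
    RFun (π / 3) τ * (1 - 27 * RFun (π / 3) τ) = hFun τ / (1 + 27 * hFun τ) ^ 2 := by
  have hh := one_add_hFun_ne_zero hτ hA
  have h1 : 1 - 27 * (hFun τ / (1 + 27 * hFun τ)) = 1 / (1 + 27 * hFun τ) := by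
    rw [eq_div_iff hh, sub_mul, one_mul, mul_assoc, div_mul_cancel₀ _ hh]
    ring
  rw [RFun_eq_hFun hτ hA, h1, div_mul_div_comm, mul_one, ← sq]

lemma RFun_mul_ne_zero {τ : ℂ} (hτ : 0 < τ.im) (hA : AFun (π / 3) τ ≠ 0) :
    RFun (π / 3) τ * (1 - 27 * RFun (π / 3) τ) ≠ 0 := by
  rw [RFun_mul_eq hτ hA]
  exact div_ne_zero (hFun_ne_zero hτ) (pow_ne_zero 2 (one_add_hFun_ne_zero hτ hA))

lemma SFun_div_six {τ : ℂ} (hτ : 0 < τ.im) (hA : AFun (π / 3) τ ≠ 0) : SFun (π / 3) τ / 6 =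
    1 / (RFun (π / 3) τ * (1 - 27 * RFun (π / 3) τ)) := by
  have h1 : Complex.sin (π / 3) ^ 4 = 9 / 16 := by
    rw [sin_pi_div_three']
    linear_combination (((√3 : ℝ) : ℂ) ^ 2 + 3) / 16 * sqrt_three_sq
  have h2 := RFun_mul_ne_zero hτ hA
  rw [SFun, D_RFun hτ hA, h1, cos_pi_div_three']
  generalize RFun (π / 3) τ * (1 - 27 * RFun (π / 3) τ) = X at h2
  field_simp
  norm_num

end SixVertex

end

noncomputable section

namespace SixVertex

open PowerSeries

/-! ### Taylor series at `0` -/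

/-- The Taylor series at `0`. -/
def taylorSeries (f : ℂ → ℂ) : PowerSeries ℂ :=
  PowerSeries.mk fun n => iteratedDeriv n f 0 / n.factorial

lemma coeff_taylorSeries (f : ℂ → ℂ) (n : ℕ) :
    coeff n (taylorSeries f) = iteratedDeriv n f 0 / n.factorial := by
  rw [taylorSeries, coeff_mk]

lemma constantCoeff_taylorSeries (f : ℂ → ℂ) : constantCoeff (taylorSeries f) = f 0 := by
  rw [← coeff_zero_eq_constantCoeff_apply, coeff_taylorSeries]
  simp

lemma coeff_one_taylorSeries (f : ℂ → ℂ) : coeff 1 (taylorSeries f) = deriv f 0 := by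
  rw [coeff_taylorSeries]
  simp

lemma taylorSeries_congr {f g : ℂ → ℂ} (h : ∀ᶠ q in nhds (0 : ℂ), f q = g q) :
    taylorSeries f = taylorSeries g := by
  ext n
  rw [coeff_taylorSeries, coeff_taylorSeries, Filter.EventuallyEq.iteratedDeriv_eq n h]

lemma taylorSeries_deriv (f : ℂ → ℂ) :
    taylorSeries (deriv f) = PowerSeries.derivative ℂ (taylorSeries f) := by
  ext n
  have h : (n.factorial : ℂ) ≠ 0 := by exact_mod_cast n.factorial_ne_zero
  have h' : (n + 1 : ℂ) ≠ 0 := by exact_mod_cast n.succ_ne_zero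
  rw [coeff_derivative, coeff_taylorSeries, coeff_taylorSeries, ← iteratedDeriv_succ',
    Nat.factorial_succ]
  push_cast
  field_simp

lemma taylorSeries_mul {f g : ℂ → ℂ} (hf : AnalyticAt ℂ f 0) (hg : AnalyticAt ℂ g 0) :
    taylorSeries (fun q => f q * g q) = taylorSeries f * taylorSeries g := by
  ext n
  rw [coeff_mul, Finset.Nat.sum_antidiagonal_eq_sum_range_succ_mk, coeff_taylorSeries,
    iteratedDeriv_fun_mul hf.contDiffAt hg.contDiffAt, Finset.sum_div]
  refine Finset.sum_congr rfl fun k hk => ?_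
  have hk' : k ≤ n := Nat.lt_succ_iff.1 (Finset.mem_range.1 hk)
  have h (m : ℕ) : (m.factorial : ℂ) ≠ 0 := by exact_mod_cast m.factorial_ne_zero
  rw [coeff_taylorSeries, coeff_taylorSeries, Nat.cast_choose ℂ hk']
  have := h n
  have := h k
  have := h (n - k)
  field_simp

lemma taylorSeries_const_mul (f : ℂ → ℂ) (c : ℂ) :
    taylorSeries (fun q => c * f q) = c • taylorSeries f := by
  ext n
  rw [coeff_smul, coeff_taylorSeries, coeff_taylorSeries, iteratedDeriv_const_mul_field,
    smul_eq_mul, mul_div_assoc]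

lemma taylorSeries_one_sub {f : ℂ → ℂ} (hf : AnalyticAt ℂ f 0) :
    taylorSeries (fun q => 1 - f q) = 1 - taylorSeries f := by
  ext n
  rw [map_sub, coeff_taylorSeries, coeff_taylorSeries, coeff_one,
    iteratedDeriv_fun_sub contDiffAt_const hf.contDiffAt, iteratedDeriv_const]
  split_ifs with h
  · simp [h]
  · simp [neg_div]

lemma taylorSeries_id : taylorSeries (fun q => q) = X := by
  ext n
  rw [coeff_taylorSeries, coeff_X]
  rcases n with _ | _ | n
  · simp
  · simp
  · simp [iteratedDeriv_succ']

lemma exists_forall_norm_nome_lt {ε : ℝ} (hε : 0 < ε) :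
    ∃ Y : ℝ, ∀ τ : ℂ, Y < τ.im → ‖nome τ‖ < ε := by
  have h : Filter.Tendsto (fun y : ℝ => Real.exp (-(2 * Real.pi * y))) Filter.atTop (nhds 0) :=
    Real.tendsto_exp_neg_atTop_nhds_zero.comp
      (Filter.tendsto_id.const_mul_atTop (by positivity))
  obtain ⟨Y, hY⟩ := Filter.eventually_atTop.1 (h.eventually_lt_const hε)
  refine ⟨Y, fun τ hτ => ?_⟩
  rw [nome, Complex.norm_exp]
  refine lt_of_eq_of_lt ?_ (hY τ.im hτ.le)
  congr 1
  simp

lemma isQExpansion_taylorSeries {f g : ℂ → ℂ} (hf : AnalyticAt ℂ f 0) (Y : ℝ)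
    (h : ∀ τ : ℂ, Y < τ.im → f (nome τ) = g τ) : IsQExpansion (taylorSeries f) g := by
  obtain ⟨ε, hε, hball⟩ := Metric.eventually_nhds_iff.1 hf.hasFPowerSeriesAt.eventually_hasSum
  obtain ⟨Y', hY'⟩ := exists_forall_norm_nome_lt hε
  refine ⟨max Y Y', fun τ hτ => ?_⟩
  rw [← h τ ((le_max_left _ _).trans_lt hτ)]
  have h4 := hball (y := nome τ) (by simpa using hY' τ ((le_max_right _ _).trans_lt hτ))
  rw [zero_add] at h4
  refine h4.congr_fun fun n => ?_
  rw [coeff_taylorSeries, FormalMultilinearSeries.ofScalars_apply_eq, smul_eq_mul]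

/-! ### The hypergeometric series -/

lemma ascPochhammer_eval_two {K : Type*} [Field K] (n : ℕ) :
    Polynomial.eval (2 : K) (ascPochhammer K n) = (n + 1).factorial := by
  have := factorial_mul_ascPochhammer K 1 n
  rwa [Nat.factorial_one, Nat.cast_one, one_mul, one_add_one_eq_two, add_comm 1 n] at this

lemma hypCoeff_one_succ {K : Type*} [Field K] [CharZero K] (n : ℕ) :
    ((n : K) + 1) * ordinaryHypergeometricCoefficient (1 / 3 : K) (2 / 3) 1 (n + 1) =
      n * ordinaryHypergeometricCoefficient (1 / 3 : K) (2 / 3) 1 n +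
        2 / 9 * ordinaryHypergeometricCoefficient (1 / 3 : K) (2 / 3) 2 n := by
  have h : (n.factorial : K) ≠ 0 := by exact_mod_cast n.factorial_ne_zero
  have h' : (n : K) + 1 ≠ 0 := by exact_mod_cast n.succ_ne_zero
  have h'' : 1 + (n : K) ≠ 0 := by rwa [add_comm]
  simp only [ordinaryHypergeometricCoefficient, ascPochhammer_eval_one, ascPochhammer_eval_two,
    ascPochhammer_succ_eval, Nat.factorial_succ]
  push_cast
  field_simp
  ring

lemma hypCoeff_two {K : Type*} [Field K] [CharZero K] (n : ℕ) :
    ((n : K) + 1) * ordinaryHypergeometricCoefficient (1 / 3 : K) (2 / 3) 2 n =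
      ordinaryHypergeometricCoefficient (1 / 3 : K) (2 / 3) 1 n := by
  have h : (n.factorial : K) ≠ 0 := by exact_mod_cast n.factorial_ne_zero
  have h' : (n : K) + 1 ≠ 0 := by exact_mod_cast n.succ_ne_zero
  simp only [ordinaryHypergeometricCoefficient, ascPochhammer_eval_one, ascPochhammer_eval_two,
    Nat.factorial_succ]
  push_cast
  field_simp

lemma hypCoeff_one_mul (n : ℕ) :
    27 ^ n * ordinaryHypergeometricCoefficient (1 / 3 : ℂ) (2 / 3) 1 n * (n.factorial : ℂ) ^ 3 =
      (3 * n).factorial := by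
  induction n with
  | zero => simp [ordinaryHypergeometricCoefficient]
  | succ n ih =>
    have h'' : 1 + (n : ℂ) ≠ 0 := by exact_mod_cast (Nat.one_add n ▸ n.succ_ne_zero)
    have h : (n.factorial : ℂ) ≠ 0 := by exact_mod_cast n.factorial_ne_zero
    have h' : (n : ℂ) + 1 ≠ 0 := by exact_mod_cast n.succ_ne_zero
    rw [show 3 * (n + 1) = 3 * n + 1 + 1 + 1 by ring, Nat.factorial_succ (3 * n + 1 + 1),
      Nat.factorial_succ (3 * n + 1), Nat.factorial_succ (3 * n), Nat.cast_mul, Nat.cast_mul, Nat.cast_mul, ← ih]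
    simp only [ordinaryHypergeometricCoefficient, ascPochhammer_eval_one,
      ascPochhammer_succ_eval, Nat.factorial_succ]
    push_cast
    field_simp
    ring

lemma choose_mul_choose_mul (n : ℕ) :
    (2 * n).choose n * (3 * n).choose n * n.factorial ^ 3 = (3 * n).factorial := by
  have h1 := Nat.choose_mul_factorial_mul_factorial (n := 2 * n) (k := n) (by omega)
  have h2 := Nat.choose_mul_factorial_mul_factorial (n := 3 * n) (k := n) (by omega)
  rw [show 2 * n - n = n by omega] at h1
  rw [show 3 * n - n = 2 * n by omega, ← h1] at h2
  rw [← h2]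
  ring

lemma ofNat_smul_eq (P : PowerSeries ℂ) : (27 : ℂ) • P = 27 * P := by
  rw [Algebra.smul_def, map_ofNat]

lemma constantCoeff_smul_eq_zero {R : PowerSeries ℂ} (hR : constantCoeff R = 0) :
    constantCoeff ((27 : ℂ) • R) = 0 := by
  rw [ofNat_smul_eq, map_mul, hR, mul_zero]

lemma hasSubst_smul {R : PowerSeries ℂ} (hR : constantCoeff R = 0) : HasSubst ((27 : ℂ) • R) :=
  HasSubst.of_constantCoeff_zero' (constantCoeff_smul_eq_zero hR)

lemma binomialSeries_eq :
    binomialSeries = X * subst ((27 : ℂ) • (X : PowerSeries ℂ)) (hypSeries (1 / 3) (2 / 3) 2) := by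
  rw [binomialSeries, ← rescale_eq_subst]
  congr 1
  ext n
  have h : (n.factorial : ℂ) ≠ 0 := by exact_mod_cast n.factorial_ne_zero
  have h' : (n : ℂ) + 1 ≠ 0 := by exact_mod_cast n.succ_ne_zero
  have h1 : ((2 * n).choose n : ℂ) * ((3 * n).choose n : ℂ) * (n.factorial : ℂ) ^ 3 =
      (3 * n).factorial := by exact_mod_cast choose_mul_choose_mul n
  rw [← hypCoeff_one_mul, ← hypCoeff_two] at h1
  have h2 := mul_right_cancel₀ (pow_ne_zero 3 h) h1
  rw [coeff_rescale, coeff_mk, hypSeries, coeff_mk, mul_assoc, h2]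
  field_simp

lemma derivative_hypSeries_one :
    (1 - X) * PowerSeries.derivative ℂ (hypSeries (1 / 3) (2 / 3) 1) =
      (2 / 9 : ℂ) • hypSeries (1 / 3) (2 / 3) 2 := by
  ext n
  have h := hypCoeff_one_succ (K := ℂ) n
  rw [sub_mul, one_mul, map_sub, coeff_smul, smul_eq_mul, coeff_derivative, hypSeries, hypSeries,
    coeff_mk, coeff_mk]
  rcases n with _ | n
  · rw [coeff_zero_X_mul]
    simpa using h
  · rw [coeff_succ_X_mul, coeff_derivative, coeff_mk]
    push_cast at h ⊢
    linear_combination h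

lemma derivative_X_mul_hypSeries_two :
    hypSeries (1 / 3) (2 / 3) 2 + X * PowerSeries.derivative ℂ (hypSeries (1 / 3) (2 / 3) 2) =
      hypSeries (1 / 3) (2 / 3) 1 := by
  ext n
  have h := hypCoeff_two (K := ℂ) n
  rw [map_add, hypSeries, hypSeries, coeff_mk, coeff_mk, ← h]
  rcases n with _ | n
  · rw [coeff_zero_X_mul]
    simp
  · rw [coeff_succ_X_mul, coeff_derivative, coeff_mk]
    push_cast
    ring

lemma constantCoeff_hypSeries (a b c : ℂ) : constantCoeff (hypSeries a b c) = 1 := by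
  rw [← coeff_zero_eq_constantCoeff_apply, hypSeries, coeff_mk]
  simp [ordinaryHypergeometricCoefficient]

lemma constantCoeff_subst_hypSeries {R : PowerSeries ℂ} (hR : constantCoeff R = 0) (a b c : ℂ) :
    constantCoeff (subst ((27 : ℂ) • R) (hypSeries a b c)) = 1 := by
  have hs := hasSubst_smul hR
  have h1 : hypSeries a b c = C 1 + (hypSeries a b c - C 1) := by ring
  have h2 : constantCoeff (hypSeries a b c - C 1) = 0 := by
    rw [map_sub, constantCoeff_hypSeries, constantCoeff_C, sub_self]
  rw [h1, subst_add hs, map_add, subst_C]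
  have h3 := constantCoeff_subst_eq_zero (constantCoeff_smul_eq_zero hR) _ h2
  erw [h3]
  exact add_zero _

section Substitution

variable {R : PowerSeries ℂ}

/-- The derivative of `₂F₁(1/3, 2/3; 1; 27 R)`. -/
lemma derivative_subst_hypSeries_one (hR : constantCoeff R = 0) :
    (1 - 27 * R) * PowerSeries.derivative ℂ (subst ((27 : ℂ) • R) (hypSeries (1 / 3) (2 / 3) 1)) =
      6 * subst ((27 : ℂ) • R) (hypSeries (1 / 3) (2 / 3) 2) * PowerSeries.derivative ℂ R := by
  have hs := hasSubst_smul hR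
  have h := congrArg (subst ((27 : ℂ) • R)) derivative_hypSeries_one
  rw [subst_mul hs, subst_sub hs, subst_X hs, subst_smul hs, ← coe_substAlgHom hs, map_one,
    coe_substAlgHom hs] at h
  rw [derivative_subst hs, Derivation.map_smul]
  generalize subst ((27 : ℂ) • R) (hypSeries (1 / 3) (2 / 3) 2) = Y at h ⊢
  have h1 : 27 * ((2 / 9 : ℂ) • Y) = 6 * Y := by
    rw [← ofNat_smul_eq, smul_smul, show (27 : ℂ) * (2 / 9) = 6 by norm_num, Algebra.smul_def,
      map_ofNat]
  generalize subst ((27 : ℂ) • R)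
    (PowerSeries.derivative ℂ (hypSeries (1 / 3) (2 / 3) 1)) = Z at h ⊢
  rw [ofNat_smul_eq] at h ⊢
  linear_combination 27 * PowerSeries.derivative ℂ R * h + PowerSeries.derivative ℂ R * h1

/-- The derivative of `R · ₂F₁(1/3, 2/3; 2; 27 R)`. -/
lemma derivative_mul_subst_hypSeries_two (hR : constantCoeff R = 0) :
    PowerSeries.derivative ℂ (R * subst ((27 : ℂ) • R) (hypSeries (1 / 3) (2 / 3) 2)) =
      subst ((27 : ℂ) • R) (hypSeries (1 / 3) (2 / 3) 1) * PowerSeries.derivative ℂ R := by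
  have hs := hasSubst_smul hR
  have h := congrArg (subst ((27 : ℂ) • R)) derivative_X_mul_hypSeries_two
  rw [subst_add hs, subst_mul hs, subst_X hs] at h
  rw [← h, Derivation.leibniz, derivative_subst hs, smul_eq_mul, smul_eq_mul, Derivation.map_smul,
    smul_mul_assoc, mul_smul_comm]
  generalize subst ((27 : ℂ) • R)
    (PowerSeries.derivative ℂ (hypSeries (1 / 3) (2 / 3) 2)) = Z
  generalize subst ((27 : ℂ) • R) (hypSeries (1 / 3) (2 / 3) 2) = Y
  rw [ofNat_smul_eq, ofNat_smul_eq]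
  ring

/-- The system of differential equations satisfied by `R`, `t` and `√3 A` determines `t` and
`√3 A` in terms of `R`. -/
lemma eq_subst_hypSeries {T a : PowerSeries ℂ} (hR0 : constantCoeff R = 0)
    (hT0 : constantCoeff T = 0) (ha0 : constantCoeff a = 1)
    (hR : X * PowerSeries.derivative ℂ R = a ^ 2 * (R * (1 - 27 * R)))
    (hT : X * PowerSeries.derivative ℂ T = a * (a ^ 2 * (R * (1 - 27 * R))))
    (ha : X * PowerSeries.derivative ℂ a = 6 * a ^ 2 * T) :
    T = R * subst ((27 : ℂ) • R) (hypSeries (1 / 3) (2 / 3) 2) ∧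
      a = subst ((27 : ℂ) • R) (hypSeries (1 / 3) (2 / 3) 1) := by
  have hG := derivative_subst_hypSeries_one hR0
  have hH := derivative_mul_subst_hypSeries_two hR0
  have hG0 := constantCoeff_subst_hypSeries hR0 (1 / 3) (2 / 3) 1
  generalize subst ((27 : ℂ) • R) (hypSeries (1 / 3) (2 / 3) 1) = G at *
  generalize subst ((27 : ℂ) • R) (hypSeries (1 / 3) (2 / 3) 2) = Y at *
  have ha1 : a ≠ 0 := by
    rintro rfl
    simp at ha0
  have h1 : 1 - 27 * R ≠ 0 := fun h => by
    have := congrArg constantCoeff h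
    simp [hR0] at this
  have hG' : X * PowerSeries.derivative ℂ G = 6 * a ^ 2 * (R * Y) :=
    mul_left_cancel₀ h1 (by linear_combination X * hG + 6 * Y * hR)
  have hH' : X * PowerSeries.derivative ℂ (R * Y) = a ^ 2 * (R * (1 - 27 * R)) * G := by
    linear_combination X * hH + G * hR
  have hV : a * (R * Y) - G * T = 0 := by
    refine derivative.ext (mul_left_cancel₀ X_ne_zero ?_) ?_
    · rw [map_sub, Derivation.leibniz _ a, Derivation.leibniz _ G, map_zero]
      simp only [smul_eq_mul]
      linear_combination a * hH' + R * Y * ha - G * hT - T * hG'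
    · simp [hR0, hT0]
  have ha1' : a * a⁻¹ = 1 := PowerSeries.mul_inv_cancel a (by rw [ha0]; exact one_ne_zero)
  have hGa : G * a⁻¹ = 1 := by
    refine derivative.ext (mul_left_cancel₀ X_ne_zero ?_) ?_
    · rw [Derivation.leibniz, derivative_inv', Derivation.map_one_eq_zero]
      simp only [smul_eq_mul]
      linear_combination a⁻¹ * hG' - a⁻¹ ^ 2 * G * ha + 6 * a * a⁻¹ * hV -
        6 * G * T * a * a⁻¹ * ha1'
    · rw [map_mul, hG0, one_mul, map_one, constantCoeff_inv, ha0, inv_one]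
  have hGa' : a = G := by linear_combination G * ha1' - a * hGa
  refine ⟨mul_left_cancel₀ ha1 ?_, hGa'⟩
  linear_combination -hV + T * hGa'

end Substitution

/-! ### Compositional inverses -/

lemma exists_rightInverse {P : PowerSeries ℂ} (h0 : constantCoeff P = 0) (h1 : coeff 1 P = 1) :
    ∃ s, IsRightInverse P s ∧ ∀ s', IsRightInverse P s' → s' = s := by
  have hu : IsUnit (coeff 1 P) := by rw [h1]; exact isUnit_one
  refine ⟨P.substInvOfIsUnit hu, ⟨constantCoeff_substInvOfIsUnit P hu,
    subst_substInvOfIsUnit_right P h0 hu⟩, fun s' hs' => ?_⟩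
  have hs := HasSubst.of_constantCoeff_zero' hs'.1
  have h2 := subst_comp_subst_apply (HasSubst.of_constantCoeff_zero' h0) hs
    (P.substInvOfIsUnit hu)
  rw [subst_substInvOfIsUnit_left P h0 hu, subst_X hs, hs'.2, ← map_algebraMap_eq_subst_X] at h2
  simpa using h2

lemma subst_mul_subst_hypSeries {P s : PowerSeries ℂ} (hP : constantCoeff P = 0)
    (hs : constantCoeff s = 0) (a b c : ℂ) :
    subst s (P * subst ((27 : ℂ) • P) (hypSeries a b c)) =
      subst s P * subst ((27 : ℂ) • subst s P) (hypSeries a b c) := by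
  have hs' := HasSubst.of_constantCoeff_zero' hs
  rw [subst_mul hs', subst_comp_subst_apply (hasSubst_smul hP) hs', subst_smul hs']

/-- The differential equation for `t` as a function of `R`. -/
lemma hypSeries_two_ode :
    X * (1 - 27 * X) * PowerSeries.derivative ℂ (PowerSeries.derivative ℂ
      (X * subst ((27 : ℂ) • (X : PowerSeries ℂ)) (hypSeries (1 / 3) (2 / 3) 2))) =
      6 * (X * subst ((27 : ℂ) • (X : PowerSeries ℂ)) (hypSeries (1 / 3) (2 / 3) 2)) := by
  have hG := derivative_subst_hypSeries_one (R := X) constantCoeff_X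
  have hH := derivative_mul_subst_hypSeries_two (R := X) constantCoeff_X
  rw [derivative_X, mul_one] at hG hH
  rw [hH]
  linear_combination X * hG

/-- The differential equation for `√3 A` as a function of `R`. -/
lemma hypSeries_one_ode :
    X * (1 - 27 * X) * PowerSeries.derivative ℂ (PowerSeries.derivative ℂ
      (subst ((27 : ℂ) • (X : PowerSeries ℂ)) (hypSeries (1 / 3) (2 / 3) 1))) +
      (1 - 54 * X) * PowerSeries.derivative ℂ
        (subst ((27 : ℂ) • (X : PowerSeries ℂ)) (hypSeries (1 / 3) (2 / 3) 1)) -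
      6 * subst ((27 : ℂ) • (X : PowerSeries ℂ)) (hypSeries (1 / 3) (2 / 3) 1) = 0 := by
  have hG := derivative_subst_hypSeries_one (R := X) constantCoeff_X
  have hH := derivative_mul_subst_hypSeries_two (R := X) constantCoeff_X
  rw [derivative_X, mul_one] at hG hH
  generalize subst ((27 : ℂ) • (X : PowerSeries ℂ)) (hypSeries (1 / 3) (2 / 3) 1) = G at *
  generalize subst ((27 : ℂ) • (X : PowerSeries ℂ)) (hypSeries (1 / 3) (2 / 3) 2) = Y at *
  have h27 : PowerSeries.derivative ℂ (27 * X) = 27 := by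
    rw [← ofNat_smul_eq, Derivation.map_smul, derivative_X, ofNat_smul_eq, mul_one]
  have h6 : PowerSeries.derivative ℂ (6 * (X * Y)) = 6 * PowerSeries.derivative ℂ (X * Y) := by
    have h (P : PowerSeries ℂ) : 6 * P = (6 : ℂ) • P := by rw [Algebra.smul_def, map_ofNat]
    rw [h, h, Derivation.map_smul]
  have h := congrArg (PowerSeries.derivative ℂ)
    (show X * ((1 - 27 * X) * PowerSeries.derivative ℂ G) = 6 * (X * Y) by
      linear_combination X * hG)
  rw [h6, hH, Derivation.leibniz, Derivation.leibniz _ (1 - 27 * X), map_sub, h27,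
    Derivation.map_one_eq_zero, derivative_X] at h
  simp only [smul_eq_mul] at h
  linear_combination h

/-! ### The expansions of `t`, `R` and `√3 A` -/

lemma taylorSeries_qODE :
    X * PowerSeries.derivative ℂ (taylorSeries RSer) =
      taylorSeries aSer ^ 2 * (taylorSeries RSer * (1 - 27 * taylorSeries RSer)) ∧
    X * PowerSeries.derivative ℂ (taylorSeries tSer) = taylorSeries aSer *
      (taylorSeries aSer ^ 2 * (taylorSeries RSer * (1 - 27 * taylorSeries RSer))) ∧
    X * PowerSeries.derivative ℂ (taylorSeries aSer) =
      6 * taylorSeries aSer ^ 2 * taylorSeries tSer := by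
  obtain ⟨h1, h2, h3⟩ := eventually_qODE
  have ha := analyticAt_aSer
  have ht := analyticAt_tSer
  have hR := analyticAt_RSer
  have hR27 : AnalyticAt ℂ (fun q => 27 * RSer q) 0 := analyticAt_const.mul hR
  have hR1 : AnalyticAt ℂ (fun q => 1 - 27 * RSer q) 0 := analyticAt_const.sub hR27
  have hid : AnalyticAt ℂ (fun q : ℂ => q) 0 := analyticAt_id
  have ha2 : AnalyticAt ℂ (fun q => aSer q ^ 2) 0 := ha.pow 2
  have hRR : AnalyticAt ℂ (fun q => RSer q * (1 - 27 * RSer q)) 0 := hR.mul hR1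
  have hp : AnalyticAt ℂ (fun q => aSer q ^ 2 * (RSer q * (1 - 27 * RSer q))) 0 := ha2.mul hRR
  have h6 : AnalyticAt ℂ (fun q => 6 * aSer q ^ 2) 0 := analyticAt_const.mul ha2
  have e0 : taylorSeries (fun q => aSer q ^ 2) = taylorSeries aSer ^ 2 := by
    simp only [sq]
    exact taylorSeries_mul ha ha
  have e1 : taylorSeries (fun q => aSer q ^ 2 * (RSer q * (1 - 27 * RSer q))) =
      taylorSeries aSer ^ 2 * (taylorSeries RSer * (1 - 27 * taylorSeries RSer)) := by
    rw [taylorSeries_mul ha2 hRR, e0, taylorSeries_mul hR hR1,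
      taylorSeries_one_sub hR27, taylorSeries_const_mul, ofNat_smul_eq]
  have e2 (f : ℂ → ℂ) (hf : AnalyticAt ℂ f 0) : taylorSeries (fun q => q * deriv f q) =
      X * PowerSeries.derivative ℂ (taylorSeries f) := by
    rw [taylorSeries_mul hid hf.deriv, taylorSeries_id, taylorSeries_deriv]
  refine ⟨?_, ?_, ?_⟩
  · rw [← e2 _ hR, taylorSeries_congr h1, e1]
  · rw [← e2 _ ht, taylorSeries_congr h2, taylorSeries_mul ha hp, e1]
  · have h4 : taylorSeries (fun q => 6 * aSer q ^ 2) = 6 * taylorSeries aSer ^ 2 := by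
      rw [taylorSeries_const_mul, e0, Algebra.smul_def, map_ofNat]
    rw [← e2 _ ha, taylorSeries_congr h3, taylorSeries_mul h6 ht, h4]

/-- For `τ` high up in the half-plane, `q` is small and `A` is non-zero. -/
lemma exists_forall_nome_small : ∃ Y : ℝ, ∀ τ : ℂ, Y < τ.im →
    0 < τ.im ∧ ‖nome τ‖ < 1 / 2 ∧ AFun (Real.pi / 3) τ ≠ 0 := by
  have h1 : ∀ᶠ q in nhds (0 : ℂ), aSer q ≠ 0 :=
    analyticAt_aSer.continuousAt.eventually_ne (by rw [aSer_zero]; exact one_ne_zero)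
  obtain ⟨ε, hε, hball⟩ := Metric.eventually_nhds_iff.1 h1
  obtain ⟨Y, hY⟩ := exists_forall_norm_nome_lt (lt_min hε (by norm_num : (0 : ℝ) < 1 / 2))
  refine ⟨max Y 0, fun τ hτ => ?_⟩
  have hτ0 : 0 < τ.im := (le_max_right _ _).trans_lt hτ
  have h2 := hY τ ((le_max_left _ _).trans_lt hτ)
  refine ⟨hτ0, h2.trans_le (min_le_right _ _), fun h => ?_⟩
  refine hball (y := nome τ) (by simpa using h2.trans_le (min_le_left _ _)) ?_
  rw [aSer_nome hτ0, h, mul_zero]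

lemma exists_formal_expansions :
    (∃ T R A : PowerSeries ℂ,
      IsQExpansion T (tFun (Real.pi / 3)) ∧
      IsQExpansion R (RFun (Real.pi / 3)) ∧
      IsQExpansion A (AFun (Real.pi / 3)) ∧
      coeff 0 T = 0 ∧ coeff 1 T = 1 ∧
      coeff 0 R = 0 ∧ coeff 1 R = 1 ∧
      T = R * subst ((27 : ℂ) • R) (hypSeries (1 / 3) (2 / 3) 2) ∧
      (Real.sqrt 3 : ℂ) • A =
        subst ((27 : ℂ) • R) (hypSeries (1 / 3) (2 / 3) 1) ∧
      -- `q` and `R` as series in `t`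
      (∃ q_t R_t : PowerSeries ℂ,
        IsRightInverse T q_t ∧
        (∀ s : PowerSeries ℂ, IsRightInverse T s → s = q_t) ∧
        R_t = subst q_t R ∧
        X = R_t *
          subst ((27 : ℂ) • R_t) (hypSeries (1 / 3) (2 / 3) 2) ∧
        IsRightInverse binomialSeries R_t ∧
        (∀ s : PowerSeries ℂ,
          IsRightInverse binomialSeries s → s = R_t)) ∧
      -- `q`, `t` and `A` as series in `R`
      (∃ q_R t_R A_R : PowerSeries ℂ,
        IsRightInverse R q_R ∧
        (∀ s : PowerSeries ℂ, IsRightInverse R s → s = q_R) ∧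
        t_R = subst q_R T ∧
        A_R = subst q_R A ∧
        X * (1 - 27 * X) *
          PowerSeries.derivative ℂ (PowerSeries.derivative ℂ t_R) = 6 * t_R ∧
        t_R = X * subst ((27 : ℂ) • (X : PowerSeries ℂ))
          (hypSeries (1 / 3) (2 / 3) 2) ∧
        X * (1 - 27 * X) *
            PowerSeries.derivative ℂ (PowerSeries.derivative ℂ A_R) +
          (1 - 54 * X) * PowerSeries.derivative ℂ A_R - 6 * A_R = 0 ∧
        (Real.sqrt 3 : ℂ) • A_R =
          subst ((27 : ℂ) • (X : PowerSeries ℂ))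
            (hypSeries (1 / 3) (2 / 3) 1))) := by
  obtain ⟨hR, hT, ha⟩ := taylorSeries_qODE
  have hR0 : constantCoeff (taylorSeries RSer) = 0 := by
    rw [constantCoeff_taylorSeries, RSer_zero]
  have hT0 : constantCoeff (taylorSeries tSer) = 0 := by
    rw [constantCoeff_taylorSeries, tSer_zero]
  have ha0 : constantCoeff (taylorSeries aSer) = 1 := by
    rw [constantCoeff_taylorSeries, aSer_zero]
  have hR1 : coeff 1 (taylorSeries RSer) = 1 := by
    rw [coeff_one_taylorSeries, hasDerivAt_RSer_zero.deriv]
  have hT1 : coeff 1 (taylorSeries tSer) = 1 := by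
    rw [coeff_one_taylorSeries, hasDerivAt_tSer_zero.deriv]
  obtain ⟨Y, hY⟩ := exists_forall_nome_small
  obtain ⟨hTR, haR⟩ := eq_subst_hypSeries hR0 hT0 ha0 hR hT ha
  have hexpR : IsQExpansion (taylorSeries RSer) (RFun (Real.pi / 3)) :=
    isQExpansion_taylorSeries analyticAt_RSer Y fun τ h => RSer_nome (hY τ h).1 (hY τ h).2.2
  have hexpT : IsQExpansion (taylorSeries tSer) (tFun (Real.pi / 3)) :=
    isQExpansion_taylorSeries analyticAt_tSer Y fun τ h =>
      tSer_nome (hY τ h).1 (hY τ h).2.2 (hY τ h).2.1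
  have hs := sqrt_three_ne_zero
  have hexpA : IsQExpansion ((Real.sqrt 3 : ℂ)⁻¹ • taylorSeries aSer) (AFun (Real.pi / 3)) := by
    rw [← taylorSeries_const_mul]
    refine isQExpansion_taylorSeries (analyticAt_const.mul analyticAt_aSer) Y fun τ h => ?_
    rw [aSer_nome (hY τ h).1, inv_mul_cancel_left₀ hs]
  generalize taylorSeries RSer = R at *
  generalize taylorSeries tSer = T at *
  generalize taylorSeries aSer = a at *
  have hB0 : constantCoeff binomialSeries = 0 := by
    rw [binomialSeries_eq, map_mul, constantCoeff_X, zero_mul]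
  have hB1 : coeff 1 binomialSeries = 1 := by
    rw [binomialSeries_eq]
    exact (coeff_succ_X_mul 0 _).trans ((coeff_zero_eq_constantCoeff_apply _).trans
      (constantCoeff_subst_hypSeries constantCoeff_X _ _ _))
  obtain ⟨q, hq, hq'⟩ := exists_rightInverse hT0 hT1
  obtain ⟨p, hp, hp'⟩ := exists_rightInverse hR0 hR1
  obtain ⟨b, hb, hb'⟩ := exists_rightInverse hB0 hB1
  have hqs := HasSubst.of_constantCoeff_zero' hq.1
  have hps := HasSubst.of_constantCoeff_zero' hp.1
  have hRq : constantCoeff (subst q R) = 0 := constantCoeff_subst_eq_zero hq.1 R hR0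
  have hXR : X = subst q R *
      subst ((27 : ℂ) • subst q R) (hypSeries (1 / 3) (2 / 3) 2) := by
    rw [← subst_mul_subst_hypSeries hR0 hq.1, ← hTR, hq.2]
  have hRb : IsRightInverse binomialSeries (subst q R) := by
    refine ⟨hRq, ?_⟩
    have hRs := HasSubst.of_constantCoeff_zero' hRq
    rw [binomialSeries_eq, subst_mul_subst_hypSeries constantCoeff_X hRq, subst_X hRs, ← hXR]
  have htp : subst p T = X *
      subst ((27 : ℂ) • (X : PowerSeries ℂ)) (hypSeries (1 / 3) (2 / 3) 2) := by
    rw [hTR, subst_mul_subst_hypSeries hR0 hp.1, hp.2]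
  have hap : subst p a =
      subst ((27 : ℂ) • (X : PowerSeries ℂ)) (hypSeries (1 / 3) (2 / 3) 1) := by
    rw [haR, subst_comp_subst_apply (hasSubst_smul hR0) hps, subst_smul hps, hp.2]
  have hode := hypSeries_one_ode
  rw [← hap] at hode
  refine ⟨T, R, (Real.sqrt 3 : ℂ)⁻¹ • a, hexpT, hexpR, hexpA,
    (coeff_zero_eq_constantCoeff_apply T).trans hT0, hT1,
    (coeff_zero_eq_constantCoeff_apply R).trans hR0, hR1, hTR, ?_,
    ⟨q, subst q R, hq, hq', rfl, hXR, hRb, fun s hs => (hb' s hs).trans (hb' _ hRb).symm⟩,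
    ⟨p, subst p T, subst p ((Real.sqrt 3 : ℂ)⁻¹ • a), hp, hp', rfl, rfl, ?_, htp, ?_, ?_⟩⟩
  · rw [smul_inv_smul₀ hs, ← haR]
  · rw [htp]
    exact hypSeries_two_ode
  · rw [subst_smul hps, Derivation.map_smul, Derivation.map_smul, mul_smul_comm, mul_smul_comm,
      mul_smul_comm, ← smul_add, ← smul_sub, hode, smul_zero]
  · rw [subst_smul hps, smul_inv_smul₀ hs, hap]

end SixVertex

end

noncomputable section

namespace SixVertex

open Filter Topology
open scoped Real ENNReal

/-! ### The real hypergeometric functions -/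

lemma hasFPowerSeriesOnBall_F {c : ℝ} (hc : 0 < c) :
    HasFPowerSeriesOnBall (F c) (ordinaryHypergeometricSeries ℝ (1 / 3 : ℝ) (2 / 3) c) 0 1 := by
  have h1 := ordinaryHypergeometricSeries_radius_eq_one ℝ (1 / 3 : ℝ) (2 / 3) c fun n => by
    have hn : (0 : ℝ) ≤ n := n.cast_nonneg
    exact ⟨by linarith, by linarith, by linarith⟩
  have h2 := (ordinaryHypergeometricSeries ℝ (1 / 3 : ℝ) (2 / 3) c).hasFPowerSeriesOnBall
    (by rw [h1]; exact one_pos)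
  rwa [h1] at h2

lemma mem_eball_one {x : ℝ} (hx : |x| < 1) : x ∈ Metric.eball (0 : ℝ) 1 := by
  rw [← ENNReal.ofReal_one, Metric.eball_ofReal]
  simpa using hx

lemma analyticAt_F {c : ℝ} (hc : 0 < c) {x : ℝ} (hx : |x| < 1) : AnalyticAt ℝ (F c) x :=
  (hasFPowerSeriesOnBall_F hc).analyticAt_of_mem (mem_eball_one hx)

lemma hasSum_F {c : ℝ} (hc : 0 < c) {x : ℝ} (hx : |x| < 1) :
    HasSum (fun n => ordinaryHypergeometricCoefficient (1 / 3 : ℝ) (2 / 3) c n * x ^ n)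
      (F c x) := by
  have h := (hasFPowerSeriesOnBall_F hc).hasSum (mem_eball_one hx)
  rw [zero_add] at h
  refine h.congr_fun fun n => ?_
  rw [ordinaryHypergeometricSeries_apply_eq, smul_eq_mul]

lemma hasSum_deriv_F {c : ℝ} (hc : 0 < c) {x : ℝ} (hx : |x| < 1) :
    HasSum (fun n : ℕ => ((n : ℝ) + 1) *
      ordinaryHypergeometricCoefficient (1 / 3 : ℝ) (2 / 3) c (n + 1) * x ^ n)
      (deriv (F c) x) := by
  have h := (hasFPowerSeriesOnBall_F hc).fderiv.hasSum (mem_eball_one hx)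
  rw [zero_add] at h
  have h1 := h.mapL (ContinuousLinearMap.apply ℝ ℝ (1 : ℝ))
  refine (h1.congr_fun fun n => ?_)
  rw [FormalMultilinearSeries.apply_eq_pow_smul_coeff, map_smul,
    ContinuousLinearMap.apply_apply, FormalMultilinearSeries.derivSeries_coeff_one,
    ordinaryHypergeometricSeries, FormalMultilinearSeries.coeff_ofScalars, smul_eq_mul,
    nsmul_eq_mul]
  push_cast
  ring

lemma hasDerivAt_F {c : ℝ} (hc : 0 < c) {x : ℝ} (hx : |x| < 1) :
    HasDerivAt (F c) (deriv (F c) x) x :=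
  (analyticAt_F hc hx).differentiableAt.hasDerivAt

lemma hasSum_mul_deriv_F {c : ℝ} (hc : 0 < c) {x : ℝ} (hx : |x| < 1) :
    HasSum (fun n : ℕ => (n : ℝ) * ordinaryHypergeometricCoefficient (1 / 3 : ℝ) (2 / 3) c n *
      x ^ n) (x * deriv (F c) x) := by
  refine (hasSum_nat_add_iff' 1).1 ?_
  have h := (hasSum_deriv_F hc hx).mul_left x
  simp only [Finset.range_one, Finset.sum_singleton, Nat.cast_zero, zero_mul, sub_zero]
  refine h.congr_fun fun n => ?_
  push_cast
  ring

lemma deriv_F_one {x : ℝ} (hx : |x| < 1) : (1 - x) * deriv (F 1) x = 2 / 9 * F 2 x := by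
  have h := ((hasSum_mul_deriv_F one_pos hx).add ((hasSum_F two_pos hx).mul_left (2 / 9)))
  have h1 := (hasSum_deriv_F one_pos hx).unique (h.congr_fun fun n => by
    rw [hypCoeff_one_succ]
    ring)
  linear_combination h1

lemma mul_deriv_F_two {x : ℝ} (hx : |x| < 1) : F 2 x + x * deriv (F 2) x = F 1 x := by
  refine ((hasSum_F two_pos hx).add (hasSum_mul_deriv_F two_pos hx)).unique
    ((hasSum_F one_pos hx).congr_fun fun n => ?_)
  rw [← hypCoeff_two]
  ring

lemma F_one_zero : F 1 0 = 1 := ordinaryHypergeometric_zero _ _ _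

lemma abs_lt_one_of_mem {x : ℝ} (hx : x ∈ Set.Ioo (0 : ℝ) (1 / 27)) : |27 * x| < 1 := by
  rw [abs_of_pos (by linarith [hx.1])]
  linarith [hx.2]

lemma hasDerivAt_F_mul {c : ℝ} (hc : 0 < c) {x : ℝ} (hx : |27 * x| < 1) :
    HasDerivAt (fun x => F c (27 * x)) (27 * deriv (F c) (27 * x)) x := by
  have h := (hasDerivAt_F hc hx).comp x ((hasDerivAt_id x).const_mul 27)
  refine h.congr_deriv ?_
  ring

/-- The derivative of `₂F₁(1/3, 2/3; 1; 27 x)`. -/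
lemma hasDerivAt_F_one_mul {x : ℝ} (hx : x ∈ Set.Ioo (0 : ℝ) (1 / 27)) :
    HasDerivAt (fun x => F 1 (27 * x)) (6 * F 2 (27 * x) / (1 - 27 * x)) x := by
  have h1 : 1 - 27 * x ≠ 0 := by linarith [hx.2]
  refine (hasDerivAt_F_mul one_pos (abs_lt_one_of_mem hx)).congr_deriv ?_
  rw [eq_div_iff h1]
  linear_combination 27 * deriv_F_one (abs_lt_one_of_mem hx)

/-- The derivative of `x · ₂F₁(1/3, 2/3; 2; 27 x)`. -/
lemma hasDerivAt_mul_F_two {x : ℝ} (hx : |27 * x| < 1) :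
    HasDerivAt (fun x => x * F 2 (27 * x)) (F 1 (27 * x)) x := by
  refine ((hasDerivAt_id x).mul (hasDerivAt_F_mul two_pos hx)).congr_deriv ?_
  simp only [id]
  linear_combination mul_deriv_F_two hx

lemma hypOperator_F_one {x : ℝ} (hx : x ∈ Set.Ioo (0 : ℝ) (1 / 27)) :
    hypOperator (fun y => F 1 (27 * y)) x = 0 := by
  have hmem : ∀ᶠ y in 𝓝 x, y ∈ Set.Ioo (0 : ℝ) (1 / 27) := isOpen_Ioo.eventually_mem hx
  have h1 : 1 - 27 * x ≠ 0 := by linarith [hx.2]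
  have h2 := (((hasDerivAt_F_mul two_pos (abs_lt_one_of_mem hx)).const_mul 6).div
    (((hasDerivAt_id x).const_mul 27).const_sub 1) h1)
  have h3 : deriv (fun y => F 1 (27 * y)) =ᶠ[𝓝 x] fun y => 6 * F 2 (27 * y) / (1 - 27 * y) :=
    hmem.mono fun y hy => (hasDerivAt_F_one_mul hy).deriv
  rw [hypOperator, h3.deriv_eq, h3.self_of_nhds]
  erw [h2.deriv]
  have h4 := mul_deriv_F_two (abs_lt_one_of_mem hx)
  dsimp only [id]
  rw [← h4]
  generalize hd : 1 - 27 * x = d at h1 ⊢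
  field_simp
  rw [← hd]
  ring

lemma hypOperator_comp_sub (f : ℝ → ℝ) (x : ℝ) :
    hypOperator (fun y => f (1 / 27 - y)) x = hypOperator f (1 / 27 - x) := by
  have h1 : deriv (fun y => f (1 / 27 - y)) = fun y => -deriv f (1 / 27 - y) :=
    funext fun y => deriv_comp_const_sub _ _ _
  rw [hypOperator, hypOperator, h1, deriv.fun_neg, deriv_comp_const_sub]
  ring

lemma hypOperator_F_one_sub {x : ℝ} (hx : x ∈ Set.Ioo (0 : ℝ) (1 / 27)) :
    hypOperator (fun y => F 1 (1 - 27 * y)) x = 0 := by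
  have h : (fun y => F 1 (1 - 27 * y)) = fun y => F 1 (27 * (1 / 27 - y)) := by
    funext y
    congr 1
    ring
  rw [h, hypOperator_comp_sub (fun y => F 1 (27 * y))]
  exact hypOperator_F_one ⟨by linarith [hx.2], by linarith [hx.1]⟩

lemma analyticOnNhd_F_one :
    AnalyticOnNhd ℝ (fun x => F 1 (27 * x)) (Set.Ioo 0 (1 / 27)) := fun _ hx =>
  AnalyticAt.comp (g := F 1) (analyticAt_F one_pos (abs_lt_one_of_mem hx))
    (analyticAt_const.mul analyticAt_id)

lemma analyticOnNhd_F_one_sub :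
    AnalyticOnNhd ℝ (fun x => F 1 (1 - 27 * x)) (Set.Ioo 0 (1 / 27)) := fun _ hx =>
  AnalyticAt.comp (g := F 1) (analyticAt_F one_pos (by
    rw [abs_of_pos (by linarith [hx.2])]
    linarith [hx.1])) (analyticAt_const.sub (analyticAt_const.mul analyticAt_id))

end SixVertex

end

noncomputable section

namespace SixVertex

open Complex Filter Topology
open scoped Real

/-! ### Real values on the imaginary axis -/

lemma hasDerivAt_re_of_real {g : ℂ → ℂ} {d : ℂ} {y : ℝ} (hy : 0 < y)
    (hg : ∀ y : ℝ, 0 < y → g (I * y) = (g (I * y)).re) (h : HasDerivAt g (2 * π * I * d) (I * y)) :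
    HasDerivAt (fun y : ℝ => (g (I * y)).re) (-2 * π * d.re) y ∧ d = d.re := by
  have h1 : HasDerivAt (fun z : ℂ => g (I * z)) (-2 * π * d) (y : ℂ) := by
    refine (HasDerivAt.comp (y : ℂ) h ((hasDerivAt_id (y : ℂ)).const_mul I)).congr_deriv ?_
    linear_combination (2 * π * d) * I_mul_I
  have h2 : HasDerivAt (fun y : ℝ => (g (I * y)).re) (-2 * π * d.re) y := by
    refine h1.real_of_complex.congr_deriv ?_
    rw [show (-2 * π * d : ℂ) = ((-2 * π : ℝ) : ℂ) * d by push_cast; ring, re_ofReal_mul]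
  refine ⟨h2, ?_⟩
  have h3 : HasDerivAt (fun y : ℝ => g (I * y)) ((-2 * π * d.re : ℝ) : ℂ) y :=
    h2.ofReal_comp.congr_of_eventuallyEq ((eventually_gt_nhds hy).mono fun y hy => hg y hy)
  have h4 := h1.comp_ofReal.unique h3
  have hp : (-2 * π : ℂ) ≠ 0 := by simp [Real.pi_ne_zero]
  refine mul_left_cancel₀ hp (h4.trans ?_)
  push_cast
  ring

/-- The value of `√3 A` on the imaginary axis. -/
def aRe (y : ℝ) : ℝ := ((√3 : ℝ) * AFun (π / 3) (I * y) : ℂ).re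

/-- The value of `h` on the imaginary axis. -/
def hRe (y : ℝ) : ℝ := (hFun (I * y)).re

/-- The value of `R` on the imaginary axis. -/
def RRe (y : ℝ) : ℝ := (RFun (π / 3) (I * y)).re

/-- The value of `t` on the imaginary axis. -/
def tRe (y : ℝ) : ℝ := (tFun (π / 3) (I * y)).re

lemma one_le_aRe {y : ℝ} (hy : 0 < y) :
    1 ≤ aRe y ∧ (√3 : ℝ) * AFun (π / 3) (I * y) = aRe y := by
  have h := hasSum_lambert (I_mul_im_pos hy)
  set Q := Real.exp (-(2 * π * y))
  have hQ : 0 < Q := Real.exp_pos _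
  have h1 : HasSum (fun n : ℕ => ((6 * (Q ^ (n + 1) / (1 + Q ^ (n + 1) + Q ^ (2 * (n + 1)))) : ℝ) : ℂ))
      ((√3 : ℝ) * AFun (π / 3) (I * y) - 1) := by
    refine h.congr_fun fun n => ?_
    have hn : nome (I * y) = (Q : ℂ) := nome_I_mul y
    rw [hn]
    push_cast
    rfl
  have h2 := Complex.summable_ofReal.1 h1.summable
  have h3 := h1.unique (Complex.hasSum_ofReal.2 h2.hasSum)
  have h4 : (0 : ℝ) ≤ ∑' n : ℕ, 6 * (Q ^ (n + 1) / (1 + Q ^ (n + 1) + Q ^ (2 * (n + 1)))) :=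
    tsum_nonneg fun n => by positivity
  have h5 : (√3 : ℝ) * AFun (π / 3) (I * y) = ((1 + ∑' n : ℕ, 6 * (Q ^ (n + 1) /
      (1 + Q ^ (n + 1) + Q ^ (2 * (n + 1)))) : ℝ) : ℂ) := by
    rw [Complex.ofReal_add, ← h3, ofReal_one]
    ring
  rw [aRe, h5, ofReal_re]
  exact ⟨by linarith, rfl⟩

lemma AFun_I_mul_ne_zero {y : ℝ} (hy : 0 < y) : AFun (π / 3) (I * y) ≠ 0 := fun h => by
  obtain ⟨h1, h2⟩ := one_le_aRe hy
  rw [h, mul_zero] at h2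
  have : aRe y = 0 := by exact_mod_cast h2.symm
  linarith

lemma exists_eta_eq_ofReal {y : ℝ} (hy : 0 < y) :
    ∃ e : ℝ, e ≠ 0 ∧ ModularForm.eta (I * y) = e := by
  have h0 := eta_ne_zero (I_mul_im_pos hy)
  have hm : Multipliable fun n : ℕ => 1 - Real.exp (-(2 * π * y)) ^ (n + 1) := by
    have hq : Real.exp (-(2 * π * y)) < 1 := Real.exp_lt_one_iff.2 (by
      rw [neg_lt_zero]
      positivity)
    simp only [sub_eq_add_neg]
    refine multipliable_one_add_of_summable ?_
    simpa using (summable_nat_add_iff 1).2 (summable_geometric_of_lt_one (Real.exp_pos _).le hq)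
  have h1 : ModularForm.eta (I * y) = ((Real.exp (-(π * y / 12)) *
      ∏' n : ℕ, (1 - Real.exp (-(2 * π * y)) ^ (n + 1)) : ℝ) : ℂ) := by
    rw [eta_eq_eProd, eProd_one, nome_I_mul, Complex.ofReal_mul]
    congr 1
    · rw [Complex.ofReal_exp]
      congr 1
      push_cast
      linear_combination (π * y / 12) * I_mul_I
    · refine Eq.trans ?_ (hm.map_tprod Complex.ofRealHom Complex.continuous_ofReal).symm
      simp
  refine ⟨_, fun h => h0 ?_, h1⟩
  rw [h1, h, ofReal_zero]

lemma eta_fricke {y : ℝ} (hy : 0 < y) :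
    ModularForm.eta (I * (1 / y : ℝ)) ^ 2 = y * ModularForm.eta (I * y) ^ 2 := by
  have h := ModularForm.eta_comp_eq_csqrt_I_inv (I_mul_im_pos hy)
  have hy' : (y : ℂ) ≠ 0 := by exact_mod_cast hy.ne'
  have h1 : -1 / (I * (y : ℂ)) = I * (1 / y : ℝ) := by
    push_cast
    field_simp
    exact I_sq.symm
  simp only [Function.comp_apply, Pi.smul_apply, Pi.mul_apply, smul_eq_mul] at h
  have h2 (z : ℂ) : Complex.sqrt z ^ 2 = z := Complex.cpow_ofNat_inv_pow z 2
  rw [← h1, h, mul_pow, mul_pow, inv_pow, h2, h2]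
  field_simp

lemma hRe_pos {y : ℝ} (hy : 0 < y) : 0 < hRe y ∧ hFun (I * y) = hRe y := by
  obtain ⟨e, he, h1⟩ := exists_eta_eq_ofReal hy
  obtain ⟨e', he', h2⟩ := exists_eta_eq_ofReal (y := 3 * y) (by positivity)
  have h3 : hFun (I * y) = (((e' / e) ^ 12 : ℝ) : ℂ) := by
    rw [hFun, h1, show 3 * (I * (y : ℂ)) = I * (3 * y : ℝ) by push_cast; ring, h2]
    push_cast
    rfl
  rw [hRe, h3, ofReal_re]
  exact ⟨by positivity, rfl⟩

lemma hRe_fricke {y : ℝ} (hy : 0 < y) : 729 * hRe (1 / (3 * y)) * hRe y = 1 := by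
  have hy3 : 0 < 1 / (3 * y) := by positivity
  have h0 := eta_ne_zero (I_mul_im_pos hy)
  have h1 := eta_fricke hy
  have h2 := eta_fricke (y := 3 * y) (by positivity)
  have h0' := eta_ne_zero (I_mul_im_pos (show 0 < 3 * y by positivity))
  have hy' : (y : ℂ) ≠ 0 := by exact_mod_cast hy.ne'
  suffices h : (729 * hFun (I * (1 / (3 * y) : ℝ)) * hFun (I * y) : ℂ) = 1 by
    rw [(hRe_pos hy).2, (hRe_pos hy3).2] at h
    exact_mod_cast h
  rw [hFun, hFun, show 3 * (I * ((1 / (3 * y) : ℝ) : ℂ)) = I * (1 / y : ℝ) by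
    push_cast; field_simp, show 3 * (I * (y : ℂ)) = I * (3 * y : ℝ) by push_cast; ring]
  have h12 (z : ℂ) : z ^ 12 = (z ^ 2) ^ 6 := by ring
  rw [h12, h12, div_pow, div_pow, h1, h2]
  generalize ModularForm.eta (I * ((3 * y : ℝ) : ℂ)) = e' at h0' ⊢
  generalize ModularForm.eta (I * (y : ℂ)) = e at h0 ⊢
  push_cast
  field_simp
  norm_num

lemma RRe_eq {y : ℝ} (hy : 0 < y) :
    RFun (π / 3) (I * y) = RRe y ∧ RRe y = hRe y / (1 + 27 * hRe y) := by
  have h := RFun_eq_hFun (I_mul_im_pos hy) (AFun_I_mul_ne_zero hy)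
  rw [(hRe_pos hy).2] at h
  have h1 : RFun (π / 3) (I * y) = ((hRe y / (1 + 27 * hRe y) : ℝ) : ℂ) := by
    rw [h]
    push_cast
    rfl
  rw [RRe, h1, ofReal_re]
  exact ⟨rfl, rfl⟩

lemma RRe_mem {y : ℝ} (hy : 0 < y) : RRe y ∈ Set.Ioo (0 : ℝ) (1 / 27) := by
  have h := (hRe_pos hy).1
  rw [(RRe_eq hy).2]
  refine ⟨by positivity, ?_⟩
  rw [div_lt_div_iff₀ (by positivity) (by norm_num)]
  linarith

lemma RRe_fricke {y : ℝ} (hy : 0 < y) : 27 * RRe (1 / (3 * y)) = 1 - 27 * RRe y := by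
  have hy3 : 0 < 1 / (3 * y) := by positivity
  have h := (hRe_pos hy).1
  have h3 := (hRe_pos hy3).1
  have hf := hRe_fricke hy
  have e : hRe (1 / (3 * y)) = 1 / (729 * hRe y) := by
    rw [eq_div_iff (by positivity)]
    linarith
  rw [(RRe_eq hy).2, (RRe_eq hy3).2, e]
  have h1 : 1 + 27 * hRe y ≠ 0 := by positivity
  field_simp
  ring

/-! ### Differential equations on the imaginary axis -/

lemma AFun_sq_re {y : ℝ} (hy : 0 < y) : 3 * AFun (π / 3) (I * y) ^ 2 = (aRe y ^ 2 : ℝ) := by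
  rw [ofReal_pow, ← (one_le_aRe hy).2, mul_pow, sqrt_three_sq]

lemma hasDerivAt_hRe {y : ℝ} (hy : 0 < y) :
    HasDerivAt hRe (-2 * π * (aRe y ^ 2 * hRe y)) y := by
  have h := hasDerivAt_hFun (I_mul_im_pos hy)
  rw [AFun_sq_re hy, (hRe_pos hy).2, ← ofReal_mul] at h
  exact (hasDerivAt_re_of_real hy (fun y hy => (hRe_pos hy).2) h).1

lemma hasDerivAt_RRe {y : ℝ} (hy : 0 < y) :
    HasDerivAt RRe (-2 * π * (aRe y ^ 2 * (RRe y * (1 - 27 * RRe y)))) y := by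
  have h := hasDerivAt_RFun (I_mul_im_pos hy) (AFun_I_mul_ne_zero hy)
  rw [AFun_sq_re hy, (RRe_eq hy).1, show ((aRe y ^ 2 : ℝ) * (RRe y * (1 - 27 * RRe y)) : ℂ) =
    ((aRe y ^ 2 * (RRe y * (1 - 27 * RRe y)) : ℝ) : ℂ) by push_cast; rfl] at h
  exact (hasDerivAt_re_of_real hy (fun y hy => (RRe_eq hy).1) h).1

lemma hasDerivAt_aRe_aux {y : ℝ} (hy : 0 < y) : tFun (π / 3) (I * y) = tRe y ∧
    HasDerivAt aRe (-2 * π * (6 * aRe y ^ 2 * tRe y)) y := by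
  have h := hasDerivAt_sqrt_three_mul_AFun (I_mul_im_pos hy) (AFun_I_mul_ne_zero hy)
  rw [(one_le_aRe hy).2] at h
  obtain ⟨h1, h2⟩ := hasDerivAt_re_of_real hy (fun y hy => (one_le_aRe hy).2) h
  have ha : ((6 * aRe y ^ 2 : ℝ) : ℂ) ≠ 0 := by
    have := (one_le_aRe hy).1
    exact_mod_cast (by positivity : 6 * aRe y ^ 2 ≠ 0)
  rw [show (6 * (aRe y : ℂ) ^ 2 * tFun (π / 3) (I * y)) =
    ((6 * aRe y ^ 2 : ℝ) : ℂ) * tFun (π / 3) (I * y) by push_cast; rfl, re_ofReal_mul] at h1 h2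
  rw [Complex.ofReal_mul (6 * aRe y ^ 2)] at h2
  exact ⟨mul_left_cancel₀ ha h2, h1⟩

lemma tFun_I_mul {y : ℝ} (hy : 0 < y) : tFun (π / 3) (I * y) = tRe y := (hasDerivAt_aRe_aux hy).1

lemma hasDerivAt_aRe {y : ℝ} (hy : 0 < y) :
    HasDerivAt aRe (-2 * π * (6 * aRe y ^ 2 * tRe y)) y := (hasDerivAt_aRe_aux hy).2

lemma hasDerivAt_tRe {y : ℝ} (hy : 0 < y) :
    HasDerivAt tRe (-2 * π * (aRe y * (aRe y ^ 2 * (RRe y * (1 - 27 * RRe y))))) y := by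
  have h := hasDerivAt_tFun (I_mul_im_pos hy) (AFun_I_mul_ne_zero hy)
  rw [AFun_sq_re hy, (RRe_eq hy).1, (one_le_aRe hy).2,
    show ((aRe y : ℂ) * ((aRe y ^ 2 : ℝ) * (RRe y * (1 - 27 * RRe y))) : ℂ) =
    ((aRe y * (aRe y ^ 2 * (RRe y * (1 - 27 * RRe y))) : ℝ) : ℂ) by push_cast; rfl] at h
  exact (hasDerivAt_re_of_real hy (fun y hy => tFun_I_mul hy) h).1

lemma aRe_fricke {y : ℝ} (hy : 0 < y) : aRe (1 / (3 * y)) = √3 * y * aRe y := by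
  have hy3 : 0 < 1 / (3 * y) := by positivity
  have h1 := (hRe_pos hy).1
  have h3 := (hRe_pos hy3).1
  have ha := (one_le_aRe hy).1
  have ha3 := (one_le_aRe hy3).1
  have hi : HasDerivAt (fun y : ℝ => 1 / (3 * y)) (-(3 * y ^ 2)⁻¹) y := by
    have := ((hasDerivAt_id y).const_mul 3).inv (by simpa using hy.ne')
    simp only [one_div]
    refine this.congr_deriv ?_
    simp only [id]
    field_simp
  have hd : HasDerivAt (fun y => 729 * hRe (1 / (3 * y)) * hRe y)
      (729 * (-2 * π * (aRe (1 / (3 * y)) ^ 2 * hRe (1 / (3 * y))) * -(3 * y ^ 2)⁻¹) * hRe y +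
        729 * hRe (1 / (3 * y)) * (-2 * π * (aRe y ^ 2 * hRe y))) y :=
    ((HasDerivAt.comp (h₂ := hRe) y (hasDerivAt_hRe hy3) hi).const_mul 729).mul
      (hasDerivAt_hRe hy)
  have he : (fun y => 729 * hRe (1 / (3 * y)) * hRe y) =ᶠ[𝓝 y] fun _ => (1 : ℝ) := by
    filter_upwards [eventually_gt_nhds hy] with z hz
    exact hRe_fricke hz
  have hc : HasDerivAt (fun y => 729 * hRe (1 / (3 * y)) * hRe y) 0 y :=
    (hasDerivAt_const y (1 : ℝ)).congr_of_eventuallyEq he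
  have hd' := hd.unique hc
  have hk : (3 * y ^ 2)⁻¹ * (3 * y ^ 2) = 1 := inv_mul_cancel₀ (by positivity)
  have hp : 1458 * π * hRe (1 / (3 * y)) * hRe y ≠ 0 :=
    mul_ne_zero (mul_ne_zero (by positivity) h3.ne') h1.ne'
  have h4 : aRe (1 / (3 * y)) ^ 2 = (√3 * y * aRe y) ^ 2 := by
    rw [mul_pow, mul_pow, Real.sq_sqrt (by norm_num : (0 : ℝ) ≤ 3)]
    generalize (3 * y ^ 2)⁻¹ = k at hd' hk
    generalize hRe (1 / (3 * y)) = H at hd' hp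
    generalize aRe (1 / (3 * y)) = a' at hd' ⊢
    have e : (1458 * π * H * hRe y) * (a' ^ 2 * k - aRe y ^ 2) = 0 := by linear_combination hd'
    have e' := (mul_eq_zero.1 e).resolve_left hp
    linear_combination 3 * y ^ 2 * e' - a' ^ 2 * hk
  exact (pow_left_inj₀ (by linarith) (mul_nonneg (by positivity) (by linarith)) two_ne_zero).1 h4

/-! ### The hypergeometric identities -/

lemma eq_of_hasDerivAt_zero_of_tendsto {f : ℝ → ℝ} {L : ℝ} (hf : ∀ y, 0 < y → HasDerivAt f 0 y)
    (hL : Tendsto f atTop (𝓝 L)) {y : ℝ} (hy : 0 < y) : f y = L := by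
  refine tendsto_nhds_unique (tendsto_const_nhds.congr' ?_) hL
  filter_upwards [eventually_gt_atTop 0] with x hx
  exact isOpen_Ioi.is_const_of_deriv_eq_zero isPreconnected_Ioi
    (fun y hy => (hf y hy).differentiableAt.differentiableWithinAt)
    (fun y hy => (hf y hy).deriv) (Set.mem_Ioi.2 hy) (Set.mem_Ioi.2 hx)

lemma tendsto_re_ser {f g : ℂ → ℂ} (hf : AnalyticAt ℂ f 0)
    (h : ∀ᶠ y : ℝ in atTop, f (nome (I * y)) = g (I * y)) :
    Tendsto (fun y : ℝ => (g (I * y)).re) atTop (𝓝 (f 0).re) := by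
  have h1 := hf.continuousAt.tendsto.comp (tendsto_nome_I_mul.mono_right nhdsWithin_le_nhds)
  exact (continuous_re.tendsto _).comp (h1.congr' h)

lemma tendsto_aRe : Tendsto aRe atTop (𝓝 1) := by
  have := tendsto_re_ser (g := fun τ => (√3 : ℝ) * AFun (π / 3) τ) analyticAt_aSer
    ((eventually_gt_atTop 0).mono fun y hy => aSer_nome (I_mul_im_pos hy))
  rwa [aSer_zero, one_re] at this

lemma tendsto_RRe : Tendsto RRe atTop (𝓝 0) := by
  have := tendsto_re_ser (g := RFun (π / 3)) analyticAt_RSer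
    ((eventually_gt_atTop 0).mono fun y hy =>
      RSer_nome (I_mul_im_pos hy) (AFun_I_mul_ne_zero hy))
  rwa [RSer_zero, zero_re] at this

lemma tendsto_tRe : Tendsto tRe atTop (𝓝 0) := by
  have hq : ∀ᶠ y : ℝ in atTop, ‖nome (I * y)‖ < 1 / 2 := by
    have := (tendsto_nome_I_mul.mono_right nhdsWithin_le_nhds).norm
    rw [norm_zero] at this
    exact this.eventually_lt_const (by norm_num)
  have := tendsto_re_ser (g := tFun (π / 3)) analyticAt_tSer (by
    filter_upwards [eventually_gt_atTop 0, hq] with y hy hy'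
    exact tSer_nome (I_mul_im_pos hy) (AFun_I_mul_ne_zero hy) hy')
  rwa [tSer_zero, zero_re] at this

lemma tendsto_F_RRe {c : ℝ} (hc : 0 < c) :
    Tendsto (fun y => F c (27 * RRe y)) atTop (𝓝 (F c 0)) := by
  have h := tendsto_RRe.const_mul 27
  rw [mul_zero] at h
  exact (analyticAt_F hc (by simp)).continuousAt.tendsto.comp h

lemma hasDerivAt_F_one_RRe {y : ℝ} (hy : 0 < y) : HasDerivAt (fun y => F 1 (27 * RRe y))
    (-2 * π * (6 * aRe y ^ 2 * (RRe y * F 2 (27 * RRe y)))) y := by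
  have hm := RRe_mem hy
  have h1 : 1 - 27 * RRe y ≠ 0 := by linarith [hm.2]
  refine ((hasDerivAt_F_one_mul hm).comp y (hasDerivAt_RRe hy)).congr_deriv ?_
  generalize hd : 1 - 27 * RRe y = d at h1
  field_simp

lemma hasDerivAt_F_two_RRe {y : ℝ} (hy : 0 < y) :
    HasDerivAt (fun y => RRe y * F 2 (27 * RRe y))
      (-2 * π * (aRe y ^ 2 * (RRe y * (1 - 27 * RRe y)) * F 1 (27 * RRe y))) y := by
  refine ((hasDerivAt_mul_F_two (abs_lt_one_of_mem (RRe_mem hy))).comp y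
    (hasDerivAt_RRe hy)).congr_deriv ?_
  ring

lemma aRe_mul_eq {y : ℝ} (hy : 0 < y) :
    aRe y * (RRe y * F 2 (27 * RRe y)) - F 1 (27 * RRe y) * tRe y = 0 := by
  refine eq_of_hasDerivAt_zero_of_tendsto
    (f := fun y => aRe y * (RRe y * F 2 (27 * RRe y)) - F 1 (27 * RRe y) * tRe y)
    (fun y hy => ?_) ?_ hy
  · refine (((hasDerivAt_aRe hy).mul (hasDerivAt_F_two_RRe hy)).sub
      ((hasDerivAt_F_one_RRe hy).mul (hasDerivAt_tRe hy))).congr_deriv ?_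
    ring
  · have h := (tendsto_aRe.mul (tendsto_RRe.mul (tendsto_F_RRe two_pos))).sub
      ((tendsto_F_RRe one_pos).mul tendsto_tRe)
    simpa using h

lemma F_one_RRe {y : ℝ} (hy : 0 < y) : F 1 (27 * RRe y) = aRe y := by
  have h : F 1 (27 * RRe y) / aRe y = 1 := by
    refine eq_of_hasDerivAt_zero_of_tendsto (f := fun y => F 1 (27 * RRe y) / aRe y)
      (fun y hy => ?_) ?_ hy
    · have ha : aRe y ≠ 0 := by linarith [(one_le_aRe hy).1]
      refine ((hasDerivAt_F_one_RRe hy).div (hasDerivAt_aRe hy) ha).congr_deriv ?_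
      rw [div_eq_zero_iff]
      left
      linear_combination (-12 * π * aRe y ^ 2) * aRe_mul_eq hy
    · have h := (tendsto_F_RRe one_pos).div tendsto_aRe one_ne_zero
      rwa [F_one_zero, div_one] at h
  exact (div_eq_one_iff_eq (by linarith [(one_le_aRe hy).1])).1 h

lemma tRe_eq {y : ℝ} (hy : 0 < y) : tRe y = RRe y * F 2 (27 * RRe y) := by
  have h := aRe_mul_eq hy
  have ha : aRe y ≠ 0 := by linarith [(one_le_aRe hy).1]
  rw [F_one_RRe hy] at h
  refine mul_left_cancel₀ ha ?_
  linarith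

lemma F_one_one_sub_RRe {y : ℝ} (hy : 0 < y) : F 1 (1 - 27 * RRe y) = √3 * y * aRe y := by
  rw [← RRe_fricke hy, F_one_RRe (by positivity), aRe_fricke hy]

lemma F_one_linear_independent {a b : ℝ} (h : ∀ x ∈ Set.Ioo (0 : ℝ) (1 / 27),
    a * F 1 (27 * x) + b * F 1 (1 - 27 * x) = 0) : a = 0 ∧ b = 0 := by
  have h1 (y : ℝ) (hy : 0 < y) : a + b * (√3 * y) = 0 := by
    have ha : aRe y ≠ 0 := by linarith [(one_le_aRe hy).1]
    have h2 := h _ (RRe_mem hy)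
    rw [F_one_RRe hy, F_one_one_sub_RRe hy] at h2
    refine mul_right_cancel₀ ha ?_
    linear_combination h2
  have h2 := h1 1 one_pos
  have h3 := h1 2 two_pos
  have hs : √3 ≠ 0 := by positivity
  have hb : b = 0 := by
    refine (mul_eq_zero.1 (?_ : b * √3 = 0)).resolve_right hs
    linarith
  rw [hb] at h2
  exact ⟨by linarith, hb⟩

/-- The values of `R`, `t` and `A` on the imaginary axis and Ramanujan's identity. -/
lemma exists_real_values {y : ℝ} (hy : 0 < y) : ∃ r : ℝ, 0 < r ∧ 27 * r < 1 ∧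
    RFun (π / 3) (I * y) = r ∧
    tFun (π / 3) (I * y) = ((r * F 2 (27 * r) : ℝ) : ℂ) ∧
    (√3 : ℂ) * AFun (π / 3) (I * y) = (F 1 (27 * r) : ℂ) ∧
    I * y * AFun (π / 3) (I * y) = I / 3 * (F 1 (1 - 27 * r) : ℂ) ∧
    F 1 (27 * r) ≠ 0 ∧
    Real.exp (-2 * π * y) =
      Real.exp (-(2 * π / √3) * (F 1 (1 - 27 * r) / F 1 (27 * r))) := by
  have hm := RRe_mem hy
  have ha := (one_le_aRe hy).2
  have ha0 : aRe y ≠ 0 := by linarith [(one_le_aRe hy).1]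
  have hs : √3 ≠ 0 := by positivity
  refine ⟨RRe y, hm.1, by linarith [hm.2], (RRe_eq hy).1, ?_, ?_, ?_, ?_, ?_⟩
  · rw [tFun_I_mul hy, tRe_eq hy]
  · rw [ha, F_one_RRe hy]
  · rw [F_one_one_sub_RRe hy, ofReal_mul, ofReal_mul, ← ha]
    linear_combination (-(I / 3) * y * AFun (π / 3) (I * y)) * sqrt_three_sq
  · rwa [F_one_RRe hy]
  · rw [F_one_one_sub_RRe hy, F_one_RRe hy]
    congr 1
    field_simp

end SixVertex

end

theorem mainTheorem5 :
    -- the parameter `α = π/3` is the case `γ = 1`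
    (-2 * Complex.cos (2 * (Real.pi / 3 : ℂ)) = 1) ∧
    -- identities between functions on the upper half-plane
    (∀ τ : ℂ, 0 < τ.im →
      SixVertex.theta (Real.pi / 3) τ = (Real.sqrt 3 : ℂ) * ModularForm.eta (3 * τ) ∧
      SixVertex.theta (Real.pi / 3) τ ≠ 0 ∧
      HasSum (fun n : ℕ => 6 * (SixVertex.nome τ ^ (n + 1) /
          (1 + SixVertex.nome τ ^ (n + 1) + SixVertex.nome τ ^ (2 * (n + 1)))))
        ((Real.sqrt 3 : ℂ) * SixVertex.AFun (Real.pi / 3) τ - 1) ∧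
      HasSum (SixVertex.latticeTerm 0 τ)
        ((Real.sqrt 3 : ℂ) * SixVertex.AFun (Real.pi / 3) τ) ∧
      Summable (SixVertex.latticeTerm (1 / 3) τ) ∧
      SixVertex.hFun τ ≠ 0 ∧
      (SixVertex.thetaD 1 (Real.pi / 3) τ ≠ 0 →
        1 + 27 * SixVertex.hFun τ ≠ 0 ∧
        SixVertex.RFun (Real.pi / 3) τ =
          SixVertex.hFun τ / (1 + 27 * SixVertex.hFun τ) ∧
        SixVertex.latticeSum 0 τ ≠ 0 ∧
        SixVertex.RFun (Real.pi / 3) τ =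
          1 / 27 * (SixVertex.latticeSum (1 / 3) τ / SixVertex.latticeSum 0 τ) ^ 3 ∧
        SixVertex.D (SixVertex.RFun (Real.pi / 3)) τ ≠ 0 ∧
        SixVertex.SFun (Real.pi / 3) τ / 6 =
          (1 + 27 * SixVertex.hFun τ) ^ 2 / SixVertex.hFun τ ∧
        SixVertex.RFun (Real.pi / 3) τ * (1 - 27 * SixVertex.RFun (Real.pi / 3) τ) ≠ 0 ∧
        SixVertex.SFun (Real.pi / 3) τ / 6 =
          1 / (SixVertex.RFun (Real.pi / 3) τ *
            (1 - 27 * SixVertex.RFun (Real.pi / 3) τ)))) ∧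
    -- identities between formal power series; `T`, `R`, `A` are series in `q`
    (∃ T R A : PowerSeries ℂ,
      SixVertex.IsQExpansion T (SixVertex.tFun (Real.pi / 3)) ∧
      SixVertex.IsQExpansion R (SixVertex.RFun (Real.pi / 3)) ∧
      SixVertex.IsQExpansion A (SixVertex.AFun (Real.pi / 3)) ∧
      PowerSeries.coeff 0 T = 0 ∧ PowerSeries.coeff 1 T = 1 ∧
      PowerSeries.coeff 0 R = 0 ∧ PowerSeries.coeff 1 R = 1 ∧
      T = R * PowerSeries.subst ((27 : ℂ) • R) (SixVertex.hypSeries (1 / 3) (2 / 3) 2) ∧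
      (Real.sqrt 3 : ℂ) • A =
        PowerSeries.subst ((27 : ℂ) • R) (SixVertex.hypSeries (1 / 3) (2 / 3) 1) ∧
      -- `q` and `R` as series in `t`
      (∃ q_t R_t : PowerSeries ℂ,
        SixVertex.IsRightInverse T q_t ∧
        (∀ s : PowerSeries ℂ, SixVertex.IsRightInverse T s → s = q_t) ∧
        R_t = PowerSeries.subst q_t R ∧
        PowerSeries.X = R_t *
          PowerSeries.subst ((27 : ℂ) • R_t) (SixVertex.hypSeries (1 / 3) (2 / 3) 2) ∧
        SixVertex.IsRightInverse SixVertex.binomialSeries R_t ∧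
        (∀ s : PowerSeries ℂ,
          SixVertex.IsRightInverse SixVertex.binomialSeries s → s = R_t)) ∧
      -- `q`, `t` and `A` as series in `R`
      (∃ q_R t_R A_R : PowerSeries ℂ,
        SixVertex.IsRightInverse R q_R ∧
        (∀ s : PowerSeries ℂ, SixVertex.IsRightInverse R s → s = q_R) ∧
        t_R = PowerSeries.subst q_R T ∧
        A_R = PowerSeries.subst q_R A ∧
        PowerSeries.X * (1 - 27 * PowerSeries.X) *
          PowerSeries.derivative ℂ (PowerSeries.derivative ℂ t_R) = 6 * t_R ∧
        t_R = PowerSeries.X * PowerSeries.subst ((27 : ℂ) • (PowerSeries.X : PowerSeries ℂ))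
          (SixVertex.hypSeries (1 / 3) (2 / 3) 2) ∧
        PowerSeries.X * (1 - 27 * PowerSeries.X) *
            PowerSeries.derivative ℂ (PowerSeries.derivative ℂ A_R) +
          (1 - 54 * PowerSeries.X) * PowerSeries.derivative ℂ A_R - 6 * A_R = 0 ∧
        (Real.sqrt 3 : ℂ) • A_R =
          PowerSeries.subst ((27 : ℂ) • (PowerSeries.X : PowerSeries ℂ))
            (SixVertex.hypSeries (1 / 3) (2 / 3) 1))) ∧
    -- the two solutions of the differential equation for `A` on `0 < R < 1/27`
    (AnalyticOnNhd ℝ (fun x => SixVertex.F 1 (27 * x)) (Set.Ioo 0 (1 / 27)) ∧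
      AnalyticOnNhd ℝ (fun x => SixVertex.F 1 (1 - 27 * x)) (Set.Ioo 0 (1 / 27)) ∧
      (∀ x ∈ Set.Ioo (0 : ℝ) (1 / 27),
        SixVertex.hypOperator (fun y => SixVertex.F 1 (27 * y)) x = 0 ∧
        SixVertex.hypOperator (fun y => SixVertex.F 1 (1 - 27 * y)) x = 0) ∧
      (∀ a b : ℝ, (∀ x ∈ Set.Ioo (0 : ℝ) (1 / 27),
        a * SixVertex.F 1 (27 * x) + b * SixVertex.F 1 (1 - 27 * x) = 0) → a = 0 ∧ b = 0)) ∧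
    -- `0 < q < 1`, that is `τ = iy` with `y > 0`: `R` is a real number `r` in `(0, 1/27)`
    (∀ y : ℝ, 0 < y → ∃ r : ℝ, 0 < r ∧ 27 * r < 1 ∧
      SixVertex.RFun (Real.pi / 3) (Complex.I * y) = r ∧
      SixVertex.tFun (Real.pi / 3) (Complex.I * y) = ((r * SixVertex.F 2 (27 * r) : ℝ) : ℂ) ∧
      (Real.sqrt 3 : ℂ) * SixVertex.AFun (Real.pi / 3) (Complex.I * y) =
        (SixVertex.F 1 (27 * r) : ℂ) ∧
      Complex.I * y * SixVertex.AFun (Real.pi / 3) (Complex.I * y) =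
        Complex.I / 3 * (SixVertex.F 1 (1 - 27 * r) : ℂ) ∧
      SixVertex.F 1 (27 * r) ≠ 0 ∧
      Real.exp (-2 * Real.pi * y) =
        Real.exp (-(2 * Real.pi / Real.sqrt 3) *
          (SixVertex.F 1 (1 - 27 * r) / SixVertex.F 1 (27 * r)))) := by
  refine ⟨by
      rw [show (2 * (Real.pi / 3 : ℂ)) = Real.pi - Real.pi / 3 by ring, Complex.cos_pi_sub,
        SixVertex.cos_pi_div_three']
      norm_num, fun τ hτ => ⟨SixVertex.theta_third hτ, SixVertex.theta_third_ne_zero hτ,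
    SixVertex.hasSum_lambert hτ, SixVertex.hasSum_lattice_zero hτ,
    (SixVertex.hasSum_latPhi_third hτ).summable, SixVertex.hFun_ne_zero hτ, fun h1 => ?_⟩, ?_, ?_,
    ?_⟩
  · have hA := SixVertex.AFun_ne_zero hτ h1
    have hp := SixVertex.RFun_mul_ne_zero hτ hA
    refine ⟨SixVertex.one_add_hFun_ne_zero hτ hA, SixVertex.RFun_eq_hFun hτ hA, ?_,
      SixVertex.RFun_eq_latticeSum hτ hA, ?_, ?_, hp, SixVertex.SFun_div_six hτ hA⟩
    · rw [SixVertex.latticeSum, (SixVertex.hasSum_lattice_zero hτ).tsum_eq]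
      exact mul_ne_zero SixVertex.sqrt_three_ne_zero hA
    · rw [SixVertex.D_RFun hτ hA]
      exact mul_ne_zero (mul_ne_zero (by norm_num) (pow_ne_zero 2 hA)) hp
    · rw [SixVertex.SFun_div_six hτ hA, SixVertex.RFun_mul_eq hτ hA, one_div_div]
  · exact SixVertex.exists_formal_expansions
  · exact ⟨SixVertex.analyticOnNhd_F_one, SixVertex.analyticOnNhd_F_one_sub,
      fun x hx => ⟨SixVertex.hypOperator_F_one hx, SixVertex.hypOperator_F_one_sub hx⟩,
      fun a b h => SixVertex.F_one_linear_independent h⟩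
  · exact fun y hy => SixVertex.exists_real_values hy
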